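/- **Theorem (Intertwining Property of the Kalkman transformation).** Let $G$ be a compact Lie group acting smoothly on a finite-dimensional smooth manifold $M$. Let $\mathfrak g=T_1G$, and for $\xi\in\mathfrak g$ let $X_\xi(x)=\frac{d}{dt}\big|_{t=0}\exp(t\xi)\cdot x$. Give $\mathfrak g$ the bracket of right-invariant vector fields on $G$, the one for which $[X_\xi,X_\eta]=X_{[\xi,\eta]}$. Fix a basis $(e_a)$ of $\mathfrak g$ with $[e_b,e_c]=f^a_{bc}e_a$, and write $X_a=X_{e_a}$. *Weil model.* Let $W(\mathfrak g)=\Lambda(\mathfrak g^*)\otimes S(\mathfrak g^*)$ with the generators $\theta^a$ (degree $1$) and $\phi^a$ (degree $2$) dual to $(e_a)$, and let $d_W$ be the odd derivation with $$d_W\theta^a=\phi^a-\tfrac12 f^a_{bc}\theta^b\theta^c,\qquad d_W\phi^a=-f^a_{bc}\theta^b\phi^c .$$ On $W(\mathfrak g)\otimes\Omega^\bullet(M)$ let $D=d_W\otimes1+1\otimes d$ and $I_a=\iota_{e_a}\otimes1+1\otimes\iota_{X_a}$, where $\iota_{e_a}$ is the odd derivation of $W(\mathfrak g)$ with $\iota_{e_a}\theta^c=\delta_a^c$,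 $\iota_{e_a}\phi^c=0$, and where $(1\otimes B)(w\otimes\eta)=(-1)^{|w|}w\otimes B\eta$ for an odd operator $B$; let $L_a=DI_a+I_aD$. An element $\alpha$ is *basic* if $I_a\alpha=0$ and $L_a\alpha=0$ for all $a$ and $\alpha$ is invariant under $G$ (acting by the coadjoint action on $W(\mathfrak g)$ and by pullback on $\Omega^\bullet(M)$). *Cartan model.* Let $\Omega_G^\bullet(M)=(S(\mathfrak g^*)\otimes\Omega^\bullet(M))^G$, graded by form degree plus twice the polynomial degree, with $(d_G\alpha)(\xi)=d(\alpha(\xi))-\iota_{X_\xi}(\alpha(\xi))$, i.e. $d_G=1\otimes d-\phi^a\otimes\iota_{X_a}$. It is regarded as a subspace of $W(\mathfrak g)\otimes\Omega^\bullet(M)$ through the injection $s\otimes\eta\mapsto(1\otimes s)\otimes\eta$. *Kalkman transformation.* Let $\kappa=\exp(-\theta^a\otimes\iota_{X_a})$, where $\theta^a\otimes\iota_{X_a}$ stands for multiplication by $\theta^a$ followed by $1\otimes\iota_{X_a}$, that is, $(\theta^a\otimes\iota_{X_a})(w\otimes\eta)=(-1)^{|w|+1}\theta^aw\otimes\iota_{X_a}\eta$.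 Then: 1. The operator $\theta^a\otimes\iota_{X_a}$ is nilpotent, and $\kappa$ is a well-defined invertible operator on $W(\mathfrak g)\otimes\Omega^\bullet(M)$. 2. $\kappa\circ(d_W\otimes1+1\otimes d)\circ\kappa^{-1}=d_G$ on the Cartan complex $\Omega_G^\bullet(M)$. 3. $\kappa$ restricts to a bijection from the basic elements of $W(\mathfrak g)\otimes\Omega^\bullet(M)$ onto $\Omega_G^\bullet(M)$, and, for every $k$, from the basic elements of degree $k$ onto $\Omega_G^k(M)$. 4. The basic elements with $D$, and $\Omega_G^\bullet(M)$ with $d_G$, are cochain complexes, and $\kappa$ induces isomorphisms $H^k_{G,\mathrm{Weil}}(M)\cong H^k_{G,\mathrm{Cartan}}(M)$ for all $k$. 5. If $G$ is connected, the $G$-invariance in the definition of a basic element is automatic: $I_a\alpha=0$ and $L_a\alpha=0$ for all $a$ suffice. -/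

import Mathlib

open scoped Manifold ContDiff TensorProduct DirectSum
open Module
set_option maxSynthPendingDepth 3

noncomputable section
namespace EquivCoh

section Forms

variable {E : Type*} [NormedAddCommGroup E] [NormedSpace ℝ E]
  {M : Type*} [TopologicalSpace M] [ChartedSpace E M]

/-- Forms on a finite-dimensional space depend smoothly on a parameter iff all their values do. -/
theorem contDiffOn_alternating_iff [FiniteDimensional ℝ E] {X : Type*} [NormedAddCommGroup X]
    [NormedSpace ℝ X] {k : ℕ} {f : X → E [⋀^Fin k]→L[ℝ] ℝ} {s : Set X} :
    ContDiffOn ℝ ∞ f s ↔ ∀ v : Fin k → E, ContDiffOn ℝ ∞ (fun x => f x v) s := by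
  constructor
  · intro h v
    exact (ContinuousAlternatingMap.apply ℝ E ℝ v).contDiff.comp_contDiffOn h
  · intro h
    let b := Module.finBasis ℝ E
    let L : (E [⋀^Fin k]→L[ℝ] ℝ) →ₗ[ℝ] ((Fin k → Fin (Module.finrank ℝ E)) → ℝ) :=
      { toFun := fun η r => η (fun i => b (r i))
        map_add' := fun _ _ => rfl
        map_smul' := fun _ _ => rfl }
    have hL : LinearMap.ker L = ⊥ := by
      rw [LinearMap.ker_eq_bot]
      intro η η₂ h
      apply ContinuousAlternatingMap.toAlternatingMap_injective
      apply AlternatingMap.coe_multilinearMap_injective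
      refine Basis.ext_multilinear (fun _ => b) fun r => ?_
      exact congrFun h r
    obtain ⟨R, hR⟩ := LinearMap.exists_leftInverse_of_injective L hL
    have : f = fun x => R.toContinuousLinearMap (L (f x)) := by
      funext x
      exact (LinearMap.congr_fun hR (f x)).symm
    rw [this]
    refine (ContinuousLinearMap.contDiff _).comp_contDiffOn ?_
    rw [contDiffOn_pi]
    intro r
    exact h _

theorem contDiffOn_alternating_comp [FiniteDimensional ℝ E] {X : Type*} [NormedAddCommGroup X]
    [NormedSpace ℝ X] {k : ℕ} {f : X → E [⋀^Fin k]→L[ℝ] ℝ} {A : X → E →L[ℝ] E} {s : Set X}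
    (hf : ContDiffOn ℝ ∞ f s) (hA : ContDiffOn ℝ ∞ A s) :
    ContDiffOn ℝ ∞ (fun x => (f x).compContinuousLinearMap (A x)) s := by
  rw [contDiffOn_alternating_iff]
  intro v
  have h1 : ContDiffOn ℝ ∞ (fun x =>
      ContinuousMultilinearMap.compContinuousLinearMapContinuousMultilinear ℝ
        (fun _ : Fin k => E) (fun _ : Fin k => E) ℝ (fun _ => A x)) s :=
    (ContinuousMultilinearMap.contDiff _).comp_contDiffOn (contDiffOn_pi.2 fun _ => hA)
  have h2 : ContDiffOn ℝ ∞ (fun x => (f x).toContinuousMultilinearMap) s :=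
    (ContinuousAlternatingMap.toContinuousMultilinearMapCLM (𝕜 := ℝ) (E := E) (F := ℝ) (ι := Fin k)
      ℝ).contDiff.comp_contDiffOn hf
  exact (ContinuousMultilinearMap.apply ℝ (fun _ : Fin k => E) ℝ v).contDiff.comp_contDiffOn
    (h1.clm_apply h2)

variable (E M) in
/-- Differential `k`-forms on `M` without any smoothness: families of alternating `k`-linear forms
on the tangent spaces -/
def RawForm (k : ℕ) : Type _ := ∀ x : M, TangentSpace 𝓘(ℝ, E) x [⋀^Fin k]→L[ℝ] ℝ

instance (k : ℕ) : AddCommGroup (RawForm E M k) :=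
  inferInstanceAs (AddCommGroup (∀ x : M, TangentSpace 𝓘(ℝ, E) x [⋀^Fin k]→L[ℝ] ℝ))

instance (k : ℕ) : Module ℝ (RawForm E M k) :=
  inferInstanceAs (Module ℝ (∀ x : M, TangentSpace 𝓘(ℝ, E) x [⋀^Fin k]→L[ℝ] ℝ))

/-- The coordinate expression, in the chart `e`, of a (not necessarily smooth) differential
`k`-form `η` on `M`, i.e. its pullback along `e.symm`. -/
def localRep {k : ℕ} (η : RawForm E M k)
    (e : OpenPartialHomeomorph M E) (y : E) : E [⋀^Fin k]→L[ℝ] ℝ :=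
  (η (e.symm y)).compContinuousLinearMap (mfderiv 𝓘(ℝ, E) 𝓘(ℝ, E) e.symm y)

variable (E M) in
/-- `Ω^k(M)`: smooth differential `k`-forms -/
def Form (k : ℕ) : Submodule ℝ (RawForm E M k) where
  carrier := {η | ∀ e ∈ atlas E M, ContDiffOn ℝ ∞ (localRep η e) e.target}
  add_mem' := fun h h' e he => (h e he).add (h' e he)
  zero_mem' := fun _ _ => contDiffOn_const (c := 0)
  smul_mem' := fun c _ h e he => (h e he).const_smul c


/-- Pullback of a (not necessarily smooth) `k`-form along a map. -/
def rawPullback {k : ℕ} (f : M → M) (η : RawForm E M k) :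
    RawForm E M k :=
  fun x => (η (f x)).compContinuousLinearMap (mfderiv 𝓘(ℝ, E) 𝓘(ℝ, E) f x)

theorem localRep_rawPullback [IsManifold 𝓘(ℝ, E) ∞ M] {k : ℕ} {f : M → M}
    (hf : ContMDiff 𝓘(ℝ, E) 𝓘(ℝ, E) ∞ f)
    (η : RawForm E M k)
    {e e' : OpenPartialHomeomorph M E} (he : e ∈ atlas E M) (he' : e' ∈ atlas E M)
    {y : E} (hy : y ∈ e.target) (hy' : f (e.symm y) ∈ e'.source) :
    localRep (rawPullback f η) e y =
      (localRep η e' (e' (f (e.symm y)))).compContinuousLinearMap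
        (fderiv ℝ (fun z => e' (f (e.symm z))) y) := by
  have hI : IsManifold 𝓘(ℝ, E) 1 M := IsManifold.of_le (n := ∞) (by norm_num)
  have h1 : MDifferentiableAt 𝓘(ℝ, E) 𝓘(ℝ, E) e.symm y := mdifferentiableAt_atlas_symm he hy
  have h2 : MDifferentiableAt 𝓘(ℝ, E) 𝓘(ℝ, E) f (e.symm y) :=
    hf.mdifferentiableAt (by simp)
  have h3 : MDifferentiableAt 𝓘(ℝ, E) 𝓘(ℝ, E) e' (f (e.symm y)) := mdifferentiableAt_atlas he' hy'
  have h4 : MDifferentiableAt 𝓘(ℝ, E) 𝓘(ℝ, E) e'.symm (e' (f (e.symm y))) :=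
    mdifferentiableAt_atlas_symm he' (e'.map_source hy')
  have h12 : MDifferentiableAt 𝓘(ℝ, E) 𝓘(ℝ, E) (fun z => f (e.symm z)) y := h2.comp y h1
  have h123 : MDifferentiableAt 𝓘(ℝ, E) 𝓘(ℝ, E) (fun z => e' (f (e.symm z))) y := h3.comp y h12
  have hev : (fun z => f (e.symm z)) =ᶠ[nhds y] (e'.symm ∘ fun z => e' (f (e.symm z))) := by
    have hc : ContinuousAt (fun z => f (e.symm z)) y := h12.continuousAt
    filter_upwards [hc.preimage_mem_nhds (e'.open_source.mem_nhds hy')] with z hz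
    exact (e'.left_inv hz).symm
  have hA : (mfderiv 𝓘(ℝ, E) 𝓘(ℝ, E) f (e.symm y)).comp (mfderiv 𝓘(ℝ, E) 𝓘(ℝ, E) e.symm y) =
      mfderiv 𝓘(ℝ, E) 𝓘(ℝ, E) (fun z => f (e.symm z)) y := (mfderiv_comp y h2 h1).symm
  have hB : (mfderiv 𝓘(ℝ, E) 𝓘(ℝ, E) (fun z => f (e.symm z)) y : E →L[ℝ] E) =
      (mfderiv 𝓘(ℝ, E) 𝓘(ℝ, E) e'.symm (e' (f (e.symm y))) : E →L[ℝ] E).comp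
        (fderiv ℝ (fun z => e' (f (e.symm z))) y) := by
    have h6 : mfderiv 𝓘(ℝ, E) 𝓘(ℝ, E) (fun z => e' (f (e.symm z))) y =
        fderiv ℝ (fun z => e' (f (e.symm z))) y := mfderiv_eq_fderiv
    exact (hev.mfderiv_eq.trans (mfderiv_comp y h4 h123)).trans
      (congrArg (fun A : E →L[ℝ] E =>
        (mfderiv 𝓘(ℝ, E) 𝓘(ℝ, E) e'.symm (e' (f (e.symm y))) : E →L[ℝ] E).comp A) h6)
  let η' : M → E [⋀^Fin k]→L[ℝ] ℝ := η
  have h5 : η' (e'.symm (e' (f (e.symm y)))) = η' (f (e.symm y)) := by rw [e'.left_inv hy']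
  ext v
  have hL : localRep (rawPullback f η) e y v = η' (f (e.symm y)) (fun i =>
      ((mfderiv 𝓘(ℝ, E) 𝓘(ℝ, E) f (e.symm y)).comp (mfderiv 𝓘(ℝ, E) 𝓘(ℝ, E) e.symm y)) (v i)) :=
    rfl
  rw [hL, hA, ← h5]
  change _ = η' (e'.symm (e' (f (e.symm y)))) (fun i =>
    ((mfderiv 𝓘(ℝ, E) 𝓘(ℝ, E) e'.symm (e' (f (e.symm y))) : E →L[ℝ] E).comp
        (fderiv ℝ (fun z => e' (f (e.symm z))) y)) (v i))
  rw [← hB]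
  rfl

theorem rawPullback_id {k : ℕ} (η : RawForm E M k) :
    rawPullback (fun x => x) η = η := by
  funext x
  ext v
  have : mfderiv 𝓘(ℝ, E) 𝓘(ℝ, E) (fun x : M => x) x = ContinuousLinearMap.id ℝ _ := mfderiv_id
  simp [rawPullback, this]

theorem localRep_change [IsManifold 𝓘(ℝ, E) ∞ M] {k : ℕ}
    (η : RawForm E M k)
    {e e' : OpenPartialHomeomorph M E} (he : e ∈ atlas E M) (he' : e' ∈ atlas E M)
    {y : E} (hy : y ∈ e.target) (hy' : e.symm y ∈ e'.source) :
    localRep η e y =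
      (localRep η e' (e' (e.symm y))).compContinuousLinearMap
        (fderiv ℝ (fun z => e' (e.symm z)) y) := by
  have := localRep_rawPullback (f := fun x : M => x) contMDiff_id η he he' hy hy'
  rwa [rawPullback_id] at this

/-- The coordinate expression of a smooth map is smooth. -/
theorem contDiffAt_coord [IsManifold 𝓘(ℝ, E) ∞ M] {f : M → M}
    (hf : ContMDiff 𝓘(ℝ, E) 𝓘(ℝ, E) ∞ f)
    {e e' : OpenPartialHomeomorph M E} (he : e ∈ atlas E M) (he' : e' ∈ atlas E M)
    {y : E} (hy : y ∈ e.target) (hy' : f (e.symm y) ∈ e'.source) :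
    ContDiffAt ℝ ∞ (fun z => e' (f (e.symm z))) y := by
  rw [← contMDiffAt_iff_contDiffAt]
  have h1 : ContMDiffAt 𝓘(ℝ, E) 𝓘(ℝ, E) ∞ e.symm y :=
    (contMDiffOn_symm_of_mem_maximalAtlas (IsManifold.subset_maximalAtlas he)).contMDiffAt
      (e.open_target.mem_nhds hy)
  have h3 : ContMDiffAt 𝓘(ℝ, E) 𝓘(ℝ, E) ∞ e' (f (e.symm y)) :=
    (contMDiffOn_of_mem_maximalAtlas (IsManifold.subset_maximalAtlas he')).contMDiffAt
      (e'.open_source.mem_nhds hy')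
  have h2 : ContMDiffAt 𝓘(ℝ, E) 𝓘(ℝ, E) ∞ (fun z => f (e.symm z)) y :=
    (hf (e.symm y)).comp y h1
  exact h3.comp y h2

/-- The exterior derivative of a `k`-form, computed at each point in the preferred chart there. -/
def rawD {k : ℕ} (η : RawForm E M k) :
    RawForm E M (k + 1) :=
  fun x => (extDeriv (localRep η (chartAt E x)) (chartAt E x x)).compContinuousLinearMap
    (mfderiv 𝓘(ℝ, E) 𝓘(ℝ, E) (chartAt E x) x)

/-- The exterior derivative is given by the usual formula in every chart. -/
theorem localRep_rawD [IsManifold 𝓘(ℝ, E) ∞ M] {k : ℕ} (η : Form E M k)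
    {e : OpenPartialHomeomorph M E} (he : e ∈ atlas E M) {y : E} (hy : y ∈ e.target) :
    localRep (rawD η.1) e y = extDeriv (localRep η.1 e) y := by
  have hI : IsManifold 𝓘(ℝ, E) 1 M := IsManifold.of_le (n := ∞) (by norm_num)
  set x := e.symm y with hx
  set c := chartAt E x with hc
  have hcx : x ∈ c.source := mem_chart_source E x
  have hca : c ∈ atlas E M := chart_mem_atlas E x
  have h1 : MDifferentiableAt 𝓘(ℝ, E) 𝓘(ℝ, E) e.symm y := mdifferentiableAt_atlas_symm he hy
  have h3 : MDifferentiableAt 𝓘(ℝ, E) 𝓘(ℝ, E) c (e.symm y) := mdifferentiableAt_atlas hca hcx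
  have hev : localRep η.1 e =ᶠ[nhds y] fun z =>
      (localRep η.1 c (c (e.symm z))).compContinuousLinearMap
        (fderiv ℝ (fun z => c (e.symm z)) z) := by
    filter_upwards [e.open_target.mem_nhds hy,
      h1.continuousAt.preimage_mem_nhds (c.open_source.mem_nhds hcx)] with z hz hz'
    exact localRep_change η.1 he hca hz hz'
  rw [hev.extDeriv_eq]
  have hsm : ContDiffAt ℝ ∞ (fun z => c (e.symm z)) y :=
    contDiffAt_coord (f := fun x : M => x) contMDiff_id he hca hy hcx
  have hη : DifferentiableAt ℝ (localRep η.1 c) (c (e.symm y)) :=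
    ((η.2 c hca).contDiffAt (c.open_target.mem_nhds (c.map_source hcx))).differentiableAt (by simp)
  refine Eq.trans ?_ (extDeriv_pullback (f := fun z => c (e.symm z)) hη hsm ?_).symm
  · have hA : (fderiv ℝ (fun z => c (e.symm z)) y : E →L[ℝ] E) =
        (mfderiv 𝓘(ℝ, E) 𝓘(ℝ, E) c (e.symm y)).comp (mfderiv 𝓘(ℝ, E) 𝓘(ℝ, E) e.symm y) := by
      rw [← mfderiv_eq_fderiv]
      exact mfderiv_comp y h3 h1
    rw [hA]
    rfl
  · simp only [minSmoothness_of_isRCLikeNormedField]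
    exact ENat.LEInfty.out

theorem rawD_mem [IsManifold 𝓘(ℝ, E) ∞ M] {k : ℕ} (η : Form E M k) :
    rawD η.1 ∈ Form E M (k + 1) := by
  intro e he
  have h1 : ContDiffOn ℝ ∞ (fun y => fderiv ℝ (localRep η.1 e) y) e.target :=
    (η.2 e he).fderiv_of_isOpen e.open_target (by simp)
  have h2 := (ContinuousAlternatingMap.alternatizeUncurryFinCLM (n := k) ℝ E ℝ).contDiff
    (n := ∞) |>.comp_contDiffOn h1
  exact h2.congr fun y hy => localRep_rawD η he hy

/-- The exterior derivative `d : Ω^k(M) → Ω^{k+1}(M)` -/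
def extD [IsManifold 𝓘(ℝ, E) ∞ M] (k : ℕ) : Form E M k →ₗ[ℝ] Form E M (k + 1) where
  toFun η := ⟨rawD η.1, rawD_mem η⟩
  map_add' η θ := by
    apply Subtype.ext
    funext x
    have hd : ∀ ζ : Form E M k,
        DifferentiableAt ℝ (localRep ζ.1 (chartAt E x)) (chartAt E x x) := fun ζ =>
      ((ζ.2 _ (chart_mem_atlas E x)).contDiffAt
        ((chartAt E x).open_target.mem_nhds (mem_chart_target E x))).differentiableAt (by simp)
    refine Eq.trans ?_ (congrArg (fun A : E [⋀^Fin (k + 1)]→L[ℝ] ℝ =>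
      A.compContinuousLinearMap (mfderiv 𝓘(ℝ, E) 𝓘(ℝ, E) (chartAt E x) x : E →L[ℝ] E))
        (extDeriv_add (hd η) (hd θ)))
    rfl
  map_smul' c η := by
    apply Subtype.ext
    funext x
    refine Eq.trans ?_ (congrArg (fun A : E [⋀^Fin (k + 1)]→L[ℝ] ℝ =>
      A.compContinuousLinearMap (mfderiv 𝓘(ℝ, E) 𝓘(ℝ, E) (chartAt E x) x : E →L[ℝ] E))
        (extDeriv_smul c (localRep η.1 (chartAt E x))))
    rfl

theorem rawPullback_mem [FiniteDimensional ℝ E] [IsManifold 𝓘(ℝ, E) ∞ M] {f : M → M}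
    (hf : ContMDiff 𝓘(ℝ, E) 𝓘(ℝ, E) ∞ f) {k : ℕ} (η : Form E M k) :
    rawPullback f η.1 ∈ Form E M k := by
  intro e he y hy
  set c := chartAt E (f (e.symm y))
  have hcx : f (e.symm y) ∈ c.source := mem_chart_source E _
  have hca : c ∈ atlas E M := chart_mem_atlas E _
  have hcont : ContinuousOn (fun z => f (e.symm z)) e.target :=
    hf.continuous.comp_continuousOn e.continuousOn_symm
  let U : Set E := e.target ∩ (fun z => f (e.symm z)) ⁻¹' c.source
  have hU : IsOpen U := hcont.isOpen_inter_preimage e.open_target c.open_source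
  have hφ : ContDiffOn ℝ ∞ (fun z => c (f (e.symm z))) U := fun z hz =>
    (contDiffAt_coord hf he hca hz.1 hz.2).contDiffWithinAt
  have hA : ContDiffOn ℝ ∞ (fun z => fderiv ℝ (fun z => c (f (e.symm z))) z) U :=
    hφ.fderiv_of_isOpen hU (by simp)
  have hB : ContDiffOn ℝ ∞ (fun z => localRep η.1 c (c (f (e.symm z)))) U :=
    (η.2 c hca).comp hφ fun z hz => c.map_source hz.2
  have hC : ContDiffOn ℝ ∞ (localRep (rawPullback f η.1) e) U :=
    (contDiffOn_alternating_comp hB hA).congr fun z hz =>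
      localRep_rawPullback hf η.1 he hca hz.1 hz.2
  exact (hC.contDiffAt (hU.mem_nhds ⟨hy, hcx⟩)).contDiffWithinAt

/-- Pullback `f^* : Ω^k(M) → Ω^k(M)` along a smooth map -/
def pullback [FiniteDimensional ℝ E] [IsManifold 𝓘(ℝ, E) ∞ M] (f : M → M)
    (hf : ContMDiff 𝓘(ℝ, E) 𝓘(ℝ, E) ∞ f) (k : ℕ) : Form E M k →ₗ[ℝ] Form E M k where
  toFun η := ⟨rawPullback f η.1, rawPullback_mem hf η⟩
  map_add' _ _ := rfl
  map_smul' _ _ := rfl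

variable (E M) in
/-- A smooth vector field on `M`, i.e. a smooth section of the tangent bundle -/
structure VField [IsManifold 𝓘(ℝ, E) ∞ M] where
  /-- the value at a point -/
  val : ∀ x : M, TangentSpace 𝓘(ℝ, E) x
  /-- smoothness -/
  smooth : ContMDiff 𝓘(ℝ, E) 𝓘(ℝ, E).tangent ∞
    (fun x : M => (⟨x, val x⟩ : TangentBundle 𝓘(ℝ, E) M))

/-- Contraction of a (not necessarily smooth) form with a vector field in the first argument -/
def rawContract {k : ℕ} (X : ∀ x : M, TangentSpace 𝓘(ℝ, E) x)
    (η : RawForm E M (k + 1)) :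
    RawForm E M k :=
  fun x => ContinuousAlternatingMap.curryLeft (E := E) (η x) (X x)

theorem rawContract_mem [IsManifold 𝓘(ℝ, E) ∞ M] {k : ℕ} (X : VField E M)
    (η : Form E M (k + 1)) : rawContract X.val η.1 ∈ Form E M k := by
  intro e he
  have hde : e.MDifferentiable 𝓘(ℝ, E) 𝓘(ℝ, E) := mdifferentiable_of_mem_atlas he
  let Y : E → E := fun y => mfderiv 𝓘(ℝ, E) 𝓘(ℝ, E) e (e.symm y) (X.val (e.symm y))
  have hY : ContDiffOn ℝ ∞ Y e.target := by
    rw [← contMDiffOn_iff_contDiffOn]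
    have h1 : ContMDiffOn 𝓘(ℝ, E) 𝓘(ℝ, E) ∞ e.symm e.target :=
      contMDiffOn_symm_of_mem_maximalAtlas (IsManifold.subset_maximalAtlas he)
    have h2 : ContMDiffOn 𝓘(ℝ, E) 𝓘(ℝ, E) ∞ e e.source :=
      contMDiffOn_of_mem_maximalAtlas (IsManifold.subset_maximalAtlas he)
    have h3 := h2.contMDiffOn_tangentMapWithin (m := ∞) le_rfl e.open_source.uniqueMDiffOn
    have h4 := h3.comp (X.smooth.comp_contMDiffOn h1) (fun y hy => e.map_target hy)
    have h5 := (contMDiff_snd_tangentBundle_modelSpace E 𝓘(ℝ, E)).comp_contMDiffOn h4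
    refine h5.congr fun y hy => ?_
    have : mfderivWithin 𝓘(ℝ, E) 𝓘(ℝ, E) e e.source (e.symm y) =
        mfderiv 𝓘(ℝ, E) 𝓘(ℝ, E) e (e.symm y) :=
      mfderivWithin_of_isOpen e.open_source (e.map_target hy)
    simp only [Y, Function.comp, tangentMapWithin]
    rw [this]
  have hcl : IsBoundedLinearMap ℝ
      (fun f : E [⋀^Fin (k + 1)]→L[ℝ] ℝ => ContinuousAlternatingMap.curryLeft f) :=
    { map_add := ContinuousAlternatingMap.curryLeft_add
      map_smul := ContinuousAlternatingMap.curryLeft_smul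
      bound := ⟨1, one_pos, fun f => by
        rw [ContinuousAlternatingMap.norm_curryLeft, one_mul]⟩ }
  have h6 := (IsBoundedLinearMap.contDiff (F := E →L[ℝ] E [⋀^Fin k]→L[ℝ] ℝ) (n := ∞)
    hcl).comp_contDiffOn (η.2 e he)
  have : ContDiffOn ℝ ∞ (fun y => (localRep η.1 e y).curryLeft (Y y)) e.target :=
    h6.clm_apply hY
  refine this.congr fun y hy => ?_
  have hid : mfderiv 𝓘(ℝ, E) 𝓘(ℝ, E) e.symm y (Y y) = X.val (e.symm y) := by
    have h0 := hde.symm_comp_deriv (e.map_target hy)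
    rw [e.right_inv hy] at h0
    exact congrArg (fun A => A (X.val (e.symm y))) h0
  ext v
  simp only [localRep, rawContract]
  change (η.1 (e.symm y)) (Matrix.vecCons (X.val (e.symm y)) fun i =>
    mfderiv 𝓘(ℝ, E) 𝓘(ℝ, E) e.symm y (v i)) = (η.1 (e.symm y)) fun i =>
      mfderiv 𝓘(ℝ, E) 𝓘(ℝ, E) e.symm y (Matrix.vecCons (Y y) v i)
  rw [← hid]
  congr 1
  funext i
  refine Fin.cases ?_ (fun j => ?_) i <;> rfl

/-- Contraction `ι_X : Ω^{k+1}(M) → Ω^k(M)` -/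
def contract [IsManifold 𝓘(ℝ, E) ∞ M] (X : VField E M) (k : ℕ) :
    Form E M (k + 1) →ₗ[ℝ] Form E M k where
  toFun η := ⟨rawContract X.val η.1, rawContract_mem X η⟩
  map_add' _ _ := rfl
  map_smul' _ _ := rfl

variable (E M) in
/-- `Ω(M)`, the direct sum of all `Ω^k(M)` -/
abbrev Forms : Type _ := ⨁ k, Form E M k

/-- `d` on `Ω(M)` -/
def dR [IsManifold 𝓘(ℝ, E) ∞ M] : Forms E M →ₗ[ℝ] Forms E M :=
  DirectSum.toModule ℝ ℕ _ fun k => DirectSum.lof ℝ ℕ (fun k => Form E M k) (k + 1) ∘ₗ extD k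

/-- `ι_X` on `Ω(M)`; it vanishes on functions -/
def iota [IsManifold 𝓘(ℝ, E) ∞ M] (X : VField E M) : Forms E M →ₗ[ℝ] Forms E M :=
  DirectSum.toModule ℝ ℕ _ fun k =>
    match k with
    | 0 => 0
    | k + 1 => DirectSum.lof ℝ ℕ (fun k => Form E M k) k ∘ₗ contract X k

/-- `f^*` on `Ω(M)` -/
def pull [FiniteDimensional ℝ E] [IsManifold 𝓘(ℝ, E) ∞ M] (f : M → M)
    (hf : ContMDiff 𝓘(ℝ, E) 𝓘(ℝ, E) ∞ f) : Forms E M →ₗ[ℝ] Forms E M :=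
  DirectSum.toModule ℝ ℕ _ fun k => DirectSum.lof ℝ ℕ (fun k => Form E M k) k ∘ₗ pullback f hf k

end Forms

section Action

variable {F : Type*} [NormedAddCommGroup F] [NormedSpace ℝ F]
  {G : Type*} [TopologicalSpace G] [ChartedSpace F G] [Group G] [LieGroup 𝓘(ℝ, F) ∞ G]
  {E : Type*} [NormedAddCommGroup E] [NormedSpace ℝ E]
  {M : Type*} [TopologicalSpace M] [ChartedSpace E M] [IsManifold 𝓘(ℝ, E) ∞ M]
  [MulAction G M] [ContMDiffSMul 𝓘(ℝ, F) 𝓘(ℝ, E) ∞ G M]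

variable (E M) in
/-- The fundamental vector field `X_ξ(x) = d/dt|_{t=0} exp(tξ) • x`, i.e. the image of
`ξ ∈ T_1 G` under the derivative at `1` of the orbit map `g ↦ g • x`. -/
def fundVF (ξ : GroupLieAlgebra 𝓘(ℝ, F) G) : VField E M where
  val x := (mfderiv 𝓘(ℝ, F) 𝓘(ℝ, E) (fun g : G => g • x) 1 : F →L[ℝ] E) ξ
  smooth := by
    let fg : M → TangentBundle 𝓘(ℝ, E) M := fun x => Bundle.TotalSpace.mk' E x 0
    have sfg : ContMDiff 𝓘(ℝ, E) 𝓘(ℝ, E).tangent ∞ fg := Bundle.contMDiff_zeroSection _ _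
    let fv : M → TangentBundle 𝓘(ℝ, F) G := fun _ => Bundle.TotalSpace.mk' F 1 ξ
    have sfv : ContMDiff 𝓘(ℝ, E) 𝓘(ℝ, F).tangent ∞ fv := contMDiff_const
    have S₁ := sfv.prodMk sfg
    have S₂ := (contMDiff_equivTangentBundleProd_symm (I := 𝓘(ℝ, F)) (M := G) (I' := 𝓘(ℝ, E))
      (M' := M) (n := ∞))
    have hs : ContMDiff (𝓘(ℝ, F).prod 𝓘(ℝ, E)) 𝓘(ℝ, E) ∞ (fun p : G × M => p.1 • p.2) :=
      contMDiff_smul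
    have S₃ := ContMDiff.contMDiff_tangentMap hs (m := ∞) le_rfl
    have S := (S₃.comp S₂).comp S₁
    have hxy : ∀ (p q : M) (w w' : E), p = q → w = w' →
        (⟨p, w⟩ : TangentBundle 𝓘(ℝ, E) M) = ⟨q, w'⟩ := by
      rintro p q w w' rfl rfl
      rfl
    refine S.congr fun x => ?_
    simp only [Function.comp_apply, tangentMap, fg, fv]
    rw [mfderiv_prod_eq_add_apply (hs.mdifferentiableAt (by simp))]
    refine hxy x ((1 : G) • x) _ _ (one_smul G x).symm ?_
    have h0 : (mfderiv 𝓘(ℝ, E) 𝓘(ℝ, E) (fun z : M => (1 : G) • z) x : E →L[ℝ] E) 0 = 0 :=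
      map_zero _
    let a : E := (mfderiv 𝓘(ℝ, F) 𝓘(ℝ, E) (fun g : G => g • x) 1 : F →L[ℝ] E) ξ
    exact ((congrArg (fun w : E => a + w) h0).trans (add_zero a)).symm

end Action

section Weil

variable (V : Type*) [AddCommGroup V] [Module ℝ V]

/-- `Λ(V^*)` -/
abbrev Ext : Type _ := ExteriorAlgebra ℝ (Dual ℝ V)

/-- `S(V^*)` -/
abbrev Sym : Type _ := SymmetricAlgebra ℝ (Dual ℝ V)

/-- The Weil algebra `W(V) = Λ(V^*) ⊗ S(V^*)`. As `S(V^*)` is concentrated in even degrees, its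
product as a graded-commutative algebra is the ordinary product of the tensor product. -/
abbrev Weil : Type _ := Ext V ⊗[ℝ] Sym V

variable {V} {ι : Type*} [Fintype ι] [DecidableEq ι] (b : Basis ι ℝ V)

/-- The generator `θ^a` of `Λ(V^*)`, for the basis dual to `b` -/
def theta (a : ι) : Ext V := ExteriorAlgebra.ι ℝ (b.coord a)

/-- The generator `φ^a` of `S(V^*)`, for the basis dual to `b` -/
def phi (a : ι) : Sym V := SymmetricAlgebra.ι ℝ (Dual ℝ V) (b.coord a)

/-- The contraction `ι_{e_a}` on `Λ(V^*)`: the antiderivation with `ι_{e_a} θ^c = δ_a^c` -/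
def contrExt (a : ι) : Ext V →ₗ[ℝ] Ext V :=
  CliffordAlgebra.contractLeft (Dual.eval ℝ V (b a))

/-- The derivation `∂/∂φ^a` of `S(V^*)` -/
def partialSym (a : ι) : Sym V →ₗ[ℝ] Sym V :=
  (SymmetricAlgebra.equivMvPolynomial b.dualBasis).symm.toLinearMap ∘ₗ
    (MvPolynomial.pderiv (R := ℝ) a).toLinearMap ∘ₗ
      (SymmetricAlgebra.equivMvPolynomial b.dualBasis).toLinearMap

variable (V) in
/-- The parity operator of `W(V)`: multiplication by `(-1)^p` on `Λ^p ⊗ S` -/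
def parity : Weil V →ₗ[ℝ] Weil V :=
  TensorProduct.map (CliffordAlgebra.involute (Q := (0 : QuadraticForm ℝ (Dual ℝ V)))).toLinearMap
    LinearMap.id

/-- The Weil differential for the structure constants `f a c d = f^a_{cd}`: the odd derivation
`∑_a φ^a ι_{e_a} - 1/2 ∑ f^a_{cd} θ^c θ^d ι_{e_a} - ∑ f^a_{cd} θ^c φ^d ∂/∂φ^a`. -/
def weilD (f : ι → ι → ι → ℝ) : Weil V →ₗ[ℝ] Weil V :=
  (∑ a, TensorProduct.map (contrExt b a) (LinearMap.mulLeft ℝ (phi b a)))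
  - (1 / 2 : ℝ) • (∑ a, ∑ c, ∑ d, f a c d •
      TensorProduct.map (LinearMap.mulLeft ℝ (theta b c * theta b d) ∘ₗ contrExt b a)
        LinearMap.id)
  - ∑ a, ∑ c, ∑ d, f a c d •
      TensorProduct.map (LinearMap.mulLeft ℝ (theta b c))
        (LinearMap.mulLeft ℝ (phi b d) ∘ₗ partialSym b a)

theorem partialSym_phi (a c : ι) : partialSym b a (phi b c) = if a = c then 1 else 0 := by
  have h : SymmetricAlgebra.equivMvPolynomial b.dualBasis (phi b c) = MvPolynomial.X c := by
    rw [← SymmetricAlgebra.equivMvPolynomial_ι_apply b.dualBasis c]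
    simp [phi]
  change (SymmetricAlgebra.equivMvPolynomial b.dualBasis).symm (MvPolynomial.pderiv a
    (SymmetricAlgebra.equivMvPolynomial b.dualBasis (phi b c))) = _
  rw [h, MvPolynomial.pderiv_X]
  by_cases hac : a = c
  · subst hac
    simp
  · rw [Pi.single_eq_of_ne (fun h => hac h.symm)]
    simp [hac]

theorem partialSym_one (a : ι) : partialSym b a 1 = 0 := by simp [partialSym]

theorem partialSym_mul (a : ι) (x y : Sym V) :
    partialSym b a (x * y) = partialSym b a x * y + x * partialSym b a y := by
  simp [partialSym, mul_comm, add_comm]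

theorem contrExt_theta (a c : ι) : contrExt b a (theta b c) = if a = c then 1 else 0 := by
  have : contrExt b a (theta b c) = algebraMap ℝ _ (b.coord c (b a)) :=
    CliffordAlgebra.contractLeft_ι _ (Dual.eval ℝ V (b a)) (b.coord c)
  rw [this, Basis.coord_apply, Basis.repr_self, Finsupp.single_apply]
  split_ifs <;> simp

theorem contrExt_one (a : ι) : contrExt b a 1 = 0 :=
  CliffordAlgebra.contractLeft_one _ (Dual.eval ℝ V (b a))

theorem contrExt_mul (a : ι) (x y : Ext V) :
    contrExt b a (x * y) = contrExt b a x * y + CliffordAlgebra.involute x * contrExt b a y := by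
  induction x using CliffordAlgebra.left_induction with
  | algebraMap r =>
    simp only [contrExt, CliffordAlgebra.contractLeft_algebraMap_mul,
      CliffordAlgebra.contractLeft_algebraMap, AlgHom.commutes, zero_mul, zero_add]
  | add x y hx hy => simp only [add_mul, map_add, hx, hy]; abel
  | ι_mul x m hx =>
    simp only [contrExt] at hx ⊢
    rw [mul_assoc, CliffordAlgebra.contractLeft_ι_mul, CliffordAlgebra.contractLeft_ι_mul, hx]
    simp only [map_mul, CliffordAlgebra.involute_ι, sub_mul, mul_add, neg_mul, smul_mul_assoc,
      mul_assoc]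
    abel

theorem theta_mul (c : ι) (x : Ext V) :
    theta b c * x = CliffordAlgebra.involute x * theta b c := by
  induction x using CliffordAlgebra.left_induction with
  | algebraMap r => simp only [AlgHom.commutes]; exact (Algebra.commutes r _).symm
  | add x y hx hy => simp only [mul_add, map_add, hx, hy, add_mul]
  | ι_mul x m hx =>
    have h := ExteriorAlgebra.ι_add_mul_swap (R := ℝ) (b.coord c) m
    have h' : theta b c * CliffordAlgebra.ι 0 m = - (CliffordAlgebra.ι 0 m * theta b c) :=
      eq_neg_of_add_eq_zero_left h
    rw [← mul_assoc, h', neg_mul, mul_assoc, hx, map_mul, CliffordAlgebra.involute_ι, neg_mul,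
      neg_mul, mul_assoc]

/-- `d_W θ^a = φ^a - 1/2 f^a_{cd} θ^c θ^d` -/
theorem weilD_theta (f : ι → ι → ι → ℝ) (a : ι) :
    weilD b f (theta b a ⊗ₜ 1) = 1 ⊗ₜ phi b a
      - (1 / 2 : ℝ) • ∑ c, ∑ d, f a c d • ((theta b c * theta b d) ⊗ₜ[ℝ] (1 : Sym V)) := by
  simp only [weilD, LinearMap.sub_apply, LinearMap.smul_apply, LinearMap.sum_apply,
    TensorProduct.map_tmul, LinearMap.comp_apply, LinearMap.mulLeft_apply, contrExt_theta,
    partialSym_one, mul_zero, TensorProduct.tmul_zero, smul_zero, Finset.sum_const_zero, sub_zero,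
    LinearMap.id_apply, mul_one]
  rw [Finset.sum_eq_single a, Finset.sum_eq_single (a := a)]
  · simp
  all_goals simp +contextual

/-- `d_W φ^a = - f^a_{cd} θ^c φ^d` -/
theorem weilD_phi (f : ι → ι → ι → ℝ) (a : ι) :
    weilD b f (1 ⊗ₜ phi b a) = - ∑ c, ∑ d, f a c d • (theta b c ⊗ₜ[ℝ] phi b d) := by
  simp only [weilD, LinearMap.sub_apply, LinearMap.smul_apply, LinearMap.sum_apply,
    TensorProduct.map_tmul, LinearMap.comp_apply, LinearMap.mulLeft_apply, contrExt_one,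
    partialSym_phi, mul_zero, TensorProduct.zero_tmul, smul_zero, Finset.sum_const_zero, sub_zero,
    LinearMap.id_apply, mul_one, zero_sub]
  rw [Finset.sum_eq_single (a := a)]
  · simp
  all_goals simp +contextual

/-- `d_W` is an odd derivation. -/
theorem weilD_mul (f : ι → ι → ι → ℝ) (x y : Weil V) :
    weilD b f (x * y) = weilD b f x * y + parity V x * weilD b f y := by
  induction x using TensorProduct.induction_on with
  | zero => simp
  | add x x' hx hx' => simp only [add_mul, map_add, hx, hx']; abel
  | tmul l s =>
    induction y using TensorProduct.induction_on with
    | zero => simp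
    | add y y' hy hy' => simp only [mul_add, map_add, hy, hy']; abel
    | tmul l' s' =>
      have h1 : ∀ c d : ι, theta b c * theta b d * CliffordAlgebra.involute l =
          CliffordAlgebra.involute l * (theta b c * theta b d) := fun c d => by
        rw [mul_assoc, theta_mul b d, CliffordAlgebra.involute_involute, ← mul_assoc,
          theta_mul b c l, mul_assoc]
      have h2 : ∀ a, TensorProduct.map (contrExt b a) (LinearMap.mulLeft ℝ (phi b a))
            ((l * l') ⊗ₜ[ℝ] (s * s')) =
          TensorProduct.map (contrExt b a) (LinearMap.mulLeft ℝ (phi b a)) (l ⊗ₜ s) * (l' ⊗ₜ s') +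
          parity V (l ⊗ₜ s) * TensorProduct.map (contrExt b a) (LinearMap.mulLeft ℝ (phi b a))
            (l' ⊗ₜ s') := fun a => by
        simp only [parity, TensorProduct.map_tmul, LinearMap.mulLeft_apply, contrExt_mul,
          AlgHom.toLinearMap_apply, LinearMap.id_apply, Algebra.TensorProduct.tmul_mul_tmul,
          TensorProduct.add_tmul]
        congr 2 <;> ring
      have h3 : ∀ a c d, TensorProduct.map (LinearMap.mulLeft ℝ (theta b c * theta b d) ∘ₗ
            contrExt b a) LinearMap.id ((l * l') ⊗ₜ[ℝ] (s * s')) =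
          TensorProduct.map (LinearMap.mulLeft ℝ (theta b c * theta b d) ∘ₗ
            contrExt b a) LinearMap.id (l ⊗ₜ s) * (l' ⊗ₜ s') +
          parity V (l ⊗ₜ s) * TensorProduct.map (LinearMap.mulLeft ℝ (theta b c * theta b d) ∘ₗ
            contrExt b a) LinearMap.id (l' ⊗ₜ s') := fun a c d => by
        simp only [parity, TensorProduct.map_tmul, LinearMap.mulLeft_apply, contrExt_mul,
          AlgHom.toLinearMap_apply, LinearMap.id_apply, Algebra.TensorProduct.tmul_mul_tmul,
          LinearMap.comp_apply, mul_add, TensorProduct.add_tmul]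
        rw [← mul_assoc, ← mul_assoc _ (CliffordAlgebra.involute l), h1, mul_assoc (CliffordAlgebra.involute l),
          mul_assoc]
      have h4 : ∀ a c d, TensorProduct.map (LinearMap.mulLeft ℝ (theta b c))
            (LinearMap.mulLeft ℝ (phi b d) ∘ₗ partialSym b a) ((l * l') ⊗ₜ[ℝ] (s * s')) =
          TensorProduct.map (LinearMap.mulLeft ℝ (theta b c))
            (LinearMap.mulLeft ℝ (phi b d) ∘ₗ partialSym b a) (l ⊗ₜ s) * (l' ⊗ₜ s') +
          parity V (l ⊗ₜ s) * TensorProduct.map (LinearMap.mulLeft ℝ (theta b c))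
            (LinearMap.mulLeft ℝ (phi b d) ∘ₗ partialSym b a) (l' ⊗ₜ s') := fun a c d => by
        simp only [parity, TensorProduct.map_tmul, LinearMap.mulLeft_apply, partialSym_mul,
          AlgHom.toLinearMap_apply, LinearMap.id_apply, Algebra.TensorProduct.tmul_mul_tmul,
          LinearMap.comp_apply, mul_add, TensorProduct.tmul_add]
        rw [← mul_assoc (theta b c) l l', ← mul_assoc _ (theta b c) l', theta_mul b c l]
        congr 2 <;> ring
      simp only [weilD, LinearMap.sub_apply, LinearMap.smul_apply, LinearMap.sum_apply,
        Algebra.TensorProduct.tmul_mul_tmul, h2, h3, h4, Finset.sum_add_distrib, smul_add,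
        sub_mul, mul_sub, Finset.sum_mul, Finset.mul_sum, smul_mul_assoc, mul_smul_comm]
      abel

end Weil
section Models

variable {F : Type*} [NormedAddCommGroup F] [NormedSpace ℝ F]
  {G : Type*} [TopologicalSpace G] [ChartedSpace F G] [Group G] [LieGroup 𝓘(ℝ, F) ∞ G]
  (E : Type*) [NormedAddCommGroup E] [NormedSpace ℝ E] [FiniteDimensional ℝ E]
  (M : Type*) [TopologicalSpace M] [ChartedSpace E M] [IsManifold 𝓘(ℝ, E) ∞ M]
  [MulAction G M] [ContMDiffSMul 𝓘(ℝ, F) 𝓘(ℝ, E) ∞ G M]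
  {ι : Type*} [Fintype ι] [DecidableEq ι] (b : Basis ι ℝ (GroupLieAlgebra 𝓘(ℝ, F) G))

/-- The structure constants `f^a_{cd}`, `[e_c, e_d] = f^a_{cd} e_a`, for the bracket of
right-invariant vector fields on `G`. This is the bracket on `T_1 G` for which `ξ ↦ X_ξ` is a Lie
algebra homomorphism; it is minus Mathlib's bracket `⁅_, _⁆`, which is that of left-invariant
vector fields. -/
def structConst (a c d : ι) : ℝ := b.coord a (-⁅b c, b d⁆)

variable (F G) in
/-- `W(𝔤) ⊗ Ω(M)` -/
abbrev WeilForms : Type _ := Weil (GroupLieAlgebra 𝓘(ℝ, F) G) ⊗[ℝ] Forms E M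

variable (F G) in
/-- `S(𝔤^*) ⊗ Ω(M)` -/
abbrev CartanForms : Type _ := Sym (GroupLieAlgebra 𝓘(ℝ, F) G) ⊗[ℝ] Forms E M

variable (F G) in
/-- The inclusion of `S(𝔤^*) ⊗ Ω(M)` in `W(𝔤) ⊗ Ω(M)` -/
def cartanIncl : CartanForms F G E M →ₗ[ℝ] WeilForms F G E M :=
  TensorProduct.map (TensorProduct.mk ℝ (Ext (GroupLieAlgebra 𝓘(ℝ, F) G))
    (Sym (GroupLieAlgebra 𝓘(ℝ, F) G)) 1) LinearMap.id

/-- `A ⊗ 1` on `W(𝔤) ⊗ Ω(M)` -/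
def onWeil (A : Weil (GroupLieAlgebra 𝓘(ℝ, F) G) →ₗ[ℝ] Weil (GroupLieAlgebra 𝓘(ℝ, F) G)) :
    WeilForms F G E M →ₗ[ℝ] WeilForms F G E M :=
  TensorProduct.map A LinearMap.id

variable (F G) {E M} in
/-- `1 ⊗ B` on `W(𝔤) ⊗ Ω(M)` for an odd operator `B`, with the Koszul sign:
`(1 ⊗ B)(w ⊗ η) = (-1)^|w| w ⊗ B η` -/
def onForms (B : Forms E M →ₗ[ℝ] Forms E M) : WeilForms F G E M →ₗ[ℝ] WeilForms F G E M :=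
  TensorProduct.map (parity _) B

/-- The Weil model differential `d_W ⊗ 1 + 1 ⊗ d` -/
def totalD : WeilForms F G E M →ₗ[ℝ] WeilForms F G E M :=
  onWeil E M (weilD b (structConst b)) + onForms F G dR

/-- The contraction with `e_a`: on `W(𝔤)` with `θ^a`, on `Ω(M)` with the vector field `X_a` -/
def totalContr (a : ι) : WeilForms F G E M →ₗ[ℝ] WeilForms F G E M :=
  onWeil E M (TensorProduct.map (contrExt b a) LinearMap.id) +
    onForms F G (iota (fundVF E M (b a)))

/-- The Lie derivative `L_{e_a}`: the graded commutator of the differential with the contraction -/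
def totalLie (a : ι) : WeilForms F G E M →ₗ[ℝ] WeilForms F G E M :=
  totalD E M b ∘ₗ totalContr E M b a + totalContr E M b a ∘ₗ totalD E M b

/-- `θ^a ⊗ ι_{X_a}`: multiplication by `θ^a` followed by contraction with `X_a`, i.e.
`w ⊗ η ↦ ∑_a (-1)^(|w| + 1) θ^a w ⊗ ι_{X_a} η` -/
def thetaContr : WeilForms F G E M →ₗ[ℝ] WeilForms F G E M :=
  ∑ a, onForms F G (iota (fundVF E M (b a))) ∘ₗ
    onWeil E M (LinearMap.mulLeft ℝ (theta b a ⊗ₜ[ℝ] (1 : Sym (GroupLieAlgebra 𝓘(ℝ, F) G))))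

/-- The exponential of a nilpotent operator -/
def nilExp {T : Type*} [AddCommGroup T] [Module ℝ T] (A : Module.End ℝ T) : Module.End ℝ T :=
  ∑ i ∈ Finset.range (nilpotencyClass A), ((Nat.factorial i : ℝ)⁻¹) • A ^ i

/-- The Kalkman transformation `κ = exp(-θ^a ⊗ ι_{X_a})` -/
def kalkman : Module.End ℝ (WeilForms F G E M) := nilExp (-(thetaContr E M b : Module.End ℝ _))

/-- The Cartan differential `d_G = 1 ⊗ d - φ^a ⊗ ι_{X_a}` on `S(𝔤^*) ⊗ Ω(M)` -/
def cartanD : CartanForms F G E M →ₗ[ℝ] CartanForms F G E M :=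
  TensorProduct.map LinearMap.id dR -
    ∑ a, TensorProduct.map (LinearMap.mulLeft ℝ (phi b a)) (iota (fundVF E M (b a)))

variable {E M} in
/-- The value `α(ξ)` of `α ∈ S(𝔤^*) ⊗ Ω(M)`, seen as a polynomial map `𝔤 → Ω(M)` -/
def evalAt (ξ : GroupLieAlgebra 𝓘(ℝ, F) G) : CartanForms F G E M →ₗ[ℝ] Forms E M :=
  (TensorProduct.lid ℝ (Forms E M)).toLinearMap ∘ₗ
    TensorProduct.map (SymmetricAlgebra.lift (Dual.eval ℝ _ ξ)).toLinearMap LinearMap.id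

theorem iota_fundVF_eq_sum (ξ : GroupLieAlgebra 𝓘(ℝ, F) G) :
    (iota (fundVF E M ξ) : Forms E M →ₗ[ℝ] Forms E M) =
      ∑ a, b.coord a ξ • iota (fundVF E M (b a)) := by
  apply DirectSum.linearMap_ext
  intro k
  cases k with
  | zero => ext η; simp [iota]
  | succ k =>
    ext1 η
    have h : contract (fundVF E M ξ) k η = ∑ a, b.coord a ξ • contract (fundVF E M (b a)) k η := by
      apply Subtype.ext
      funext x
      let A : F →L[ℝ] E := mfderiv 𝓘(ℝ, F) 𝓘(ℝ, E) (fun g : G => g • x) 1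
      let B : E →L[ℝ] E [⋀^Fin k]→L[ℝ] ℝ := ContinuousAlternatingMap.curryLeft (E := E) (η.1 x)
      have h1 : B (A ξ) = ∑ a, b.coord a ξ • B (A (b a)) := by
        have h2 : (B.comp A) ξ = (B.comp A) (∑ a, b.coord a ξ • b a : GroupLieAlgebra 𝓘(ℝ, F) G) :=
          congrArg _ (b.sum_repr ξ).symm
        refine h2.trans ((map_sum (B.comp A) _ _).trans ?_)
        exact Finset.sum_congr rfl fun a _ => map_smul (B.comp A) _ _
      let ev : Form E M k →ₗ[ℝ] E [⋀^Fin k]→L[ℝ] ℝ :=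
        { toFun := fun ζ => ζ.1 x, map_add' := fun _ _ => rfl, map_smul' := fun _ _ => rfl }
      have h3 : ev (∑ a, b.coord a ξ • contract (fundVF E M (b a)) k η) =
          ∑ a, b.coord a ξ • B (A (b a)) := by
        rw [map_sum]
        exact Finset.sum_congr rfl fun a _ => map_smul ev _ _
      exact h1.trans h3.symm
    simp only [iota, LinearMap.comp_apply, DirectSum.toModule_lof, h, map_sum, map_smul,
      LinearMap.sum_apply, LinearMap.smul_apply]

/-- `(d_G α)(ξ) = d(α(ξ)) - ι_{X_ξ}(α(ξ))` -/
theorem evalAt_cartanD (ξ : GroupLieAlgebra 𝓘(ℝ, F) G) (α : CartanForms F G E M) :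
    evalAt ξ (cartanD E M b α) = dR (evalAt ξ α) - iota (fundVF E M ξ) (evalAt ξ α) := by
  rw [iota_fundVF_eq_sum E M b ξ]
  induction α using TensorProduct.induction_on with
  | zero => simp
  | add x y hx hy => simp only [map_add, hx, hy]; abel
  | tmul s η =>
    simp only [cartanD, evalAt, phi, LinearMap.sub_apply, LinearMap.sum_apply, LinearMap.comp_apply,
      TensorProduct.map_tmul, map_sub, map_sum, LinearEquiv.coe_coe, TensorProduct.lid_tmul,
      LinearMap.id_apply, LinearMap.mulLeft_apply, AlgHom.toLinearMap_apply, map_mul,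
      SymmetricAlgebra.lift_ι_apply, Dual.eval_apply, map_smul, LinearMap.smul_apply, mul_smul]
    congr 1
    rw [Finset.smul_sum]
    exact Finset.sum_congr rfl fun a _ => smul_comm _ _ _

/-- The adjoint action `Ad_g` of `G` on its Lie algebra -/
def Ad (g : G) : GroupLieAlgebra 𝓘(ℝ, F) G →ₗ[ℝ] GroupLieAlgebra 𝓘(ℝ, F) G :=
  (mfderiv 𝓘(ℝ, F) 𝓘(ℝ, F) (fun h : G => g * h * g⁻¹) 1 : F →L[ℝ] F).toLinearMap

variable (F) in
/-- The coadjoint action `(g • λ)(ξ) = λ(Ad_{g⁻¹} ξ)` -/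
def coadj (g : G) :
    Dual ℝ (GroupLieAlgebra 𝓘(ℝ, F) G) →ₗ[ℝ] Dual ℝ (GroupLieAlgebra 𝓘(ℝ, F) G) :=
  (Ad g⁻¹).dualMap

variable (F) in
/-- The action of `G` on `Ω(M)`, `g • η = (g⁻¹)^* η` -/
def actForms (g : G) : Forms E M →ₗ[ℝ] Forms E M :=
  pull (fun x : M => g⁻¹ • x)
    ((contMDiff_smul (I := 𝓘(ℝ, F)) (I' := 𝓘(ℝ, E)) (n := ∞) (G := G) (M := M)).comp
      (contMDiff_const.prodMk contMDiff_id))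

variable (F) in
/-- The action of `G` on `S(𝔤^*)` induced by the coadjoint action -/
def actSym (g : G) :
    Sym (GroupLieAlgebra 𝓘(ℝ, F) G) →ₗ[ℝ] Sym (GroupLieAlgebra 𝓘(ℝ, F) G) :=
  (SymmetricAlgebra.lift (SymmetricAlgebra.ι ℝ _ ∘ₗ coadj F g)).toLinearMap

variable (F) in
/-- The action of `G` on `Λ(𝔤^*)` induced by the coadjoint action -/
def actExt (g : G) :
    Ext (GroupLieAlgebra 𝓘(ℝ, F) G) →ₗ[ℝ] Ext (GroupLieAlgebra 𝓘(ℝ, F) G) :=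
  (ExteriorAlgebra.map (coadj F g)).toLinearMap

variable (F) in
/-- The diagonal action of `G` on `S(𝔤^*) ⊗ Ω(M)` -/
def actCartan (g : G) : CartanForms F G E M →ₗ[ℝ] CartanForms F G E M :=
  TensorProduct.map (actSym F g) (actForms F E M g)

variable (F) in
/-- The diagonal action of `G` on `W(𝔤) ⊗ Ω(M)` -/
def actWeil (g : G) : WeilForms F G E M →ₗ[ℝ] WeilForms F G E M :=
  TensorProduct.map (TensorProduct.map (actExt F g) (actSym F g)) (actForms F E M g)

variable (F G) in
/-- The Cartan complex `(S(𝔤^*) ⊗ Ω(M))^G` -/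
def cartan : Submodule ℝ (CartanForms F G E M) :=
  ⨅ g : G, LinearMap.eqLocus (actCartan F E M g) LinearMap.id

/-- The elements of `W(𝔤) ⊗ Ω(M)` that are horizontal and annihilated by all `L_{e_a}` -/
def infBasic : Submodule ℝ (WeilForms F G E M) :=
  ⨅ a, LinearMap.ker (totalContr E M b a) ⊓ LinearMap.ker (totalLie E M b a)

/-- The basic subcomplex of the Weil model: the elements that are horizontal, annihilated by all
`L_{e_a}`, and invariant under `G`. -/
def weilBasic : Submodule ℝ (WeilForms F G E M) :=
  infBasic E M b ⊓ ⨅ g : G, LinearMap.eqLocus (actWeil F E M g) LinearMap.id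

variable (F G) in
/-- The part of total degree `k` of `W(𝔤) ⊗ Ω(M)`, where `|θ^a| = 1` and `|φ^a| = 2` -/
def weilDeg (k : ℕ) : Submodule ℝ (WeilForms F G E M) :=
  Submodule.span ℝ {t | ∃ (p q r : ℕ) (l : Ext (GroupLieAlgebra 𝓘(ℝ, F) G))
    (s : Sym (GroupLieAlgebra 𝓘(ℝ, F) G)) (η : Form E M r),
    l ∈ LinearMap.range (ExteriorAlgebra.ι ℝ (M := Dual ℝ (GroupLieAlgebra 𝓘(ℝ, F) G))) ^ p ∧
    s ∈ LinearMap.range (SymmetricAlgebra.ι ℝ (Dual ℝ (GroupLieAlgebra 𝓘(ℝ, F) G))) ^ q ∧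
    p + 2 * q + r = k ∧
    t = (l ⊗ₜ[ℝ] s) ⊗ₜ[ℝ] DirectSum.lof ℝ ℕ (fun k => Form E M k) r η}

variable (F G) in
/-- The part of total degree `k` of `S(𝔤^*) ⊗ Ω(M)`, where `|φ^a| = 2` -/
def cartanFormsDeg (k : ℕ) : Submodule ℝ (CartanForms F G E M) :=
  Submodule.span ℝ {t | ∃ (q r : ℕ) (s : Sym (GroupLieAlgebra 𝓘(ℝ, F) G)) (η : Form E M r),
    s ∈ LinearMap.range (SymmetricAlgebra.ι ℝ (Dual ℝ (GroupLieAlgebra 𝓘(ℝ, F) G))) ^ q ∧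
    2 * q + r = k ∧ t = s ⊗ₜ[ℝ] DirectSum.lof ℝ ℕ (fun k => Form E M k) r η}

/-- The degree `k` part of the basic subcomplex of the Weil model -/
def weilBasicDeg (k : ℕ) : Submodule ℝ (WeilForms F G E M) := weilBasic E M b ⊓ weilDeg F G E M k

variable (F G) in
/-- The degree `k` part `Ω_G^k(M)` of the Cartan complex -/
def cartanDeg (k : ℕ) : Submodule ℝ (CartanForms F G E M) :=
  cartan F G E M ⊓ cartanFormsDeg F G E M k

end Models

section Cohomology

variable {T : Type*} [AddCommGroup T] [Module ℝ T]

/-- The subspaces `C^k` form a cochain complex with the differential `δ`. -/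
def IsComplex (C : ℕ → Submodule ℝ T) (δ : T →ₗ[ℝ] T) : Prop :=
  ∀ k, ∀ x ∈ C k, δ x ∈ C (k + 1) ∧ δ (δ x) = 0

/-- The `k`-cocycles -/
def cocycles (C : ℕ → Submodule ℝ T) (δ : T →ₗ[ℝ] T) (k : ℕ) : Submodule ℝ T :=
  C k ⊓ LinearMap.ker δ

/-- The `k`-coboundaries `δ C^{k-1}` (zero for `k = 0`) -/
def coboundaries (C : ℕ → Submodule ℝ T) (δ : T →ₗ[ℝ] T) : ℕ → Submodule ℝ T
  | 0 => ⊥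
  | k + 1 => (C k).map δ

/-- The cohomology `H^k`, cocycles modulo coboundaries -/
abbrev Coh (C : ℕ → Submodule ℝ T) (δ : T →ₗ[ℝ] T) (k : ℕ) : Type _ :=
  cocycles C δ k ⧸ (coboundaries C δ k).submoduleOf (cocycles C δ k)

end Cohomology

end EquivCoh
end

/-!
Write `K = θ^a ι_{X_a}` for the contraction `ι_{X_a}` (with its Koszul sign) followed by the
multiplication by `θ^a`, so that `κ = exp K`. As the `θ^a` anticommute with each other and with the
`ι_{X_a}`, which also anticommute with each other, `K` is a sum of commuting operators of square
zero. Hence `K` is nilpotent and `κ` is invertible.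

*Conjugation by `κ`.* The iterated commutators of `K` with the operators of the Weil model vanish
from the third on, so `κ A κ⁻¹ = A + [K, A] + [K, [K, A]] / 2` (`nilExp_mul_of_commutator`). This
uses only a list of commutation relations, which is collected in `WeilRelations`. The result is that
`κ` turns the contraction `I_a` into `ι_{e_a} ⊗ 1` (`WeilRelations.nilExp_mul_contr`), and `D` into
`D + θ^a L_{X_a} - φ^a ι_{X_a}` (`WeilRelations.nilExp_mul_diff`), the terms quadratic in `θ`
cancelling. The one relation that is not formal is `[L_{X_a}, ι_{X_b}] = ι_{[X_a, X_b]}`.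

*The Cartan model.* The elements of `W(𝔤) ⊗ Ω(M)` annihilated by all `ι_{e_a}` are those of
`S(𝔤^*) ⊗ Ω(M)`, since `θ^a ι_{e_a}` multiplies `Λ^p` by `p` (`cartanIncl_cartanProj`). On
`S(𝔤^*) ⊗ Ω(M)` the conjugate of `D` is `d_G + θ^c 𝓛_c`, where `𝓛_c` is the infinitesimal action of
`e_c` (`kalkman_totalD_of_eq`). Contracting with `e_a` shows that for horizontal `α` the condition
`L_a α = 0` says that `𝓛_a` annihilates `κ α` (`mem_infBasic_iff`). As `κ` commutes with the action
of `G`, it maps the basic elements onto the elements of `S(𝔤^*) ⊗ Ω(M)` that are invariant under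
`G` (`mem_weilBasic_iff`), once it is known that invariance under `G` implies infinitesimal
invariance; on these, the conjugate of `D` is `d_G`. Moreover `(d_G^2 α)(ξ) = - L_ξ (α(ξ))`, which
vanishes for invariant `α` (`cartanD_cartanD`).

*Differentiating the group action.* The values of an element of `S(𝔤^*) ⊗ Ω(M)`, seen as a
polynomial map from `𝔤` to forms, determine it (`cartanForms_ext`), so it is enough to
differentiate the real-valued functions that `g ↦ g⁻¹ · α` gives rise to. Their derivative at `1` is
the infinitesimal action (`hasDerivAtOne_evForm_evalAt`). This proves that invariance under `G`
implies infinitesimal invariance (`cartanLie_eq_zero`), and also the converse for connected `G`,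
because the derivative at any other `g` is again a derivative at `1` (`mem_cartan_of_cartanLie`).
The computation rests on two facts. The derivative of the pullback of a form along the action is
`d ι_ξ + ι_ξ d` (`hasDerivAtOne_evForm_pull`); this is the identity `a^* d = d a^*` for the action
`a : G × M → M`, evaluated in charts on one tangent vector of `G` and on tangent vectors of `M`
(`extDeriv_cons_eq_family`), and needs no flow. The derivative of `Ad` is the Lie bracket
(`hasDerivAtOne_AdL`), which is the symmetry of the second derivative of the multiplication of `G`
in a chart. Differentiating the equivariance of the contraction then gives the formula for
`[L_{X_a}, ι_{X_b}]` (`lieD_iota`). In these lemmas the bracket of `T_1 G` is that of left-invariant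
vector fields; the structure constants carry the opposite sign.
-/

set_option linter.unusedSectionVars false

noncomputable section

namespace EquivCoh

/-! ### Differentiating the pullback of a form along a family of maps -/

section FamilyPullback

variable {F : Type*} [NormedAddCommGroup F] [NormedSpace ℝ F]
  {E : Type*} [NormedAddCommGroup E] [NormedSpace ℝ E]

/-- The pullback `H^* α` of a form `α` on `E` along `H : F × E → E`. -/
def familyPullback {k : ℕ} (H : F × E → E) (α : E → E [⋀^Fin k]→L[ℝ] ℝ) (q : F × E) :
    (F × E) [⋀^Fin k]→L[ℝ] ℝ :=
  (α (H q)).compContinuousLinearMap (fderiv ℝ H q)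

theorem differentiableAt_familyPullback {k : ℕ} {H : F × E → E} {α : E → E [⋀^Fin k]→L[ℝ] ℝ}
    {q : F × E} (hH : ContDiffAt ℝ ∞ H q) (hα : DifferentiableAt ℝ α (H q)) :
    DifferentiableAt ℝ (familyPullback H α) q := by
  have h1 : DifferentiableAt ℝ (fun q => α (H q)) q :=
    hα.comp q (hH.differentiableAt (by simp))
  have h2 : DifferentiableAt ℝ (fderiv ℝ H) q :=
    (hH.fderiv_right (m := 1)
      (by rw [one_add_one_eq_two]; exact ENat.LEInfty.out)).differentiableAt (by simp)
  exact h1.continuousAlternatingMapCompContinuousLinearMap h2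

/-- Cartan's formula in raw form: the identity `d (H^* α) = H^* (d α)` on `F × E`, evaluated on
one vector `(ζ, 0)` in the parameter direction and on vectors `(0, v i)`. -/
theorem extDeriv_cons_eq_family {k : ℕ} {H : F × E → E} {α : E → E [⋀^Fin k]→L[ℝ] ℝ}
    {o : F} {y : E} (hH : ContDiffAt ℝ ∞ H (o, y)) (hα : DifferentiableAt ℝ α (H (o, y)))
    (ζ : F) (v : Fin k → E) :
    extDeriv α (H (o, y)) (Matrix.vecCons (fderiv ℝ H (o, y) (ζ, 0))
        fun i => fderiv ℝ H (o, y) (0, v i)) =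
      fderiv ℝ (fun s => familyPullback H α (s, y) fun i => (0, v i)) o ζ -
      ∑ j : Fin k, (-1 : ℝ) ^ (j : ℕ) • fderiv ℝ (fun z => familyPullback H α (o, z)
        (j.succ.removeNth (Matrix.vecCons (ζ, 0) fun i => (0, v i)))) y (v j) := by
  have hA := differentiableAt_familyPullback hH hα
  have h1 : extDeriv (familyPullback H α) (o, y) = _ :=
    extDeriv_pullback hα hH
      (by simp only [minSmoothness_of_isRCLikeNormedField]; exact ENat.LEInfty.out)
  have hev : ∀ (w : Fin k → F × E),
      DifferentiableAt ℝ (fun q => familyPullback H α q w) (o, y) := fun w =>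
    ((ContinuousAlternatingMap.apply ℝ (F × E) ℝ w).differentiableAt).comp _ hA
  have hl : ∀ (w : Fin k → F × E) (ζ : F), fderiv ℝ (fun q => familyPullback H α q w) (o, y) (ζ, 0)
      = fderiv ℝ (fun s => familyPullback H α (s, y) w) o ζ := by
    intro w ζ
    have h3 : HasFDerivAt (fun s : F => (s, y)) (ContinuousLinearMap.inl ℝ F E) o :=
      hasFDerivAt_prodMk_left o y
    have := ((hev w).hasFDerivAt.comp o h3).fderiv
    exact (congrArg (fun A : F →L[ℝ] ℝ => A ζ) this).symm
  have hr : ∀ (w : Fin k → F × E) (u : E), fderiv ℝ (fun q => familyPullback H α q w) (o, y) (0, u)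
      = fderiv ℝ (fun z => familyPullback H α (o, z) w) y u := by
    intro w u
    have h3 : HasFDerivAt (fun z : E => (o, z)) (ContinuousLinearMap.inr ℝ F E) y :=
      hasFDerivAt_prodMk_right o y
    have := ((hev w).hasFDerivAt.comp y h3).fderiv
    exact (congrArg (fun A : E →L[ℝ] ℝ => A u) this).symm
  have h2 := congrArg (fun B : (F × E) [⋀^Fin (k + 1)]→L[ℝ] ℝ =>
    B (Matrix.vecCons (ζ, 0) fun i => (0, v i))) h1
  simp only [extDeriv_apply hA, Fin.sum_univ_succ] at h2
  rw [Matrix.cons_val_zero, hl] at h2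
  simp only [Matrix.cons_val_succ, hr] at h2
  have h4 : (Fin.removeNth 0 (Matrix.vecCons (ζ, (0 : E)) fun i => ((0 : F), v i))) =
      fun i => (0, v i) := by
    funext i; simp [Fin.removeNth]
  have h5 : (fun i => fderiv ℝ H (o, y) ((Matrix.vecCons (ζ, (0 : E)) fun i => ((0 : F), v i)) i))
      = Matrix.vecCons (fderiv ℝ H (o, y) (ζ, 0)) fun i => fderiv ℝ H (o, y) (0, v i) := by
    funext i
    refine Fin.cases ?_ (fun j => ?_) i <;> rfl
  rw [h4] at h2
  have h6 : (extDeriv α (H (o, y))).compContinuousLinearMap (fderiv ℝ H (o, y))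
      (Matrix.vecCons (ζ, 0) fun i => (0, v i)) = extDeriv α (H (o, y))
        (fun i => fderiv ℝ H (o, y) ((Matrix.vecCons (ζ, (0 : E)) fun i => ((0 : F), v i)) i)) :=
    rfl
  rw [h6, h5] at h2
  rw [← h2]
  simp only [Fin.val_zero, pow_zero, one_smul, Fin.val_succ, pow_succ, mul_neg, mul_one, neg_smul,
    Finset.sum_neg_distrib, sub_eq_add_neg]
  simp

/-- A family of maps that is the identity for the parameter `o` has partial derivative the identity
there. -/
theorem fderiv_inr_of_eventually_id {H : F × E → E} {o : F} {y : E}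
    (hH : DifferentiableAt ℝ H (o, y)) (hid : ∀ᶠ z in nhds y, H (o, z) = z) (u : E) :
    fderiv ℝ H (o, y) (0, u) = u := by
  have h3 : HasFDerivAt (fun z : E => (o, z)) (ContinuousLinearMap.inr ℝ F E) y :=
    hasFDerivAt_prodMk_right o y
  have h4 := hH.hasFDerivAt.comp y h3
  have h5 : HasFDerivAt (H ∘ fun z : E => (o, z)) (ContinuousLinearMap.id ℝ E) y :=
    (hasFDerivAt_id y).congr_of_eventuallyEq hid
  exact congrArg (fun A : E →L[ℝ] E => A u) (h4.unique h5)

/-- The derivative of a function along a family of maps through the identity. -/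
theorem fderiv_family_zero {H : F × E → E} {α : E → E [⋀^Fin 0]→L[ℝ] ℝ}
    {o : F} {y : E} (hH : ContDiffAt ℝ ∞ H (o, y)) (hid : ∀ᶠ z in nhds y, H (o, z) = z)
    (hα : DifferentiableAt ℝ α y) (ζ : F) (v : Fin 0 → E) :
    fderiv ℝ (fun s => familyPullback H α (s, y) fun i => (0, v i)) o ζ =
      extDeriv α y (Matrix.vecCons (fderiv ℝ H (o, y) (ζ, 0)) v) := by
  have hy : H (o, y) = y := hid.self_of_nhds
  have h := extDeriv_cons_eq_family hH (by rwa [hy]) ζ v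
  simp only [Finset.univ_eq_empty, Finset.sum_empty, sub_zero, hy,
    fderiv_inr_of_eventually_id (hH.differentiableAt (by simp)) hid] at h
  exact h.symm

/-- Cartan's formula on a normed space, for a family of maps through the identity. -/
theorem fderiv_family_succ {k : ℕ} {H : F × E → E} {α : E → E [⋀^Fin (k + 1)]→L[ℝ] ℝ}
    {o : F} {y : E} (hH : ContDiffAt ℝ ∞ H (o, y)) (hid : ∀ᶠ z in nhds y, H (o, z) = z)
    (hα : DifferentiableAt ℝ α y) (ζ : F) (v : Fin (k + 1) → E) {τ : E → E [⋀^Fin k]→L[ℝ] ℝ}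
    (hτ : ∀ᶠ z in nhds y, τ z = (α z).curryLeft (fderiv ℝ H (o, z) (ζ, 0)))
    (hτ' : DifferentiableAt ℝ τ y) :
    fderiv ℝ (fun s => familyPullback H α (s, y) fun i => (0, v i)) o ζ =
      extDeriv τ y v + extDeriv α y (Matrix.vecCons (fderiv ℝ H (o, y) (ζ, 0)) v) := by
  have hy : H (o, y) = y := hid.self_of_nhds
  have h := extDeriv_cons_eq_family hH (by rwa [hy]) ζ v
  simp only [hy, fderiv_inr_of_eventually_id (hH.differentiableAt (by simp)) hid] at h
  have hcd : ∀ᶠ z in nhds y, DifferentiableAt ℝ H (o, z) :=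
    (Continuous.prodMk_right o).continuousAt.eventually
      (((hH.of_le (m := 1) ENat.LEInfty.out).eventually (by simp)).mono
        fun q hq => hq.differentiableAt (by simp))
  have hsum : ∀ j : Fin (k + 1), fderiv ℝ (fun z => familyPullback H α (o, z)
        (j.succ.removeNth (Matrix.vecCons (ζ, 0) fun i => (0, v i)))) y (v j) =
      fderiv ℝ (fun z => τ z (j.removeNth v)) y (v j) := by
    intro j
    congr 1
    apply Filter.EventuallyEq.fderiv_eq
    filter_upwards [hτ, hid, hid.eventually_nhds, hcd] with z h1 h2 h3 h4
    rw [h1, ContinuousAlternatingMap.curryLeft_apply_apply]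
    simp only [familyPullback, ContinuousAlternatingMap.compContinuousLinearMap_apply, h2]
    congr 1
    funext i
    refine Fin.cases ?_ (fun j' => ?_) i
    · rfl
    · simp only [Function.comp_apply, Fin.removeNth, Fin.succ_succAbove_succ, Matrix.cons_val_succ]
      exact fderiv_inr_of_eventually_id h4 h3 _
  simp only [hsum] at h
  rw [extDeriv_apply hτ', h]
  simp only [zsmul_eq_mul, smul_eq_mul, Int.cast_pow, Int.cast_neg, Int.cast_one, add_sub_cancel]

end FamilyPullback

/-! ### The Lie derivative along a fundamental vector field -/

section LieDerivative

variable {F : Type*} [NormedAddCommGroup F] [NormedSpace ℝ F]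
  {G : Type*} [TopologicalSpace G] [ChartedSpace F G] [Group G] [LieGroup 𝓘(ℝ, F) ∞ G]
  {E : Type*} [NormedAddCommGroup E] [NormedSpace ℝ E]
  {M : Type*} [TopologicalSpace M] [ChartedSpace E M] [IsManifold 𝓘(ℝ, E) ∞ M]
  [MulAction G M] [ContMDiffSMul 𝓘(ℝ, F) 𝓘(ℝ, E) ∞ G M]

/-- The values of a form at `x` are recovered from its coordinate expression in the chart at `x`. -/
theorem rawForm_apply_eq_localRep {k : ℕ} (η : RawForm E M k) (x : M)
    (v : Fin k → TangentSpace 𝓘(ℝ, E) x) :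
    η x v = localRep η (chartAt E x) (chartAt E x x)
      (fun i => mfderiv 𝓘(ℝ, E) 𝓘(ℝ, E) (chartAt E x) x (v i)) := by
  have hI : IsManifold 𝓘(ℝ, E) 1 M := IsManifold.of_le (n := ∞) (by norm_num)
  have hde : (chartAt E x).MDifferentiable 𝓘(ℝ, E) 𝓘(ℝ, E) :=
    mdifferentiable_of_mem_atlas (chart_mem_atlas E x)
  have h0 := hde.symm_comp_deriv (mem_chart_source E x)
  let η' : M → E [⋀^Fin k]→L[ℝ] ℝ := η
  have h1 : η' ((chartAt E x).symm (chartAt E x x)) = η' x := by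
    rw [(chartAt E x).left_inv (mem_chart_source E x)]
  have h2 : localRep η (chartAt E x) (chartAt E x x)
      (fun i => mfderiv 𝓘(ℝ, E) 𝓘(ℝ, E) (chartAt E x) x (v i)) =
      η' ((chartAt E x).symm (chartAt E x x)) (fun i =>
        ((mfderiv 𝓘(ℝ, E) 𝓘(ℝ, E) (chartAt E x).symm (chartAt E x x)).comp
          (mfderiv 𝓘(ℝ, E) 𝓘(ℝ, E) (chartAt E x) x)) (v i)) := rfl
  rw [h2, h0, h1]
  rfl

/-- `h` has derivative `A : T_1 G → E'` at the identity, expressed in the chart there. -/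
def HasDerivAtOne {E' : Type*} [NormedAddCommGroup E'] [NormedSpace ℝ E'] (h : G → E')
    (A : F →L[ℝ] E') : Prop :=
  HasFDerivAt (fun s => h ((chartAt F (1 : G)).symm s)) A (chartAt F (1 : G) 1)

theorem HasDerivAtOne.hasMFDerivAt {E' : Type*} [NormedAddCommGroup E'] [NormedSpace ℝ E']
    {h : G → E'} {A : F →L[ℝ] E'} (hA : HasDerivAtOne h A) :
    HasMFDerivAt 𝓘(ℝ, F) 𝓘(ℝ, E') h 1 A := by
  refine ⟨?_, ?_⟩
  · have h1 := hA.continuousAt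
    have h2 : ContinuousAt (chartAt F (1 : G)) 1 :=
      (chartAt F (1 : G)).continuousAt (mem_chart_source F 1)
    have h3 : ContinuousAt (fun g : G => h ((chartAt F (1 : G)).symm (chartAt F (1 : G) g))) 1 :=
      ContinuousAt.comp (f := chartAt F (1 : G)) h1 h2
    refine h3.congr ?_
    filter_upwards [(chartAt F (1 : G)).open_source.mem_nhds (mem_chart_source F 1)] with g hg
    rw [(chartAt F (1 : G)).left_inv hg]
  · rw [ModelWithCorners.range_eq_univ]
    exact hA.hasFDerivWithinAt

theorem hasDerivAtOne_mfderiv {E' : Type*} [NormedAddCommGroup E'] [NormedSpace ℝ E']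
    {h : G → E'} (hh : MDifferentiableAt 𝓘(ℝ, F) 𝓘(ℝ, E') h 1) :
    HasDerivAtOne (F := F) (E' := E') h (mfderiv 𝓘(ℝ, F) 𝓘(ℝ, E') h 1) := by
  have := hh.hasMFDerivAt.2
  rw [ModelWithCorners.range_eq_univ] at this
  exact hasFDerivWithinAt_univ.1 this

variable (F G) in
/-- The action map `G × M → M` in the charts at `1` and at `x`. -/
def localAct (x : M) (q : F × E) : E :=
  chartAt E x ((chartAt F (1 : G)).symm q.1 • (chartAt E x).symm q.2)

theorem contDiffAt_localAct (x : M) {y : E} (hy : y ∈ (chartAt E x).target) :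
    ContDiffAt ℝ ∞ (localAct F G x) (chartAt F (1 : G) 1, y) := by
  have hG1 : ContMDiffAt 𝓘(ℝ, F × E) 𝓘(ℝ, F) ∞
      (fun q : F × E => (chartAt F (1 : G)).symm q.1) (chartAt F (1 : G) 1, y) := by
    have h1 : ContMDiffAt 𝓘(ℝ, F) 𝓘(ℝ, F) ∞ (chartAt F (1 : G)).symm (chartAt F (1 : G) 1) :=
      (contMDiffOn_symm_of_mem_maximalAtlas (IsManifold.subset_maximalAtlas
        (chart_mem_atlas F 1))).contMDiffAt
        ((chartAt F (1 : G)).open_target.mem_nhds (mem_chart_target F 1))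
    exact ContMDiffAt.comp (g := (chartAt F (1 : G)).symm) (f := Prod.fst)
      (chartAt F (1 : G) 1, y) h1 contDiffAt_fst.contMDiffAt
  have hM1 : ContMDiffAt 𝓘(ℝ, F × E) 𝓘(ℝ, E) ∞
      (fun q : F × E => (chartAt E x).symm q.2) (chartAt F (1 : G) 1, y) := by
    have h1 : ContMDiffAt 𝓘(ℝ, E) 𝓘(ℝ, E) ∞ (chartAt E x).symm y :=
      (contMDiffOn_symm_of_mem_maximalAtlas (IsManifold.subset_maximalAtlas
        (chart_mem_atlas E x))).contMDiffAt
        ((chartAt E x).open_target.mem_nhds hy)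
    exact ContMDiffAt.comp (g := (chartAt E x).symm) (f := Prod.snd)
      (chartAt F (1 : G) 1, y) h1 contDiffAt_snd.contMDiffAt
  have h2 := ContMDiffAt.smul hG1 hM1
  have h3 : ContMDiffAt 𝓘(ℝ, E) 𝓘(ℝ, E) ∞ (chartAt E x)
      ((chartAt F (1 : G)).symm (chartAt F (1 : G) 1) • (chartAt E x).symm y) := by
    rw [(chartAt F (1 : G)).left_inv (mem_chart_source F 1), one_smul]
    exact (contMDiffOn_of_mem_maximalAtlas (IsManifold.subset_maximalAtlas
      (chart_mem_atlas E x))).contMDiffAt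
        ((chartAt E x).open_source.mem_nhds ((chartAt E x).map_target hy))
  rw [← contMDiffAt_iff_contDiffAt]
  exact ContMDiffAt.comp (g := chartAt E x) _ h3 h2

theorem localAct_one (x : M) {y : E} (hy : y ∈ (chartAt E x).target) :
    localAct F G x (chartAt F (1 : G) 1, y) = y := by
  rw [localAct, (chartAt F (1 : G)).left_inv (mem_chart_source F 1), one_smul,
    (chartAt E x).right_inv hy]

theorem contMDiff_orbit (x : M) : ContMDiff 𝓘(ℝ, F) 𝓘(ℝ, E) ∞ (fun g : G => g • x) :=
  ContMDiff.smul (I := 𝓘(ℝ, F)) contMDiff_id contMDiff_const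

theorem mdifferentiableAt_orbit (x : M) :
    MDifferentiableAt 𝓘(ℝ, F) 𝓘(ℝ, E) (fun g : G => g • x) 1 :=
  (contMDiff_orbit x).mdifferentiableAt (by simp)

/-- The derivative of the action in the group direction is the fundamental vector field. -/
theorem fderiv_localAct_inl (x : M) {y : E} (hy : y ∈ (chartAt E x).target)
    (ζ : GroupLieAlgebra 𝓘(ℝ, F) G) :
    fderiv ℝ (localAct F G x) (chartAt F (1 : G) 1, y) (ζ, 0) =
      mfderiv 𝓘(ℝ, E) 𝓘(ℝ, E) (chartAt E x) ((chartAt E x).symm y)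
        ((fundVF E M ζ).val ((chartAt E x).symm y)) := by
  have hI : IsManifold 𝓘(ℝ, E) 1 M := IsManifold.of_le (n := ∞) (by norm_num)
  set z := (chartAt E x).symm y with hz
  have h1 : HasFDerivAt (fun s : F => (s, y)) (ContinuousLinearMap.inl ℝ F E)
    (chartAt F (1 : G) 1) := hasFDerivAt_prodMk_left _ _
  have h2 := ((contDiffAt_localAct (F := F) (G := G) x hy).differentiableAt
    (by simp)).hasFDerivAt.comp (chartAt F (1 : G) 1) h1
  have hc : MDifferentiableAt 𝓘(ℝ, E) 𝓘(ℝ, E) (chartAt E x) ((1 : G) • z) := by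
    rw [one_smul]
    exact mdifferentiableAt_atlas (chart_mem_atlas E x) ((chartAt E x).map_target hy)
  have h3 : MDifferentiableAt 𝓘(ℝ, F) 𝓘(ℝ, E) (fun g : G => chartAt E x (g • z)) 1 :=
    MDifferentiableAt.comp (1 : G) hc (mdifferentiableAt_orbit z)
  have h4 := HasFDerivAt.unique (𝕜 := ℝ) (E := F) (F := E) (hasDerivAtOne_mfderiv h3) h2
  refine (congrArg (fun A : F →L[ℝ] E => A ζ) h4).symm.trans ?_
  have h5 : mfderiv 𝓘(ℝ, F) 𝓘(ℝ, E) (fun g : G => chartAt E x (g • z)) 1 =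
      (mfderiv 𝓘(ℝ, E) 𝓘(ℝ, E) (chartAt E x) ((1 : G) • z)).comp
        (mfderiv 𝓘(ℝ, F) 𝓘(ℝ, E) (fun g : G => g • z) 1) :=
    mfderiv_comp (1 : G) hc (mdifferentiableAt_orbit z)
  -- tangent spaces at `1 • z` and `z` are different types that unfold to `E`, so that rewriting
  -- with `one_smul` is not type-correct; a variable base point circumvents this
  have h6 : ∀ p : M, p = z → (mfderiv 𝓘(ℝ, E) 𝓘(ℝ, E) (chartAt E x) p : E →L[ℝ] E) =
      (mfderiv 𝓘(ℝ, E) 𝓘(ℝ, E) (chartAt E x) z : E →L[ℝ] E) := by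
    rintro p rfl; rfl
  refine (congrArg (fun A : F →L[ℝ] E => A ζ) h5).trans ?_
  exact congrArg (fun A : E →L[ℝ] E => A ((fundVF E M ζ).val z)) (h6 _ (one_smul G z))

/-- In a chart, contraction with a vector field is contraction with its coordinate expression. -/
theorem localRep_contract {k : ℕ} (X : VField E M) (η : RawForm E M (k + 1))
    {e : OpenPartialHomeomorph M E} (he : e ∈ atlas E M) {y : E} (hy : y ∈ e.target) :
    localRep (rawContract X.val η) e y =
      (localRep η e y).curryLeft (mfderiv 𝓘(ℝ, E) 𝓘(ℝ, E) e (e.symm y) (X.val (e.symm y))) := by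
  have hI : IsManifold 𝓘(ℝ, E) 1 M := IsManifold.of_le (n := ∞) (by norm_num)
  have hde : e.MDifferentiable 𝓘(ℝ, E) 𝓘(ℝ, E) := mdifferentiable_of_mem_atlas he
  have hid : mfderiv 𝓘(ℝ, E) 𝓘(ℝ, E) e.symm y
      (mfderiv 𝓘(ℝ, E) 𝓘(ℝ, E) e (e.symm y) (X.val (e.symm y))) = X.val (e.symm y) := by
    have h0 := hde.symm_comp_deriv (e.map_target hy)
    rw [e.right_inv hy] at h0
    exact congrArg (fun A => A (X.val (e.symm y))) h0
  ext v
  change (η (e.symm y)) (Matrix.vecCons (X.val (e.symm y)) fun i =>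
    mfderiv 𝓘(ℝ, E) 𝓘(ℝ, E) e.symm y (v i)) = (η (e.symm y)) fun i =>
      mfderiv 𝓘(ℝ, E) 𝓘(ℝ, E) e.symm y (Matrix.vecCons
        (mfderiv 𝓘(ℝ, E) 𝓘(ℝ, E) e (e.symm y) (X.val (e.symm y))) v i)
  conv_lhs => rw [← hid]
  congr 1
  funext i
  refine Fin.cases ?_ (fun j => ?_) i <;> rfl

theorem contMDiff_smul_left (F : Type*) [NormedAddCommGroup F] [NormedSpace ℝ F] {G : Type*}
    [TopologicalSpace G] [ChartedSpace F G] [Group G] [MulAction G M]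
    [ContMDiffSMul 𝓘(ℝ, F) 𝓘(ℝ, E) ∞ G M] (g : G) :
    ContMDiff 𝓘(ℝ, E) 𝓘(ℝ, E) ∞ (fun x : M => g • x) :=
  (contMDiff_smul (I := 𝓘(ℝ, F)) (I' := 𝓘(ℝ, E)) (n := ∞) (G := G) (M := M)).comp
    (contMDiff_const.prodMk contMDiff_id)

/-- Near `1`, the values of the translates of a form are those of the pullback along the action
in charts. -/
theorem rawPullback_eventually_eq {k : ℕ} (η : RawForm E M k) (x : M)
    (v : Fin k → TangentSpace 𝓘(ℝ, E) x) :
    ∀ᶠ s in nhds (chartAt F (1 : G) 1),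
      rawPullback (fun z : M => (chartAt F (1 : G)).symm s • z) η x v =
      familyPullback (localAct F G x) (localRep η (chartAt E x)) (s, chartAt E x x)
        (fun i => (0, mfderiv 𝓘(ℝ, E) 𝓘(ℝ, E) (chartAt E x) x (v i))) := by
  set y := chartAt E x x with hy
  have hyt : y ∈ (chartAt E x).target := mem_chart_target E x
  have hyx : (chartAt E x).symm y = x := (chartAt E x).left_inv (mem_chart_source E x)
  have hH := contDiffAt_localAct (F := F) (G := G) x hyt
  have hd : ∀ᶠ s in nhds (chartAt F (1 : G) 1), DifferentiableAt ℝ (localAct F G x) (s, y) :=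
    (Continuous.prodMk_left y).continuousAt.eventually
      (((hH.of_le (m := 1) ENat.LEInfty.out).eventually (by simp)).mono
        fun q hq => hq.differentiableAt (by simp))
  have hc : ∀ᶠ s in nhds (chartAt F (1 : G) 1),
      (chartAt F (1 : G)).symm s • x ∈ (chartAt E x).source := by
    have h1 : ContinuousAt (chartAt F (1 : G)).symm (chartAt F (1 : G) 1) :=
      (chartAt F (1 : G)).continuousAt_symm (mem_chart_target F 1)
    have h2 : ContinuousAt (fun g : G => g • x)
        ((chartAt F (1 : G)).symm (chartAt F (1 : G) 1)) := by
      rw [(chartAt F (1 : G)).left_inv (mem_chart_source F 1)]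
      exact (mdifferentiableAt_orbit (F := F) (E := E) x).continuousAt
    have h3 : ContinuousAt (fun s => (chartAt F (1 : G)).symm s • x) (chartAt F (1 : G) 1) :=
      ContinuousAt.comp (f := (chartAt F (1 : G)).symm) h2 h1
    refine h3.eventually ((chartAt E x).open_source.mem_nhds ?_)
    beta_reduce
    rw [(chartAt F (1 : G)).left_inv (mem_chart_source F 1), one_smul]
    exact mem_chart_source E x
  filter_upwards [hd, hc] with s h1 h2
  rw [rawForm_apply_eq_localRep, localRep_rawPullback (contMDiff_smul_left F _) η
    (chart_mem_atlas E x) (chart_mem_atlas E x) hyt (by rw [hyx]; exact h2)]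
  have h3 : HasFDerivAt (fun z : E => (s, z)) (ContinuousLinearMap.inr ℝ F E) y :=
    hasFDerivAt_prodMk_right s y
  have h4 := (h1.hasFDerivAt.comp y h3).fderiv
  have h5 : (fun z => (chartAt E x) ((chartAt F (1 : G)).symm s • (chartAt E x).symm z)) =
    localAct F G x ∘ fun z => (s, z) := rfl
  rw [h5, h4]
  rfl

theorem hasDerivAtOne_rawPullback {k : ℕ} (η : Form E M k) (x : M)
    (v : Fin k → TangentSpace 𝓘(ℝ, E) x) :
    HasDerivAtOne (fun g : G => rawPullback (fun z : M => g • z) η.1 x v)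
      (fderiv ℝ (fun s => familyPullback (localAct F G x) (localRep η.1 (chartAt E x))
        (s, chartAt E x x) (fun i => (0, mfderiv 𝓘(ℝ, E) 𝓘(ℝ, E) (chartAt E x) x (v i))))
        (chartAt F (1 : G) 1)) := by
  refine HasFDerivAt.congr_of_eventuallyEq ?_
    (rawPullback_eventually_eq η.1 x v)
  have hyt : chartAt E x x ∈ (chartAt E x).target := mem_chart_target E x
  have h1 := differentiableAt_familyPullback (α := localRep η.1 (chartAt E x))
    (contDiffAt_localAct (F := F) (G := G) x hyt) (by
      rw [localAct_one x hyt]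
      exact ((η.2 _ (chart_mem_atlas E x)).contDiffAt
        ((chartAt E x).open_target.mem_nhds hyt)).differentiableAt (by simp))
  refine DifferentiableAt.hasFDerivAt ?_
  have h2 : DifferentiableAt ℝ (fun s : F => (s, chartAt E x x)) (chartAt F (1 : G) 1) :=
    (hasFDerivAt_prodMk_left _ _).differentiableAt
  have h3 := DifferentiableAt.comp (f := fun s : F => (s, chartAt E x x))
    (chartAt F (1 : G) 1) h1 h2
  exact ((ContinuousAlternatingMap.apply ℝ (F × E) ℝ _).differentiableAt).comp _ h3

theorem fderiv_localAct_inl_self (x : M) (ζ : GroupLieAlgebra 𝓘(ℝ, F) G) :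
    fderiv ℝ (localAct F G x) (chartAt F (1 : G) 1, chartAt E x x) (ζ, 0) =
      mfderiv 𝓘(ℝ, E) 𝓘(ℝ, E) (chartAt E x) x ((fundVF E M ζ).val x) := by
  refine (fderiv_localAct_inl x (mem_chart_target E x) ζ).trans ?_
  have h6 : ∀ p : M, p = x → (mfderiv 𝓘(ℝ, E) 𝓘(ℝ, E) (chartAt E x) p : E →L[ℝ] E)
      ((fundVF E M ζ).val p) = (mfderiv 𝓘(ℝ, E) 𝓘(ℝ, E) (chartAt E x) x : E →L[ℝ] E)
        ((fundVF E M ζ).val x) := by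
    rintro p rfl; rfl
  exact h6 _ ((chartAt E x).left_inv (mem_chart_source E x))

theorem eventually_localAct_one (x : M) : ∀ᶠ z in nhds (chartAt E x x),
    localAct F G x (chartAt F (1 : G) 1, z) = z := by
  filter_upwards [(chartAt E x).open_target.mem_nhds (mem_chart_target E x)] with z hz
  exact localAct_one x hz

theorem contract_extD_apply {k : ℕ} (η : Form E M k) (x : M)
    (v : Fin k → TangentSpace 𝓘(ℝ, E) x) (ζ : GroupLieAlgebra 𝓘(ℝ, F) G) :
    (contract (fundVF E M ζ) k (extD k η)).1 x v =
      extDeriv (localRep η.1 (chartAt E x)) (chartAt E x x)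
        (Matrix.vecCons (fderiv ℝ (localAct F G x) (chartAt F (1 : G) 1, chartAt E x x) (ζ, 0))
          (fun i => mfderiv 𝓘(ℝ, E) 𝓘(ℝ, E) (chartAt E x) x (v i))) := by
  rw [fderiv_localAct_inl_self]
  change extDeriv (localRep η.1 (chartAt E x)) (chartAt E x x) (fun i =>
    mfderiv 𝓘(ℝ, E) 𝓘(ℝ, E) (chartAt E x) x
      ((Matrix.vecCons ((fundVF E M ζ).val x) v : Fin (k + 1) → E) i)) = _
  congr 1
  funext i
  refine Fin.cases ?_ (fun j => ?_) i <;> rfl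

/-- The derivative at `1` of the translates of a function, where Cartan's formula has only the term
`ι_ζ d`. -/
theorem hasDerivAtOne_rawPullback_zero (η : Form E M 0) (x : M)
    (v : Fin 0 → TangentSpace 𝓘(ℝ, E) x) :
    ∃ A : F →L[ℝ] ℝ, HasDerivAtOne (fun g : G => rawPullback (fun z : M => g • z) η.1 x v) A ∧
      ∀ ζ : GroupLieAlgebra 𝓘(ℝ, F) G,
        A ζ = (contract (fundVF E M ζ) 0 (extD 0 η)).1 x v := by
  refine ⟨_, hasDerivAtOne_rawPullback η x v, fun ζ => ?_⟩
  rw [contract_extD_apply]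
  have hyt : chartAt E x x ∈ (chartAt E x).target := mem_chart_target E x
  exact fderiv_family_zero (contDiffAt_localAct (F := F) (G := G) x hyt)
    (eventually_localAct_one x) (((η.2 _ (chart_mem_atlas E x)).contDiffAt
        ((chartAt E x).open_target.mem_nhds hyt)).differentiableAt (by simp)) ζ _

/-- Cartan's formula: the derivative at `1` of the pullback of a form under the action is
`d ι_ζ + ι_ζ d`. -/
theorem hasDerivAtOne_rawPullback_succ {k : ℕ} (η : Form E M (k + 1)) (x : M)
    (v : Fin (k + 1) → TangentSpace 𝓘(ℝ, E) x) :
    ∃ A : F →L[ℝ] ℝ, HasDerivAtOne (fun g : G => rawPullback (fun z : M => g • z) η.1 x v) A ∧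
      ∀ ζ : GroupLieAlgebra 𝓘(ℝ, F) G, A ζ = (extD k (contract (fundVF E M ζ) k η)).1 x v +
        (contract (fundVF E M ζ) (k + 1) (extD (k + 1) η)).1 x v := by
  refine ⟨_, hasDerivAtOne_rawPullback η x v, fun ζ => ?_⟩
  rw [contract_extD_apply]
  have hyt : chartAt E x x ∈ (chartAt E x).target := mem_chart_target E x
  have hd : ∀ {l : ℕ} (ζ : Form E M l),
      DifferentiableAt ℝ (localRep ζ.1 (chartAt E x)) (chartAt E x x) := fun ζ =>
    ((ζ.2 _ (chart_mem_atlas E x)).contDiffAt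
      ((chartAt E x).open_target.mem_nhds hyt)).differentiableAt (by simp)
  refine fderiv_family_succ (contDiffAt_localAct (F := F) (G := G) x hyt)
    (eventually_localAct_one x) (hd η) ζ _
    (τ := localRep (contract (fundVF E M ζ) k η).1 (chartAt E x)) ?_ (hd _)
  filter_upwards [(chartAt E x).open_target.mem_nhds hyt] with z hz
  rw [fderiv_localAct_inl x hz]
  exact localRep_contract _ _ (chart_mem_atlas E x) hz

/-- The Lie derivative `L_ζ = d ι_ζ + ι_ζ d` along the fundamental vector field of `ζ`. -/
def lieD (E : Type*) [NormedAddCommGroup E] [NormedSpace ℝ E] (M : Type*) [TopologicalSpace M]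
    [ChartedSpace E M] [IsManifold 𝓘(ℝ, E) ∞ M] [MulAction G M]
    [ContMDiffSMul 𝓘(ℝ, F) 𝓘(ℝ, E) ∞ G M] (ζ : GroupLieAlgebra 𝓘(ℝ, F) G) :
    Forms E M →ₗ[ℝ] Forms E M :=
  dR ∘ₗ iota (fundVF E M ζ) + iota (fundVF E M ζ) ∘ₗ dR

/-- The value of the degree `k` component of a form at a point on given tangent vectors. -/
def evForm {k : ℕ} (x : M) (v : Fin k → TangentSpace 𝓘(ℝ, E) x) : Forms E M →ₗ[ℝ] ℝ :=
  { toFun := fun η : Form E M k => η.1 x v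
    map_add' := fun _ _ => rfl
    map_smul' := fun _ _ => rfl } ∘ₗ DirectSum.component ℝ ℕ (fun k => Form E M k) k

theorem evForm_lof_self {k : ℕ} (x : M) (v : Fin k → TangentSpace 𝓘(ℝ, E) x) (η : Form E M k) :
    evForm x v (DirectSum.lof ℝ ℕ (fun k => Form E M k) k η) = η.1 x v := by
  rw [evForm, LinearMap.comp_apply, DirectSum.component.lof_self]
  rfl

theorem evForm_lof_of_ne {k l : ℕ} (h : l ≠ k) (x : M) (v : Fin k → TangentSpace 𝓘(ℝ, E) x)
    (η : Form E M l) :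
    evForm x v (DirectSum.lof ℝ ℕ (fun k => Form E M k) l η) = 0 := by
  have : DirectSum.component ℝ ℕ (fun k => Form E M k) k
      (DirectSum.lof ℝ ℕ (fun k => Form E M k) l η) = 0 := by
    rw [DirectSum.component.of, dif_neg h]
  rw [evForm, LinearMap.comp_apply, this, map_zero]

theorem forms_ext {η θ : Forms E M} (h : ∀ (k : ℕ) (x : M) (v : Fin k → TangentSpace 𝓘(ℝ, E) x),
    evForm x v η = evForm x v θ) : η = θ := by
  refine DirectSum.ext_component ℝ fun k => ?_
  apply Subtype.ext
  funext x
  ext v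
  exact h k x v

theorem iota_lof_zero (X : VField E M) (η : Form E M 0) :
    iota X (DirectSum.lof ℝ ℕ (fun k => Form E M k) 0 η) = 0 := by
  simp [iota]

theorem iota_lof_succ (X : VField E M) {k : ℕ} (η : Form E M (k + 1)) :
    iota X (DirectSum.lof ℝ ℕ (fun k => Form E M k) (k + 1) η) =
      DirectSum.lof ℝ ℕ (fun k => Form E M k) k (contract X k η) := by
  simp [iota]

theorem dR_lof {k : ℕ} (η : Form E M k) :
    dR (DirectSum.lof ℝ ℕ (fun k => Form E M k) k η) =
      DirectSum.lof ℝ ℕ (fun k => Form E M k) (k + 1) (extD k η) := by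
  simp [dR]

theorem lieD_lof_zero (ζ : GroupLieAlgebra 𝓘(ℝ, F) G) (η : Form E M 0) :
    lieD E M ζ (DirectSum.lof ℝ ℕ (fun k => Form E M k) 0 η) =
      DirectSum.lof ℝ ℕ (fun k => Form E M k) 0 (contract (fundVF E M ζ) 0 (extD 0 η)) := by
  rw [lieD, LinearMap.add_apply, LinearMap.comp_apply, iota_lof_zero, map_zero,
    LinearMap.comp_apply, dR_lof, iota_lof_succ]
  exact zero_add _

theorem lieD_lof_succ (ζ : GroupLieAlgebra 𝓘(ℝ, F) G) {k : ℕ} (η : Form E M (k + 1)) :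
    lieD E M ζ (DirectSum.lof ℝ ℕ (fun k => Form E M k) (k + 1) η) =
      DirectSum.lof ℝ ℕ (fun k => Form E M k) (k + 1) (extD k (contract (fundVF E M ζ) k η) +
        contract (fundVF E M ζ) (k + 1) (extD (k + 1) η)) := by
  rw [lieD, LinearMap.add_apply, LinearMap.comp_apply, iota_lof_succ, LinearMap.comp_apply,
    dR_lof, dR_lof, iota_lof_succ, map_add]

theorem pull_lof [FiniteDimensional ℝ E] {f : M → M} (hf : ContMDiff 𝓘(ℝ, E) 𝓘(ℝ, E) ∞ f) {k : ℕ}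
    (η : Form E M k) :
    pull f hf (DirectSum.lof ℝ ℕ (fun k => Form E M k) k η) =
      DirectSum.lof ℝ ℕ (fun k => Form E M k) k (pullback f hf k η) := by
  simp [pull]

theorem forms_induction {p : Forms E M → Prop} (h0 : p 0)
    (hadd : ∀ η θ, p η → p θ → p (η + θ))
    (hlof : ∀ (k : ℕ) (η : Form E M k), p (DirectSum.lof ℝ ℕ (fun k => Form E M k) k η))
    (η : Forms E M) : p η :=
  DirectSum.induction_on η h0 hlof hadd

/-- The derivative at `1` of the translates of a form is the Lie derivative. -/
theorem hasDerivAtOne_evForm_pull [FiniteDimensional ℝ E] (η : Forms E M) {k : ℕ} (x : M)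
    (v : Fin k → TangentSpace 𝓘(ℝ, E) x) :
    ∃ A : F →L[ℝ] ℝ, HasDerivAtOne
        (fun g : G => evForm x v (pull (fun z : M => g • z) (contMDiff_smul_left F g) η)) A ∧
      ∀ ζ : GroupLieAlgebra 𝓘(ℝ, F) G, A ζ = evForm x v (lieD E M ζ η) := by
  induction η using forms_induction with
  | h0 =>
    simp only [map_zero]
    exact ⟨0, hasFDerivAt_const _ _, fun ζ => rfl⟩
  | hadd η θ h1 h2 =>
    obtain ⟨A, hA, hA'⟩ := h1
    obtain ⟨B, hB, hB'⟩ := h2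
    refine ⟨A + B, ?_, fun ζ => ?_⟩
    · simp only [map_add]
      exact hA.add hB
    · rw [map_add, map_add, ← hA', ← hB']; rfl
  | hlof l η =>
    simp only [pull_lof]
    by_cases h : l = k
    · subst h
      simp only [evForm_lof_self]
      cases l with
      | zero =>
        obtain ⟨A, hA, hA'⟩ := hasDerivAtOne_rawPullback_zero (F := F) (G := G) η x v
        refine ⟨A, hA, fun ζ => ?_⟩
        rw [hA', lieD_lof_zero, evForm_lof_self]
      | succ l =>
        obtain ⟨A, hA, hA'⟩ := hasDerivAtOne_rawPullback_succ (F := F) (G := G) η x v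
        refine ⟨A, hA, fun ζ => ?_⟩
        rw [hA', lieD_lof_succ, evForm_lof_self]
        rfl
    · refine ⟨0, ?_, fun ζ => ?_⟩
      · simp only [evForm_lof_of_ne h]
        exact hasFDerivAt_const _ _
      · cases l with
        | zero => rw [lieD_lof_zero, evForm_lof_of_ne h]; rfl
        | succ l => rw [lieD_lof_succ, evForm_lof_of_ne h]; rfl

end LieDerivative

/-! ### The derivative of the adjoint action -/

section Adjoint

variable {F : Type*} [NormedAddCommGroup F] [NormedSpace ℝ F]
  {G : Type*} [TopologicalSpace G] [ChartedSpace F G] [Group G] [LieGroup 𝓘(ℝ, F) ∞ G]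

theorem mfderiv_chart_one : (mfderiv 𝓘(ℝ, F) 𝓘(ℝ, F) (chartAt F (1 : G)) 1 : F →L[ℝ] F) =
    ContinuousLinearMap.id ℝ F := by
  have hI : IsManifold 𝓘(ℝ, F) 1 G := IsManifold.of_le (n := ∞) (by norm_num)
  exact mfderiv_extChartAt_self (I := 𝓘(ℝ, F)) (x := (1 : G))

/-- The derivative of the multiplication in the second variable is given by left-invariant vector
fields. -/
theorem fderiv_localAct_inr {s : F} (hs : s ∈ (chartAt F (1 : G)).target)
    (hd : DifferentiableAt ℝ (localAct F G (1 : G)) (s, chartAt F (1 : G) 1))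
    (w : GroupLieAlgebra 𝓘(ℝ, F) G) :
    fderiv ℝ (localAct F G (1 : G)) (s, chartAt F (1 : G) 1) (0, w) =
      mfderiv 𝓘(ℝ, F) 𝓘(ℝ, F) (chartAt F (1 : G)) ((chartAt F (1 : G)).symm s)
        (mulInvariantVectorField w ((chartAt F (1 : G)).symm s)) := by
  have hI : IsManifold 𝓘(ℝ, F) 1 G := IsManifold.of_le (n := ∞) (by norm_num)
  set z := (chartAt F (1 : G)).symm s with hz
  have h1 : HasFDerivAt (fun t : F => (s, t)) (ContinuousLinearMap.inr ℝ F F)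
    (chartAt F (1 : G) 1) := hasFDerivAt_prodMk_right _ _
  have h2 := hd.hasFDerivAt.comp (chartAt F (1 : G) 1) h1
  have hm : MDifferentiableAt 𝓘(ℝ, F) 𝓘(ℝ, F) (fun h : G => z * h) 1 :=
    (contMDiff_mul_left (I := 𝓘(ℝ, F)) (n := ∞) (a := z)).mdifferentiableAt (by simp)
  have hc : MDifferentiableAt 𝓘(ℝ, F) 𝓘(ℝ, F) (chartAt F (1 : G)) (z * 1) := by
    rw [mul_one]
    exact mdifferentiableAt_atlas (chart_mem_atlas F 1) ((chartAt F (1 : G)).map_target hs)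
  have h3 : MDifferentiableAt 𝓘(ℝ, F) 𝓘(ℝ, F) (fun h : G => chartAt F (1 : G) (z * h)) 1 :=
    MDifferentiableAt.comp (1 : G) hc hm
  have h4 := HasFDerivAt.unique (𝕜 := ℝ) (E := F) (F := F) (hasDerivAtOne_mfderiv h3) h2
  refine (congrArg (fun A : F →L[ℝ] F => A w) h4).symm.trans ?_
  have h5 : mfderiv 𝓘(ℝ, F) 𝓘(ℝ, F) (fun h : G => chartAt F (1 : G) (z * h)) 1 =
      (mfderiv 𝓘(ℝ, F) 𝓘(ℝ, F) (chartAt F (1 : G)) (z * 1)).comp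
        (mfderiv 𝓘(ℝ, F) 𝓘(ℝ, F) (fun h : G => z * h) 1) :=
    mfderiv_comp (1 : G) hc hm
  have h6 : ∀ p : G, p = z → (mfderiv 𝓘(ℝ, F) 𝓘(ℝ, F) (chartAt F (1 : G)) p : F →L[ℝ] F) =
      (mfderiv 𝓘(ℝ, F) 𝓘(ℝ, F) (chartAt F (1 : G)) z : F →L[ℝ] F) := by
    rintro p rfl; rfl
  refine (congrArg (fun A : F →L[ℝ] F => A w) h5).trans ?_
  exact congrArg (fun A : F →L[ℝ] F => A (mulInvariantVectorField w z)) (h6 _ (mul_one z))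

/-- The left-invariant vector fields, written in the chart at `1` by Mathlib's pullback of vector
fields, are partial derivatives of the multiplication in that chart. -/
theorem eventually_mpullback_mulInvariantVectorField (w : GroupLieAlgebra 𝓘(ℝ, F) G) :
    ∀ᶠ s in nhds (chartAt F (1 : G) 1),
      (VectorField.mpullbackWithin 𝓘(ℝ, F) 𝓘(ℝ, F) (extChartAt 𝓘(ℝ, F) (1 : G)).symm
        (mulInvariantVectorField w) (Set.range 𝓘(ℝ, F)) s : F) =
      fderiv ℝ (localAct F G (1 : G)) (s, chartAt F (1 : G) 1) (0, w) := by
  have hI : IsManifold 𝓘(ℝ, F) 1 G := IsManifold.of_le (n := ∞) (by norm_num)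
  have hH := contDiffAt_localAct (F := F) (G := G) (1 : G) (mem_chart_target F (1 : G))
  have hd : ∀ᶠ s in nhds (chartAt F (1 : G) 1),
      DifferentiableAt ℝ (localAct F G (1 : G)) (s, chartAt F (1 : G) 1) :=
    (Continuous.prodMk_left _).continuousAt.eventually
      (((hH.of_le (m := 1) ENat.LEInfty.out).eventually (by simp)).mono
        fun q hq => hq.differentiableAt (by simp))
  filter_upwards [hd, (chartAt F (1 : G)).open_target.mem_nhds (mem_chart_target F 1)] with s h1 h2
  rw [fderiv_localAct_inr h2 h1, VectorField.mpullbackWithin_apply,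
    ModelWithCorners.range_eq_univ, mfderivWithin_univ]
  have hde : (chartAt F (1 : G)).MDifferentiable 𝓘(ℝ, F) 𝓘(ℝ, F) :=
    mdifferentiable_of_mem_atlas (chart_mem_atlas F 1)
  have h3 := hde.comp_symm_deriv h2
  have h4 := hde.symm_comp_deriv ((chartAt F (1 : G)).map_target h2)
  rw [(chartAt F (1 : G)).right_inv h2] at h4
  have h5 : (mfderiv 𝓘(ℝ, F) 𝓘(ℝ, F) (chartAt F (1 : G)).symm s).inverse =
      mfderiv 𝓘(ℝ, F) 𝓘(ℝ, F) (chartAt F (1 : G)) ((chartAt F (1 : G)).symm s) :=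
    ContinuousLinearMap.inverse_eq h4 h3
  exact congrArg (fun A : F →L[ℝ] F => A (mulInvariantVectorField w ((chartAt F (1 : G)).symm s)))
    h5

/-- The Lie bracket on `T_1 G` through the second derivative of the multiplication in a chart. -/
theorem bracket_eq_lieBracket (v w : GroupLieAlgebra 𝓘(ℝ, F) G) :
    ⁅v, w⁆ = VectorField.lieBracket ℝ
      (fun s => fderiv ℝ (localAct F G (1 : G)) (s, chartAt F (1 : G) 1) (0, v))
      (fun s => fderiv ℝ (localAct F G (1 : G)) (s, chartAt F (1 : G) 1) (0, w))
      (chartAt F (1 : G) 1) := by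
  have hI : IsManifold 𝓘(ℝ, F) 1 G := IsManifold.of_le (n := ∞) (by norm_num)
  rw [GroupLieAlgebra.bracket_def, VectorField.mlieBracket,
    VectorField.mlieBracketWithin_apply, mfderiv_extChartAt_self]
  have h0 : (ContinuousLinearMap.id ℝ F).inverse = ContinuousLinearMap.id ℝ F :=
    ContinuousLinearMap.inverse_id
  refine (congrArg (fun A : F →L[ℝ] F => A _) h0).trans ?_
  rw [ContinuousLinearMap.id_apply]
  have h1 : (extChartAt 𝓘(ℝ, F) (1 : G)).symm ⁻¹' Set.univ ∩ Set.range 𝓘(ℝ, F) = Set.univ := by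
    simp
  rw [h1]
  refine (congrFun (VectorField.lieBracketWithin_univ (𝕜 := ℝ) (E := F)) _).trans ?_
  exact Filter.EventuallyEq.lieBracket_vectorField_eq
    (eventually_mpullback_mulInvariantVectorField v)
    (eventually_mpullback_mulInvariantVectorField w)

theorem localAct_self_right {s : F} (hs : s ∈ (chartAt F (1 : G)).target) :
    localAct F G (1 : G) (s, chartAt F (1 : G) 1) = s := by
  rw [localAct, (chartAt F (1 : G)).left_inv (mem_chart_source F 1), smul_eq_mul, mul_one,
    (chartAt F (1 : G)).right_inv hs]

theorem contMDiff_conj (g : G) : ContMDiff 𝓘(ℝ, F) 𝓘(ℝ, F) ∞ (fun h : G => g * h * g⁻¹) :=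
  (contMDiff_mul_right (I := 𝓘(ℝ, F)) (n := ∞) (a := g⁻¹)).comp
    (contMDiff_mul_left (I := 𝓘(ℝ, F)) (n := ∞) (a := g))

variable (F) in
/-- `Ad g` as a continuous linear map. -/
def AdL (g : G) : F →L[ℝ] F := mfderiv 𝓘(ℝ, F) 𝓘(ℝ, F) (fun h : G => g * h * g⁻¹) 1

theorem hasDerivAtOne_chart_conj (g : G) :
    HasDerivAtOne (fun h : G => chartAt F (1 : G) (g * h * g⁻¹)) (AdL F g) := by
  have hI : IsManifold 𝓘(ℝ, F) 1 G := IsManifold.of_le (n := ∞) (by norm_num)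
  have hm : MDifferentiableAt 𝓘(ℝ, F) 𝓘(ℝ, F) (fun h : G => g * h * g⁻¹) 1 :=
    (contMDiff_conj g).mdifferentiableAt (by simp)
  have h1 : g * 1 * g⁻¹ = 1 := by simp
  have hc : MDifferentiableAt 𝓘(ℝ, F) 𝓘(ℝ, F) (chartAt F (1 : G)) (g * 1 * g⁻¹) := by
    rw [h1]
    exact mdifferentiableAt_atlas (chart_mem_atlas F 1) (mem_chart_source F 1)
  have h3 : MDifferentiableAt 𝓘(ℝ, F) 𝓘(ℝ, F)
      (fun h : G => chartAt F (1 : G) (g * h * g⁻¹)) 1 := MDifferentiableAt.comp (1 : G) hc hm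
  have h5 : mfderiv 𝓘(ℝ, F) 𝓘(ℝ, F) (fun h : G => chartAt F (1 : G) (g * h * g⁻¹)) 1 =
      (mfderiv 𝓘(ℝ, F) 𝓘(ℝ, F) (chartAt F (1 : G)) (g * 1 * g⁻¹)).comp
        (mfderiv 𝓘(ℝ, F) 𝓘(ℝ, F) (fun h : G => g * h * g⁻¹) 1) :=
    mfderiv_comp (1 : G) hc hm
  have h6 : ∀ p : G, p = 1 → (mfderiv 𝓘(ℝ, F) 𝓘(ℝ, F) (chartAt F (1 : G)) p : F →L[ℝ] F) =
      ContinuousLinearMap.id ℝ F := by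
    rintro p rfl; exact mfderiv_chart_one
  have h7 : (mfderiv 𝓘(ℝ, F) 𝓘(ℝ, F) (fun h : G => chartAt F (1 : G) (g * h * g⁻¹)) 1 :
      F →L[ℝ] F) = AdL F g := by
    refine h5.trans ((congrArg (fun A : F →L[ℝ] F => A.comp (AdL F g)) (h6 _ h1)).trans ?_)
    exact ContinuousLinearMap.id_comp _
  have h8 := hasDerivAtOne_mfderiv h3
  exact (congrArg (fun A : F →L[ℝ] F => HasDerivAtOne
    (fun h : G => chartAt F (1 : G) (g * h * g⁻¹)) A) h7).mp h8

/-- The identity `g h = (g h g⁻¹) g`, differentiated in `h` at `1`. -/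
theorem fderiv_localAct_AdL {s : F}
    (h1 : DifferentiableAt ℝ (localAct F G (1 : G)) (s, chartAt F (1 : G) 1))
    (h2 : DifferentiableAt ℝ (localAct F G (1 : G)) (chartAt F (1 : G) 1, s)) (w : F) :
    fderiv ℝ (localAct F G (1 : G)) (chartAt F (1 : G) 1, s)
      (AdL F ((chartAt F (1 : G)).symm s) w, 0) =
    fderiv ℝ (localAct F G (1 : G)) (s, chartAt F (1 : G) 1) (0, w) := by
  set o := chartAt F (1 : G) 1 with ho
  set z := (chartAt F (1 : G)).symm s with hz
  have ho1 : (chartAt F (1 : G)).symm o = 1 := (chartAt F (1 : G)).left_inv (mem_chart_source F 1)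
  have hp := hasDerivAtOne_chart_conj (F := F) z
  set p : F → F := fun t => chartAt F (1 : G) (z * (chartAt F (1 : G)).symm t * z⁻¹) with hpdef
  have hp' : HasFDerivAt p (AdL F z) o := hp
  have hpo : p o = o := by simp [hpdef, ho]
  have h3 : HasFDerivAt (fun t : F => (s, t)) (ContinuousLinearMap.inr ℝ F F) o :=
    hasFDerivAt_prodMk_right _ _
  have h4 := h1.hasFDerivAt.comp o h3
  have h5 : HasFDerivAt (fun t : F => (t, s)) (ContinuousLinearMap.inl ℝ F F) (p o) :=
    hasFDerivAt_prodMk_left _ _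
  have h6 : HasFDerivAt (fun t => (p t, s)) ((ContinuousLinearMap.inl ℝ F F).comp (AdL F z)) o :=
    h5.comp o hp'
  have h7 : HasFDerivAt (localAct F G (1 : G)) (fderiv ℝ (localAct F G (1 : G)) (o, s))
      (p o, s) := by
    rw [hpo]; exact h2.hasFDerivAt
  have h8 := HasFDerivAt.comp (f := fun t => (p t, s)) o h7 h6
  have hev : (localAct F G (1 : G) ∘ fun t => (p t, s)) =ᶠ[nhds o]
      (localAct F G (1 : G) ∘ fun t => (s, t)) := by
    have hc : ContinuousAt (fun t => z * (chartAt F (1 : G)).symm t * z⁻¹) o := by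
      have hcs : ContinuousAt (chartAt F (1 : G)).symm o :=
        (chartAt F (1 : G)).continuousAt_symm (mem_chart_target F 1)
      exact ContinuousAt.comp (g := fun h : G => z * h * z⁻¹)
        (contMDiff_conj (F := F) z).continuous.continuousAt hcs
    have hmem : z * (chartAt F (1 : G)).symm o * z⁻¹ ∈ (chartAt F (1 : G)).source := by
      rw [ho1]; simp
    filter_upwards [hc.eventually ((chartAt F (1 : G)).open_source.mem_nhds hmem)] with t ht
    simp only [Function.comp_apply, localAct, hpdef, (chartAt F (1 : G)).left_inv ht, smul_eq_mul]
    rw [← hz]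
    simp
  have h9 := (h4.congr_of_eventuallyEq hev).unique h8
  exact (congrArg (fun A : F →L[ℝ] F => A w) h9).symm

/-- For a local multiplication `m` with unit `o`, if `a s` is the right-translate back to the unit
of the left-invariant vector field `w` at `s`, then the derivative of `a` at `o` is given by Lie
brackets of left-invariant vector fields; this is the symmetry of the second derivative of `m`. -/
theorem hasFDerivAt_of_local_mul [CompleteSpace F] {m : F × F → F} {o : F}
    (hH : ContDiffAt ℝ ∞ m (o, o)) (hl : ∀ᶠ s in nhds o, m (s, o) = s)
    (hr : ∀ᶠ s in nhds o, m (o, s) = s) {a : F → F} {w : F}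
    (hBa : ∀ᶠ s in nhds o, fderiv ℝ m (o, s) (a s, 0) = fderiv ℝ m (s, o) (0, w)) :
    ∃ A : F →L[ℝ] F, HasFDerivAt a A o ∧
      ∀ v, A v = VectorField.lieBracket ℝ (fun s => fderiv ℝ m (s, o) (0, v))
        (fun s => fderiv ℝ m (s, o) (0, w)) o := by
  have hD : HasFDerivAt (fderiv ℝ m) (fderiv ℝ (fderiv ℝ m) (o, o)) (o, o) :=
    ((hH.fderiv_right (m := 1)
      (by rw [one_add_one_eq_two]; exact ENat.LEInfty.out)).differentiableAt (by simp)).hasFDerivAt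
  set D2 := fderiv ℝ (fderiv ℝ m) (o, o) with hD2
  have hsymm : ∀ p q : F × F, D2 p q = D2 q p :=
    hH.isSymmSndFDerivAt (by simp only [minSmoothness_of_isRCLikeNormedField];
                             exact ENat.LEInfty.out)
  -- the left-invariant vector fields in the chart
  have hW : ∀ u : F, HasFDerivAt (fun s => fderiv ℝ m (s, o) (0, u))
      ((ContinuousLinearMap.apply ℝ F ((0, u) : F × F)).comp
        (D2.comp (ContinuousLinearMap.inl ℝ F F))) o := fun u =>
    (ContinuousLinearMap.apply ℝ F ((0, u) : F × F)).hasFDerivAt.comp o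
      (HasFDerivAt.comp (f := fun s : F => (s, o)) o hD (hasFDerivAt_prodMk_left o o))
  have hinr : ∀ u : F, fderiv ℝ m (o, o) (0, u) = u := fun u =>
    fderiv_inr_of_eventually_id (hH.differentiableAt (by simp)) hr u
  have hinl : ∀ u : F, fderiv ℝ m (o, o) (u, 0) = u := fun u => by
    have h3 : HasFDerivAt (fun z : F => (z, o)) (ContinuousLinearMap.inl ℝ F F) o :=
      hasFDerivAt_prodMk_left o o
    have h4 := HasFDerivAt.comp (f := fun z : F => (z, o)) o
      (hH.differentiableAt (by simp)).hasFDerivAt h3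
    have h5 : HasFDerivAt (m ∘ fun z : F => (z, o)) (ContinuousLinearMap.id ℝ F) o := by
      exact (hasFDerivAt_id o).congr_of_eventuallyEq hl
    exact congrArg (fun A : F →L[ℝ] F => A u) (h4.unique h5)
  -- the right multiplications in the chart
  let B : F → F →L[ℝ] F := fun s => (fderiv ℝ m (o, s)).comp (ContinuousLinearMap.inl ℝ F F)
  have hB : HasFDerivAt B (((ContinuousLinearMap.compL ℝ F (F × F) F).flip
      (ContinuousLinearMap.inl ℝ F F)).comp (D2.comp (ContinuousLinearMap.inr ℝ F F))) o :=
    ((ContinuousLinearMap.compL ℝ F (F × F) F).flip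
      (ContinuousLinearMap.inl ℝ F F)).hasFDerivAt.comp o
      (hD.comp o (hasFDerivAt_prodMk_right o o))
  have hBo : B o = ContinuousLinearMap.id ℝ F := by ext u; exact hinl u
  have hinv : ∀ᶠ s in nhds o, (B s).IsInvertible := by
    refine hB.continuousAt.eventually ?_
    rw [hBo]
    exact ContinuousLinearEquiv.nhds (ContinuousLinearEquiv.refl ℝ F)
  have hBinv : DifferentiableAt ℝ (fun s => (B s).inverse) o := by
    have h1 : DifferentiableAt ℝ (ContinuousLinearMap.inverse : (F →L[ℝ] F) → _) (B o) := by
      rw [hBo]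
      exact (contDiffAt_map_inverse (n := 1) (ContinuousLinearEquiv.refl ℝ F)).differentiableAt
        (by simp)
    exact h1.comp o hB.differentiableAt
  -- solving `hBa` for `a` shows that `a` is differentiable
  have haeq : a =ᶠ[nhds o] fun s => (B s).inverse (fderiv ℝ m (s, o) (0, w)) := by
    filter_upwards [hBa, hinv] with s h1 h2
    rw [← h1]
    exact (congrArg (fun A : F →L[ℝ] F => A (a s)) h2.inverse_comp_self).symm
  have ha : DifferentiableAt ℝ a o :=
    (hBinv.clm_apply (hW w).differentiableAt).congr_of_eventuallyEq haeq
  have hao : a o = w := by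
    have := hBa.self_of_nhds
    rwa [hinl, hinr] at this
  refine ⟨fderiv ℝ a o, ha.hasFDerivAt, fun v => ?_⟩
  -- both sides of `hBa` are differentiated at `o`
  have h1 := (hB.clm_apply ha.hasFDerivAt).unique ((hW w).congr_of_eventuallyEq hBa)
  have h2 := congrArg (fun A : F →L[ℝ] F => A v) h1
  simp only [add_apply, ContinuousLinearMap.comp_apply,
    ContinuousLinearMap.flip_apply, ContinuousLinearMap.compL_apply, hBo, hao,
    ContinuousLinearMap.id_apply, ContinuousLinearMap.inl_apply, ContinuousLinearMap.inr_apply,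
    ContinuousLinearMap.apply_apply] at h2
  rw [VectorField.lieBracket, (hW w).fderiv, (hW v).fderiv]
  simp only [ContinuousLinearMap.comp_apply, ContinuousLinearMap.inl_apply,
    ContinuousLinearMap.apply_apply, hinr]
  rw [← h2, hsymm (0, v) (w, 0)]
  simp

/-- The derivative of the adjoint action is the Lie bracket of left-invariant vector fields. -/
theorem hasDerivAtOne_AdL [CompleteSpace F] (w : GroupLieAlgebra 𝓘(ℝ, F) G) :
    ∃ A : F →L[ℝ] F, HasDerivAtOne (fun g : G => AdL F g w) A ∧
      ∀ v : GroupLieAlgebra 𝓘(ℝ, F) G, A v = ⁅v, w⁆ := by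
  have hot : chartAt F (1 : G) 1 ∈ (chartAt F (1 : G)).target := mem_chart_target F 1
  have hH := contDiffAt_localAct (F := F) (G := G) (1 : G) hot
  have hd : ∀ᶠ q in nhds (chartAt F (1 : G) 1, chartAt F (1 : G) 1),
      DifferentiableAt ℝ (localAct F G (1 : G)) q :=
    ((hH.of_le (m := 1) ENat.LEInfty.out).eventually (by simp)).mono
        fun q hq => hq.differentiableAt (by simp)
  obtain ⟨A, hA, hA'⟩ := hasFDerivAt_of_local_mul hH
    (a := fun s => AdL F ((chartAt F (1 : G)).symm s) w) (w := w)
    (by filter_upwards [(chartAt F (1 : G)).open_target.mem_nhds hot] with s hs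
        exact localAct_self_right hs)
    (eventually_localAct_one (F := F) (1 : G))
    (by filter_upwards [(Continuous.prodMk_left _).continuousAt.eventually hd,
          (Continuous.prodMk_right _).continuousAt.eventually hd] with s h1 h2
        exact fderiv_localAct_AdL h1 h2 w)
  exact ⟨A, hA, fun v => (hA' v).trans (bracket_eq_lieBracket v w).symm⟩

end Adjoint

/-! ### Cartan calculus on differential forms -/

section CartanCalculus

variable {E : Type*} [NormedAddCommGroup E] [NormedSpace ℝ E]
  {M : Type*} [TopologicalSpace M] [ChartedSpace E M] [IsManifold 𝓘(ℝ, E) ∞ M]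

theorem extD_extD {k : ℕ} (η : Form E M k) : extD (k + 1) (extD k η) = 0 := by
  apply Subtype.ext
  funext x
  have h1 : localRep (rawD η.1) (chartAt E x) =ᶠ[nhds (chartAt E x x)]
      extDeriv (localRep η.1 (chartAt E x)) := by
    filter_upwards [(chartAt E x).open_target.mem_nhds (mem_chart_target E x)] with y hy
    exact localRep_rawD η (chart_mem_atlas E x) hy
  have h2 : extDeriv (localRep (rawD η.1) (chartAt E x)) (chartAt E x x) = 0 := by
    rw [h1.extDeriv_eq]
    exact extDeriv_extDeriv_apply (r := ∞) ((η.2 _ (chart_mem_atlas E x)).contDiffAt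
      ((chartAt E x).open_target.mem_nhds (mem_chart_target E x)))
      (by simp only [minSmoothness_of_isRCLikeNormedField]; exact ENat.LEInfty.out)
  change (extDeriv (localRep (rawD η.1) (chartAt E x)) (chartAt E x x)).compContinuousLinearMap
    (mfderiv 𝓘(ℝ, E) 𝓘(ℝ, E) (chartAt E x) x : E →L[ℝ] E) = 0
  rw [h2]
  rfl

theorem dR_dR (η : Forms E M) : dR (dR η) = 0 := by
  induction η using forms_induction with
  | h0 => simp
  | hadd η θ h1 h2 => simp [h1, h2]
  | hlof k η => rw [dR_lof, dR_lof, extD_extD, map_zero]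

theorem alternating_cons_cons_swap {k : ℕ} (α : E [⋀^Fin (k + 2)]→L[ℝ] ℝ) (u w : E)
    (v : Fin k → E) : α (Matrix.vecCons u (Matrix.vecCons w v)) =
      - α (Matrix.vecCons w (Matrix.vecCons u v)) := by
  have h := α.toAlternatingMap.map_swap (Matrix.vecCons w (Matrix.vecCons u v))
    (i := 0) (j := 1) (by simp)
  have h2 : (Matrix.vecCons w (Matrix.vecCons u v) : Fin (k + 2) → E) ∘
      Equiv.swap 0 1 = Matrix.vecCons u (Matrix.vecCons w v) := by
    funext i
    refine Fin.cases ?_ (fun i => Fin.cases ?_ (fun j => ?_) i) i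
    · simp
    · simp
    · rw [Function.comp_apply, Equiv.swap_apply_of_ne_of_ne]
      · simp
      · exact Fin.succ_ne_zero _
      · intro h
        exact Fin.succ_ne_zero _ (Fin.succ_injective _ (h.trans (Fin.succ_zero_eq_one).symm))
  rw [← h2]
  exact h

theorem contract_contract (X Y : VField E M) {k : ℕ} (η : Form E M (k + 2)) :
    contract X k (contract Y (k + 1) η) = - contract Y k (contract X (k + 1) η) := by
  apply Subtype.ext
  funext x
  ext v
  exact alternating_cons_cons_swap (E := E) (η.1 x) (Y.val x) (X.val x) v

theorem iota_iota (X Y : VField E M) (η : Forms E M) :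
    iota X (iota Y η) = - iota Y (iota X η) := by
  induction η using forms_induction with
  | h0 => simp
  | hadd η θ h1 h2 => simp only [map_add, h1, h2, neg_add]
  | hlof k η =>
    rcases k with _ | _ | k
    · simp [iota_lof_zero]
    · rw [iota_lof_succ, iota_lof_succ, iota_lof_zero, iota_lof_zero, neg_zero]
    · rw [iota_lof_succ, iota_lof_succ, iota_lof_succ, iota_lof_succ, contract_contract, map_neg]

theorem iota_iota_self (X : VField E M) (η : Forms E M) : iota X (iota X η) = 0 := by
  refine forms_ext fun k x v => ?_
  have h := congrArg (evForm x v) (iota_iota X X η)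
  rw [map_neg] at h
  rw [map_zero]
  linarith

theorem evForm_iota (X : VField E M) {k : ℕ} (x : M) (v : Fin k → TangentSpace 𝓘(ℝ, E) x)
    (η : Forms E M) :
    evForm x v (iota X η) = evForm (k := k + 1) x (Matrix.vecCons (X.val x) v) η := by
  induction η using forms_induction with
  | h0 => simp
  | hadd η θ h1 h2 => simp only [map_add, h1, h2]
  | hlof l η =>
    rcases l with _ | l
    · rw [iota_lof_zero, map_zero, evForm_lof_of_ne (by omega)]
    · rw [iota_lof_succ]
      by_cases h : l = k
      · subst h
        rw [evForm_lof_self, evForm_lof_self]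
        rfl
      · rw [evForm_lof_of_ne h, evForm_lof_of_ne (by omega)]

variable [FiniteDimensional ℝ E]

/-- Pullback of forms, on values. For a form with components of several degrees this needs no case
distinction. -/
theorem evForm_pull {f : M → M} (hf : ContMDiff 𝓘(ℝ, E) 𝓘(ℝ, E) ∞ f) {k : ℕ} (x : M)
    (v : Fin k → TangentSpace 𝓘(ℝ, E) x) (η : Forms E M) :
    evForm x v (pull f hf η) = evForm (f x) (fun i => mfderiv 𝓘(ℝ, E) 𝓘(ℝ, E) f x (v i)) η := by
  induction η using forms_induction with
  | h0 => simp
  | hadd η θ h1 h2 => simp only [map_add, h1, h2]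
  | hlof l η =>
    rw [pull_lof]
    by_cases h : l = k
    · subst h
      rw [evForm_lof_self, evForm_lof_self]
      rfl
    · rw [evForm_lof_of_ne h, evForm_lof_of_ne h]

theorem pull_pull {f g : M → M} (hf : ContMDiff 𝓘(ℝ, E) 𝓘(ℝ, E) ∞ f)
    (hg : ContMDiff 𝓘(ℝ, E) 𝓘(ℝ, E) ∞ g) (η : Forms E M) :
    pull f hf (pull g hg η) = pull (fun x => g (f x)) (hg.comp hf) η := by
  refine forms_ext fun k x v => ?_
  rw [evForm_pull, evForm_pull, evForm_pull]
  have h : mfderiv 𝓘(ℝ, E) 𝓘(ℝ, E) (fun x => g (f x)) x =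
      (mfderiv 𝓘(ℝ, E) 𝓘(ℝ, E) g (f x)).comp (mfderiv 𝓘(ℝ, E) 𝓘(ℝ, E) f x) :=
    mfderiv_comp x (hg.mdifferentiableAt (by simp)) (hf.mdifferentiableAt (by simp))
  simp only [h]
  rfl

theorem pull_id (η : Forms E M) : pull (fun x : M => x) contMDiff_id η = η := by
  refine forms_ext fun k x v => ?_
  rw [evForm_pull]
  have h : mfderiv 𝓘(ℝ, E) 𝓘(ℝ, E) (fun x : M => x) x = ContinuousLinearMap.id ℝ _ := mfderiv_id
  simp only [h]
  rfl

/-- The exterior derivative commutes with pullback. -/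
theorem pullback_extD {f : M → M} (hf : ContMDiff 𝓘(ℝ, E) 𝓘(ℝ, E) ∞ f) {k : ℕ} (η : Form E M k) :
    pullback f hf (k + 1) (extD k η) = extD k (pullback f hf k η) := by
  apply Subtype.ext
  funext x
  ext v
  set c := chartAt E x with hc
  set c' := chartAt E (f x) with hc'
  have hca : c ∈ atlas E M := chart_mem_atlas E x
  have hca' : c' ∈ atlas E M := chart_mem_atlas E (f x)
  have hx : c.symm (c x) = x := c.left_inv (mem_chart_source E x)
  have hct : c x ∈ c.target := mem_chart_target E x
  have hy' : f (c.symm (c x)) ∈ c'.source := by rw [hx]; exact mem_chart_source E (f x)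
  have h1 : (pullback f hf (k + 1) (extD k η)).1 x v = _ :=
    rawForm_apply_eq_localRep (rawPullback f (rawD η.1)) x v
  rw [h1, localRep_rawPullback hf _ hca hca' hct hy', localRep_rawD η hca' (c'.map_source hy')]
  change _ = extDeriv (localRep (rawPullback f η.1) c) (c x)
    (fun i => mfderiv 𝓘(ℝ, E) 𝓘(ℝ, E) c x (v i))
  congr 1
  have hcont : ContinuousAt (fun z => f (c.symm z)) (c x) :=
    ContinuousAt.comp (g := f) hf.continuous.continuousAt (c.continuousAt_symm hct)
  have hev : localRep (rawPullback f η.1) c =ᶠ[nhds (c x)] fun z =>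
      (localRep η.1 c' (c' (f (c.symm z)))).compContinuousLinearMap
        (fderiv ℝ (fun z => c' (f (c.symm z))) z) := by
    filter_upwards [c.open_target.mem_nhds hct,
      hcont.preimage_mem_nhds (c'.open_source.mem_nhds hy')] with z hz hz'
    exact localRep_rawPullback hf η.1 hca hca' hz hz'
  rw [hev.extDeriv_eq]
  have hη : DifferentiableAt ℝ (localRep η.1 c') (c' (f (c.symm (c x)))) :=
    ((η.2 c' hca').contDiffAt (c'.open_target.mem_nhds (c'.map_source hy'))).differentiableAt
      (by simp)
  exact (extDeriv_pullback (f := fun z => c' (f (c.symm z))) hη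
    (contDiffAt_coord hf hca hca' hct hy')
    (by simp only [minSmoothness_of_isRCLikeNormedField]; exact ENat.LEInfty.out)).symm

theorem pull_dR {f : M → M} (hf : ContMDiff 𝓘(ℝ, E) 𝓘(ℝ, E) ∞ f) (η : Forms E M) :
    pull f hf (dR η) = dR (pull f hf η) := by
  induction η using forms_induction with
  | h0 => simp
  | hadd η θ h1 h2 => simp only [map_add, h1, h2]
  | hlof k η => rw [dR_lof, pull_lof, pull_lof, dR_lof, pullback_extD]

end CartanCalculus

/-! ### Fundamental vector fields and the adjoint action -/

section Equivariance

variable {F : Type*} [NormedAddCommGroup F] [NormedSpace ℝ F]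
  {G : Type*} [TopologicalSpace G] [ChartedSpace F G] [Group G] [LieGroup 𝓘(ℝ, F) ∞ G]
  {E : Type*} [NormedAddCommGroup E] [NormedSpace ℝ E]
  {M : Type*} [TopologicalSpace M] [ChartedSpace E M] [IsManifold 𝓘(ℝ, E) ∞ M]
  [MulAction G M] [ContMDiffSMul 𝓘(ℝ, F) 𝓘(ℝ, E) ∞ G M]

/-- `X_{Ad_g ξ}(g x) = g_* X_ξ(x)`. -/
theorem fundVF_Ad (g : G) (ξ : GroupLieAlgebra 𝓘(ℝ, F) G) (x : M) :
    (fundVF E M (Ad g ξ)).val (g • x) =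
      mfderiv 𝓘(ℝ, E) 𝓘(ℝ, E) (fun z : M => g • z) x ((fundVF E M ξ).val x) := by
  have h0 : g * 1 * g⁻¹ = 1 := by simp
  have hk : MDifferentiableAt 𝓘(ℝ, F) 𝓘(ℝ, F) (fun h : G => g * h * g⁻¹) 1 :=
    (contMDiff_conj g).mdifferentiableAt (by simp)
  have ho : ∀ (h : G) (y : M), MDifferentiableAt 𝓘(ℝ, F) 𝓘(ℝ, E) (fun h : G => h • y) h :=
    fun h y => (contMDiff_orbit y).mdifferentiableAt (by simp)
  have hg : ∀ y : M, MDifferentiableAt 𝓘(ℝ, E) 𝓘(ℝ, E) (fun z : M => g • z) y :=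
    fun y => (contMDiff_smul_left F g).mdifferentiableAt (by simp)
  have h1 : mfderiv 𝓘(ℝ, F) 𝓘(ℝ, E) (fun h : G => (g * h * g⁻¹) • (g • x)) 1 =
      (mfderiv 𝓘(ℝ, F) 𝓘(ℝ, E) (fun h : G => h • (g • x)) (g * 1 * g⁻¹)).comp
        (mfderiv 𝓘(ℝ, F) 𝓘(ℝ, F) (fun h : G => g * h * g⁻¹) 1) :=
    mfderiv_comp (1 : G) (ho _ _) hk
  have h2 : mfderiv 𝓘(ℝ, F) 𝓘(ℝ, E) (fun h : G => g • (h • x)) 1 =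
      (mfderiv 𝓘(ℝ, E) 𝓘(ℝ, E) (fun z : M => g • z) ((1 : G) • x)).comp
        (mfderiv 𝓘(ℝ, F) 𝓘(ℝ, E) (fun h : G => h • x) 1) :=
    mfderiv_comp (1 : G) (hg _) (ho _ _)
  have h3 : (fun h : G => (g * h * g⁻¹) • (g • x)) = fun h : G => g • (h • x) := by
    funext h
    simp only [smul_smul]
    congr 1
    group
  have h4 : ∀ p : G, p = 1 →
      (mfderiv 𝓘(ℝ, F) 𝓘(ℝ, E) (fun h : G => h • (g • x)) p : F →L[ℝ] E) =
      (mfderiv 𝓘(ℝ, F) 𝓘(ℝ, E) (fun h : G => h • (g • x)) 1 : F →L[ℝ] E) := by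
    rintro p rfl; rfl
  have h5 : ∀ p : M, p = x → (mfderiv 𝓘(ℝ, E) 𝓘(ℝ, E) (fun z : M => g • z) p : E →L[ℝ] E) =
      (mfderiv 𝓘(ℝ, E) 𝓘(ℝ, E) (fun z : M => g • z) x : E →L[ℝ] E) := by
    rintro p rfl; rfl
  have h6 : ∀ k k' : G → M, k = k' → (mfderiv 𝓘(ℝ, F) 𝓘(ℝ, E) k 1 : F →L[ℝ] E) =
      (mfderiv 𝓘(ℝ, F) 𝓘(ℝ, E) k' 1 : F →L[ℝ] E) := by
    rintro k k' rfl; rfl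
  let A : F →L[ℝ] E := mfderiv 𝓘(ℝ, F) 𝓘(ℝ, E) (fun h : G => h • x) 1
  have h7 := (congrArg (fun B : F →L[ℝ] E => B.comp (AdL F g)) (h4 _ h0)).symm.trans
    (h1.symm.trans ((h6 _ _ h3).trans (h2.trans
      (congrArg (fun B : E →L[ℝ] E => B.comp A) (h5 _ (one_smul G x))))))
  exact congrArg (fun B : F →L[ℝ] E => B ξ) h7

/-- Equivariance of the contraction: `g^* ι_{Ad_g ξ} = ι_ξ g^*`. -/
theorem pull_iota [FiniteDimensional ℝ E] (g : G) (ξ : GroupLieAlgebra 𝓘(ℝ, F) G)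
    (η : Forms E M) :
    pull (fun z : M => g • z) (contMDiff_smul_left F g) (iota (fundVF E M (Ad g ξ)) η) =
      iota (fundVF E M ξ) (pull (fun z : M => g • z) (contMDiff_smul_left F g) η) := by
  refine forms_ext fun k x v => ?_
  rw [evForm_pull, evForm_iota, evForm_iota, evForm_pull, fundVF_Ad]
  congr 2
  funext i
  refine Fin.cases ?_ (fun j => ?_) i <;> rfl

theorem Ad_mul (g h : G) : Ad (F := F) (g * h) = Ad g ∘ₗ Ad h := by
  have h0 : h * 1 * h⁻¹ = 1 := by simp
  have hk : ∀ (g p : G), MDifferentiableAt 𝓘(ℝ, F) 𝓘(ℝ, F) (fun h : G => g * h * g⁻¹) p :=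
    fun g p => (contMDiff_conj g).mdifferentiableAt (by simp)
  have h1 : mfderiv 𝓘(ℝ, F) 𝓘(ℝ, F) (fun k : G => g * (h * k * h⁻¹) * g⁻¹) 1 =
      (mfderiv 𝓘(ℝ, F) 𝓘(ℝ, F) (fun k : G => g * k * g⁻¹) (h * 1 * h⁻¹)).comp
        (mfderiv 𝓘(ℝ, F) 𝓘(ℝ, F) (fun k : G => h * k * h⁻¹) 1) :=
    mfderiv_comp (1 : G) (hk _ _) (hk _ _)
  have h2 : (fun k : G => (g * h) * k * (g * h)⁻¹) = fun k : G => g * (h * k * h⁻¹) * g⁻¹ := by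
    funext k; group
  have h4 : ∀ p : G, p = 1 →
      (mfderiv 𝓘(ℝ, F) 𝓘(ℝ, F) (fun k : G => g * k * g⁻¹) p : F →L[ℝ] F) = AdL F g := by
    rintro p rfl; rfl
  have h6 : ∀ k k' : G → G, k = k' → (mfderiv 𝓘(ℝ, F) 𝓘(ℝ, F) k 1 : F →L[ℝ] F) =
      (mfderiv 𝓘(ℝ, F) 𝓘(ℝ, F) k' 1 : F →L[ℝ] F) := by
    rintro k k' rfl; rfl
  have h7 : AdL F (g * h) = (AdL F g).comp (AdL F h) := (h6 _ _ h2).trans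
    (h1.trans (congrArg (fun B : F →L[ℝ] F => B.comp (AdL F h)) (h4 _ h0)))
  refine LinearMap.ext fun w => ?_
  exact congrArg (fun B : F →L[ℝ] F => B w) h7

theorem Ad_one : Ad (F := F) (1 : G) = LinearMap.id := by
  have h2 : (fun k : G => 1 * k * 1⁻¹) = fun k : G => k := by funext k; simp
  have h6 : ∀ k k' : G → G, k = k' → (mfderiv 𝓘(ℝ, F) 𝓘(ℝ, F) k 1 : F →L[ℝ] F) =
      (mfderiv 𝓘(ℝ, F) 𝓘(ℝ, F) k' 1 : F →L[ℝ] F) := by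
    rintro k k' rfl; rfl
  have h7 : AdL F (1 : G) = ContinuousLinearMap.id ℝ F := (h6 _ _ h2).trans mfderiv_id
  refine LinearMap.ext fun w => ?_
  exact congrArg (fun B : F →L[ℝ] F => B w) h7

section Derivatives

variable {E₁ E₂ : Type*} [NormedAddCommGroup E₁] [NormedSpace ℝ E₁]
  [NormedAddCommGroup E₂] [NormedSpace ℝ E₂]

theorem HasDerivAtOne.unique {h : G → E₁} {A B : F →L[ℝ] E₁} (hA : HasDerivAtOne h A)
    (hB : HasDerivAtOne h B) : A = B := HasFDerivAt.unique hA hB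

theorem HasDerivAtOne.clm_comp {h : G → E₁} {A : F →L[ℝ] E₁} (L : E₁ →L[ℝ] E₂)
    (hA : HasDerivAtOne h A) : HasDerivAtOne (fun g => L (h g)) (L.comp A) :=
  L.hasFDerivAt.comp _ hA

theorem HasDerivAtOne.sum {κ : Type*} {u : Finset κ} {h : κ → G → E₁} {A : κ → F →L[ℝ] E₁}
    (hA : ∀ i ∈ u, HasDerivAtOne (h i) (A i)) :
    HasDerivAtOne (fun g => ∑ i ∈ u, h i g) (∑ i ∈ u, A i) :=
  HasFDerivAt.fun_sum hA

theorem HasDerivAtOne.add {h k : G → E₁} {A B : F →L[ℝ] E₁} (hA : HasDerivAtOne h A)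
    (hB : HasDerivAtOne k B) : HasDerivAtOne (fun g => h g + k g) (A + B) :=
  HasFDerivAt.add hA hB

theorem HasDerivAtOne.mul {h k : G → ℝ} {A B : F →L[ℝ] ℝ} (hA : HasDerivAtOne h A)
    (hB : HasDerivAtOne k B) : HasDerivAtOne (fun g => h g * k g) (h 1 • B + k 1 • A) := by
  have h1 : (chartAt F (1 : G)).symm (chartAt F (1 : G) 1) = 1 :=
    (chartAt F (1 : G)).left_inv (mem_chart_source F 1)
  have := HasFDerivAt.mul hA hB
  rw [h1] at this
  exact this

theorem hasDerivAtOne_const (c : E₁) : HasDerivAtOne (F := F) (fun _ : G => c) 0 :=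
  hasFDerivAt_const _ _

end Derivatives

variable [FiniteDimensional ℝ F] [FiniteDimensional ℝ E]

/-- The matrix coefficients of the adjoint action have the Lie bracket as derivative at `1`. -/
theorem hasDerivAtOne_dual_Ad (l : Dual ℝ (GroupLieAlgebra 𝓘(ℝ, F) G))
    (w : GroupLieAlgebra 𝓘(ℝ, F) G) :
    ∃ A : F →L[ℝ] ℝ, HasDerivAtOne (fun g : G => l (Ad g w)) A ∧
      ∀ v : GroupLieAlgebra 𝓘(ℝ, F) G, A v = l ⁅v, w⁆ := by
  have : CompleteSpace F := FiniteDimensional.complete ℝ F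
  obtain ⟨A, hA, hA'⟩ := hasDerivAtOne_AdL (F := F) (G := G) w
  let L : F →L[ℝ] ℝ := LinearMap.toContinuousLinearMap (E := F) (F' := ℝ) l
  refine ⟨L.comp A, hA.clm_comp L, fun v => ?_⟩
  rw [← hA' v]
  rfl

/-- `[L_ζ, ι_ξ] = - ι_{[ζ, ξ]}`, the bracket being that of left-invariant vector fields. It is the
derivative at `1` of the equivariance of the contraction. -/
theorem lieD_iota {ι : Type*} [Fintype ι] [DecidableEq ι]
    (b : Basis ι ℝ (GroupLieAlgebra 𝓘(ℝ, F) G)) (ζ ξ : GroupLieAlgebra 𝓘(ℝ, F) G)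
    (η : Forms E M) :
    lieD E M ζ (iota (fundVF E M ξ) η) =
      iota (fundVF E M ξ) (lieD E M ζ η) - iota (fundVF E M ⁅ζ, ξ⁆) η := by
  refine forms_ext fun k x v => ?_
  obtain ⟨A, hA, hA'⟩ := hasDerivAtOne_evForm_pull (F := F) (G := G) η (k := k + 1) x
    (Matrix.vecCons ((fundVF E M ξ).val x) v)
  choose B hB hB' using fun a => hasDerivAtOne_evForm_pull (F := F) (G := G)
    (iota (fundVF E M (b a)) η) x v
  choose C hC hC' using fun a => hasDerivAtOne_dual_Ad (F := F) (G := G) (b.coord a) ξ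
  -- both sides of `g^* ι_{Ad_g ξ} η = ι_ξ g^* η` are differentiated, with `Ad_g ξ` expanded in `b`
  have h1 := HasDerivAtOne.sum (u := Finset.univ) fun a _ => (hC a).mul (hB a)
  have h2 : (fun g : G => ∑ a, b.coord a (Ad g ξ) * evForm x v (pull (fun z : M => g • z)
      (contMDiff_smul_left F g) (iota (fundVF E M (b a)) η))) =
      fun g : G => evForm (k := k + 1) x (Matrix.vecCons ((fundVF E M ξ).val x) v)
        (pull (fun z : M => g • z) (contMDiff_smul_left F g) η) := by
    funext g
    rw [← evForm_iota, ← pull_iota, iota_fundVF_eq_sum E M b (Ad g ξ), LinearMap.sum_apply,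
      map_sum, map_sum]
    simp only [LinearMap.smul_apply, map_smul, smul_eq_mul]
  rw [h2] at h1
  -- the Lie algebra is definitionally the model space, on which the linear maps are evaluated
  let ζ' : F := ζ
  have h3 := congrArg (fun A : F →L[ℝ] ℝ => A ζ') (hA.unique h1)
  have hA'' : A ζ' = _ := hA' ζ
  have hB'' : ∀ a, B a ζ' = _ := fun a => hB' a ζ
  have hC'' : ∀ a, C a ζ' = _ := fun a => hC' a ζ
  simp only [sum_apply, add_apply, smul_apply, smul_eq_mul, hA'', hB'', hC'', Ad_one,
    LinearMap.id_apply, one_smul, pull_id, Finset.sum_add_distrib] at h3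
  rw [iota_fundVF_eq_sum E M b ξ, iota_fundVF_eq_sum E M b ⁅ζ, ξ⁆]
  have h4 : evForm x v (iota (fundVF E M ξ) (lieD E M ζ η)) = _ := (evForm_iota _ x v _).trans h3
  rw [iota_fundVF_eq_sum E M b ξ] at h4
  simp only [LinearMap.sum_apply, LinearMap.smul_apply, map_sum, map_smul, map_sub, smul_eq_mul]
    at h4 ⊢
  rw [h4, add_sub_assoc]
  simp [mul_comm]

end Equivariance

/-! ### Exponentials of nilpotent operators -/

section NilExp

variable {T : Type*} [AddCommGroup T] [Module ℝ T]

theorem nilExp_eq_sum {A : Module.End ℝ T} {N : ℕ} (h : A ^ N = 0) :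
    nilExp A = ∑ i ∈ Finset.range N, ((Nat.factorial i : ℝ)⁻¹) • A ^ i := by
  have h₁ := Finset.sum_range_add_sum_Ico
    (fun i => ((Nat.factorial i : ℝ)⁻¹) • A ^ i) (show nilpotencyClass A ≤ N from csInf_le' h)
  rw [← h₁, nilExp, left_eq_add]
  exact Finset.sum_eq_zero fun i hi => by
    rw [pow_eq_zero_of_le (Finset.mem_Ico.1 hi).1 (pow_nilpotencyClass ⟨N, h⟩), smul_zero]

theorem nilExp_mul_nilExp_neg {A : Module.End ℝ T} (h : IsNilpotent A) :
    nilExp A * nilExp (-A) = 1 := by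
  -- Mathlib's exponential of a nilpotent element is that of a `ℚ`-algebra
  let _ : Module ℚ (Module.End ℝ T) := Module.compHom _ (algebraMap ℚ ℝ)
  have h₁ : ∀ B : Module.End ℝ T, nilExp B = IsNilpotent.exp B := fun B => by
    refine Finset.sum_congr rfl fun i _ => ?_
    change _ = (algebraMap ℚ ℝ ((Nat.factorial i : ℚ)⁻¹)) • B ^ i
    simp
  rw [h₁, h₁, IsNilpotent.exp_mul_exp_neg_self h]

theorem isUnit_nilExp {A : Module.End ℝ T} (h : IsNilpotent A) : IsUnit (nilExp A) :=
  ⟨⟨nilExp A, nilExp (-A), nilExp_mul_nilExp_neg h,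
    by simpa using nilExp_mul_nilExp_neg h.neg⟩, rfl⟩

theorem inverse_nilExp {A : Module.End ℝ T} (h : IsNilpotent A) :
    Ring.inverse (nilExp A) = nilExp (-A) := by
  have h₁ : nilExp (-A) * nilExp A = 1 := by simpa using nilExp_mul_nilExp_neg h.neg
  exact Ring.inverse_unit ⟨nilExp A, nilExp (-A), nilExp_mul_nilExp_neg h, h₁⟩

theorem commute_nilExp {A B : Module.End ℝ T} (h : Commute A B) :
    Commute (nilExp A) B :=
  Commute.sum_left _ _ _ fun i _ => (h.pow_left i).smul_left _

/-- `Ad (exp K) = exp (ad K)` when the exponential series of `ad K` stops after the quadratic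
term. -/
theorem nilExp_mul_of_commutator {K X Y Z : Module.End ℝ T} (hK : IsNilpotent K)
    (hX : K * X = X * K + Y) (hY : K * Y = Y * K + Z) (hZ : K * Z = Z * K) :
    nilExp K * X = (X + Y + (1 / 2 : ℝ) • Z) * nilExp K := by
  have hZn : ∀ n, K ^ n * Z = Z * K ^ n := fun n => ((show Commute K Z from hZ).pow_left n).eq
  have hYn : ∀ n : ℕ, K ^ (n + 1) * Y = Y * K ^ (n + 1) + ((n : ℝ) + 1) • (Z * K ^ n) := by
    intro n
    induction n with
    | zero => simp [hY]
    | succ n ih =>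
      rw [pow_succ' K (n + 1), mul_assoc, ih, mul_add, mul_smul_comm, ← mul_assoc, hY,
        ← mul_assoc, hZ, add_mul, mul_assoc, mul_assoc, ← pow_succ' K, ← pow_succ' K]
      push_cast
      module
  have hXn : ∀ n : ℕ, K ^ (n + 2) * X = X * K ^ (n + 2) + ((n : ℝ) + 2) • (Y * K ^ (n + 1)) +
      (((n : ℝ) + 2) * (n + 1) / 2) • (Z * K ^ n) := by
    intro n
    induction n with
    | zero =>
      rw [show (0 + 2) = 1 + 1 from rfl, pow_succ', pow_one, mul_assoc, hX, mul_add, hY,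
        ← mul_assoc, hX, add_mul, mul_assoc]
      simp only [pow_zero, zero_add, mul_one, Nat.cast_zero]
      module
    | succ n ih =>
      rw [pow_succ' K (n + 2), mul_assoc, ih, mul_add, mul_add, mul_smul_comm, mul_smul_comm,
        ← mul_assoc, hX, ← mul_assoc, hY, ← mul_assoc, hZ, add_mul, add_mul, mul_assoc, mul_assoc,
        mul_assoc, ← pow_succ' K, ← pow_succ' K, ← pow_succ' K]
      push_cast
      module
  -- writing the exponential as a sum of `N + 2`, of `N + 1` and of `N` terms makes the terms of the
  -- shifted series match
  obtain ⟨N, hN⟩ := hK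
  have hN1 : K ^ (N + 1) = 0 := by rw [pow_succ, hN, zero_mul]
  have hN2 : K ^ (N + 2) = 0 := by rw [pow_succ, hN1, zero_mul]
  have e0 := nilExp_eq_sum hN
  have e1 := nilExp_eq_sum hN1
  have e2 := nilExp_eq_sum hN2
  rw [Finset.sum_range_succ'] at e1
  have hs : nilExp K * X = (∑ n ∈ Finset.range N, (((n + 2).factorial : ℝ)⁻¹) •
      (K ^ (n + 2) * X)) + K * X + X := by
    rw [e2, Finset.sum_range_succ', Finset.sum_range_succ', add_mul, add_mul, Finset.sum_mul]
    simp
  have hX2 : X * nilExp K = (∑ n ∈ Finset.range N, (((n + 2).factorial : ℝ)⁻¹) •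
      (X * K ^ (n + 2))) + X * K + X := by
    rw [e2, Finset.sum_range_succ', Finset.sum_range_succ', mul_add, mul_add, Finset.mul_sum]
    simp
  have hY2 : Y * nilExp K = (∑ n ∈ Finset.range N, (((n + 1).factorial : ℝ)⁻¹) •
      (Y * K ^ (n + 1))) + Y := by
    rw [e1, mul_add, Finset.mul_sum]
    simp
  have hZ2 : Z * nilExp K = ∑ n ∈ Finset.range N, ((n.factorial : ℝ)⁻¹) • (Z * K ^ n) := by
    rw [e0, Finset.mul_sum]
    simp
  rw [add_mul, add_mul, smul_mul_assoc, hX2, hY2, hZ2, hs, hX]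
  have key : ∀ n : ℕ, (((n + 2).factorial : ℝ)⁻¹) • (K ^ (n + 2) * X) =
      (((n + 2).factorial : ℝ)⁻¹) • (X * K ^ (n + 2)) +
      (((n + 1).factorial : ℝ)⁻¹) • (Y * K ^ (n + 1)) +
      (1 / 2 : ℝ) • ((n.factorial : ℝ)⁻¹) • (Z * K ^ n) := by
    intro n
    have h2 : (((n + 2).factorial : ℝ)⁻¹) * ((n : ℝ) + 2) = ((n + 1).factorial : ℝ)⁻¹ := by
      rw [Nat.factorial_succ (n + 1)]
      have : ((n + 1).factorial : ℝ) ≠ 0 := by positivity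
      push_cast
      field_simp
      ring
    have h3 : (((n + 2).factorial : ℝ)⁻¹) * (((n : ℝ) + 2) * (n + 1) / 2) =
        (1 / 2 : ℝ) * (n.factorial : ℝ)⁻¹ := by
      rw [Nat.factorial_succ (n + 1), Nat.factorial_succ n]
      have : (n.factorial : ℝ) ≠ 0 := by positivity
      push_cast
      field_simp
      ring
    rw [hXn, smul_add, smul_add, smul_smul, smul_smul, h2, h3, smul_smul]
  simp only [key, Finset.sum_add_distrib, ← Finset.smul_sum]
  abel

end NilExp

/-! ### The commutation relations behind the Kalkman transformation -/

section Relations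

variable {ι : Type*} [Fintype ι] [DecidableEq ι] {R : Type*} [Ring R] [Algebra ℝ R]

/-- The relations between the operators on `W(𝔤) ⊗ Ω(M)` that make up the Weil model:
`th a` (multiplication by `θ^a`), `ct a` (contraction of `θ^a`), `io a` (contraction with `X_a`),
`ph a` (multiplication by `φ^a`), `pd a` (the derivation `∂/∂φ^a`), `lie a` (the Lie derivative
along `X_a`) and `d` (the exterior derivative on `M`), with structure constants `f`. -/
structure WeilRelations (f : ι → ι → ι → ℝ) (th ct io ph pd lie : ι → R) (d : R) : Prop where
  th_th (a c : ι) : th a * th c = - (th c * th a)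
  th_sq (a : ι) : th a * th a = 0
  io_io (a c : ι) : io a * io c = - (io c * io a)
  ct_th (a c : ι) : ct a * th c = (if a = c then 1 else 0) - th c * ct a
  io_th (a c : ι) : io a * th c = - (th c * io a)
  io_ct (a c : ι) : io a * ct c = - (ct c * io a)
  d_th (a : ι) : d * th a = - (th a * d)
  io_d (a : ι) : io a * d = lie a - d * io a
  ph_th (a c : ι) : ph a * th c = th c * ph a
  ph_io (a c : ι) : ph a * io c = io c * ph a
  pd_th (a c : ι) : pd a * th c = th c * pd a
  pd_io (a c : ι) : pd a * io c = io c * pd a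
  lie_th (a c : ι) : lie a * th c = th c * lie a
  lie_io (a c : ι) : lie a * io c = io c * lie a + ∑ e, f e a c • io e

namespace WeilRelations

variable {f : ι → ι → ι → ℝ} {th ct io ph pd lie : ι → R} {d : R}

theorem commute_summands (h : WeilRelations f th ct io ph pd lie d) (a c : ι) :
    Commute (th a * io a) (th c * io c) := by
  change _ * _ = _ * _
  have h₁ : th a * io a * (th c * io c) = - (th a * th c * (io a * io c)) := by
    rw [mul_assoc, ← mul_assoc (io a), h.io_th, neg_mul, mul_neg, mul_assoc, ← mul_assoc]
  have h₂ : th c * io c * (th a * io a) = - (th c * th a * (io c * io a)) := by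
    rw [mul_assoc, ← mul_assoc (io c), h.io_th, neg_mul, mul_neg, mul_assoc, ← mul_assoc]
  rw [h₁, h₂, h.th_th, h.io_io a c, neg_mul_neg]

theorem isNilpotent (h : WeilRelations f th ct io ph pd lie d) :
    IsNilpotent (∑ a, th a * io a) := by
  refine Commute.isNilpotent_sum (fun a _ => ⟨2, ?_⟩) fun a c _ _ => h.commute_summands a c
  rw [sq, mul_assoc, ← mul_assoc (io a), h.io_th, neg_mul, mul_neg, ← mul_assoc, ← mul_assoc,
    h.th_sq, zero_mul, zero_mul, neg_zero]

theorem commute_th (h : WeilRelations f th ct io ph pd lie d) (c : ι) :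
    Commute (∑ a, th a * io a) (th c) :=
  Commute.sum_left _ _ _ fun a _ => by
    change _ * _ = _ * _
    rw [mul_assoc, h.io_th, mul_neg, ← mul_assoc, h.th_th, neg_mul, neg_neg, mul_assoc]

theorem commute_io (h : WeilRelations f th ct io ph pd lie d) (c : ι) :
    Commute (∑ a, th a * io a) (io c) :=
  Commute.sum_left _ _ _ fun a _ => by
    change _ * _ = _ * _
    rw [mul_assoc, h.io_io, mul_neg, ← mul_assoc, ← mul_assoc, h.io_th, neg_mul]

theorem commute_ph (h : WeilRelations f th ct io ph pd lie d) (c : ι) :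
    Commute (∑ a, th a * io a) (ph c) :=
  Commute.sum_left _ _ _ fun a _ => by
    change _ * _ = _ * _
    rw [← mul_assoc, h.ph_th, mul_assoc, mul_assoc, h.ph_io]

theorem commute_pd (h : WeilRelations f th ct io ph pd lie d) (c : ι) :
    Commute (∑ a, th a * io a) (pd c) :=
  Commute.sum_left _ _ _ fun a _ => by
    change _ * _ = _ * _
    rw [← mul_assoc, h.pd_th, mul_assoc, mul_assoc, h.pd_io]

theorem mul_ct (h : WeilRelations f th ct io ph pd lie d) (c : ι) :
    (∑ a, th a * io a) * ct c = ct c * (∑ a, th a * io a) - io c := by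
  have h₁ : ∀ a, th a * io a * ct c = ct c * (th a * io a) - (if c = a then io a else 0) := by
    intro a
    rw [mul_assoc, h.io_ct, ← mul_assoc (ct c), h.ct_th, sub_mul, mul_neg, mul_assoc]
    split_ifs <;> simp
  simp [Finset.sum_mul, Finset.mul_sum, h₁, Finset.sum_sub_distrib]

theorem mul_d (h : WeilRelations f th ct io ph pd lie d) :
    (∑ a, th a * io a) * d = d * (∑ a, th a * io a) + ∑ a, th a * lie a := by
  rw [Finset.sum_mul, Finset.mul_sum, ← Finset.sum_add_distrib]
  refine Finset.sum_congr rfl fun a _ => ?_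
  rw [mul_assoc, h.io_d, mul_sub, ← mul_assoc, ← mul_assoc d, h.d_th, neg_mul]
  abel

/-- The differential of the Weil model, written in terms of the elementary operators -/
def diff (f : ι → ι → ι → ℝ) (th ct ph pd : ι → R) (d : R) : R :=
  ∑ a, ph a * ct a - (1 / 2 : ℝ) • ∑ a, ∑ c, ∑ e, f a c e • (th c * th e * ct a) -
    ∑ a, ∑ c, ∑ e, f a c e • (th c * ph e * pd a) + d

/-- The first commutator of `θ^a ι_{X_a}` with the differential. The quadratic term comes from the
structure constants in `d_W θ^a`. -/
theorem mul_diff (h : WeilRelations f th ct io ph pd lie d) :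
    (∑ a, th a * io a) * diff f th ct ph pd d =
    diff f th ct ph pd d * (∑ a, th a * io a) + (∑ a, th a * lie a - ∑ a, ph a * io a +
      (1 / 2 : ℝ) • ∑ a, ∑ c, ∑ e, f a c e • (th c * th e * io a)) := by
  set K := ∑ a, th a * io a with hK
  have h₁ : ∀ a, K * (ph a * ct a) = ph a * ct a * K - ph a * io a := fun a => by
    rw [← mul_assoc, (h.commute_ph a).eq, mul_assoc, h.mul_ct, mul_sub, mul_assoc]
  have h₂ : ∀ a c e, K * (th c * th e * ct a) = th c * th e * ct a * K - th c * th e * io a :=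
    fun a c e => by
      rw [← mul_assoc, ((h.commute_th c).mul_right (h.commute_th e)).eq, mul_assoc, h.mul_ct,
        mul_sub, mul_assoc (th c * th e)]
  have h₃ : ∀ a c e, K * (th c * ph e * pd a) = th c * ph e * pd a * K := fun a c e =>
    (((h.commute_th c).mul_right (h.commute_ph e)).mul_right (h.commute_pd a)).eq
  simp only [diff, mul_add, mul_sub, add_mul, sub_mul, mul_smul_comm, smul_mul_assoc,
    Finset.mul_sum, Finset.sum_mul, h₁, h₂, h₃, smul_sub, Finset.sum_sub_distrib]
  rw [h.mul_d]
  abel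

/-- The commutator of `θ^a ι_{X_a}` with `θ^a L_{X_a}`, the only part of the first commutator
with the differential that contributes to the second one. -/
theorem mul_mul_lie (h : WeilRelations f th ct io ph pd lie d) :
    (∑ a, th a * io a) * (∑ a, th a * lie a) =
    (∑ a, th a * lie a) * (∑ a, th a * io a) -
      ∑ a, ∑ c, ∑ e, f a c e • (th c * th e * io a) := by
  have h₁ : ∀ a c, th c * io c * (th a * lie a) =
      th a * lie a * (th c * io c) - ∑ e, f e a c • (th a * th c * io e) := by
    intro a c
    have h₂ : th a * lie a * (th c * io c) = th a * th c * (lie a * io c) := by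
      rw [mul_assoc, ← mul_assoc (lie a), h.lie_th, mul_assoc, ← mul_assoc, ← mul_assoc]
    have h₃ : th c * io c * (th a * lie a) = th a * th c * (io c * lie a) := by
      rw [mul_assoc, ← mul_assoc (io c), h.io_th, neg_mul, mul_neg, mul_assoc, ← mul_assoc,
        h.th_th c a, neg_mul, neg_neg]
    rw [h₂, h₃, h.lie_io, mul_add, Finset.mul_sum]
    simp
  simp only [Finset.sum_mul, Finset.mul_sum, h₁, Finset.sum_sub_distrib]
  congr 1
  · exact Finset.sum_comm
  · rw [Finset.sum_comm (γ := ι) (s := Finset.univ) (t := Finset.univ)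
      (f := fun a c => ∑ e, f a c e • (th c * th e * io a))]
    exact Finset.sum_congr rfl fun a _ => Finset.sum_comm

end WeilRelations

variable {T : Type*} [AddCommGroup T] [Module ℝ T] {f : ι → ι → ι → ℝ}
  {th ct io ph pd lie : ι → Module.End ℝ T} {d : Module.End ℝ T}

namespace WeilRelations

/-- Conjugation by `exp (θ^a ι_{X_a})` turns the total contraction into the contraction of `θ^a`. -/
theorem nilExp_mul_contr (h : WeilRelations f th ct io ph pd lie d) (c : ι) :
    nilExp (∑ a, th a * io a) * (ct c + io c) = ct c * nilExp (∑ a, th a * io a) := by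
  have h₁ := nilExp_mul_of_commutator (X := ct c + io c) (Y := - io c) (Z := 0) h.isNilpotent
    (by rw [mul_add, add_mul, h.mul_ct, (h.commute_io c).eq]; abel)
    (by rw [mul_neg, (h.commute_io c).eq]; simp) (by simp)
  simpa using h₁

/-- Conjugation by `exp (θ^a ι_{X_a})` adds `θ^a L_{X_a} - φ^a ι_{X_a}` to the differential; the
terms quadratic in `θ` of the first and the second commutator cancel. -/
theorem nilExp_mul_diff (h : WeilRelations f th ct io ph pd lie d) :
    nilExp (∑ a, th a * io a) * diff f th ct ph pd d =
      (diff f th ct ph pd d + (∑ a, th a * lie a - ∑ a, ph a * io a)) *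
        nilExp (∑ a, th a * io a) := by
  have hq : ∀ a c e, Commute (∑ a, th a * io a) (f a c e • (th c * th e * io a)) := fun a c e =>
    (((h.commute_th c).mul_right (h.commute_th e)).mul_right (h.commute_io a)).smul_right _
  have hQ : Commute (∑ a, th a * io a) (∑ a, ∑ c, ∑ e, f a c e • (th c * th e * io a)) :=
    Commute.sum_right _ _ _ fun a _ => Commute.sum_right _ _ _ fun c _ =>
      Commute.sum_right _ _ _ fun e _ => hq a c e
  have hP : Commute (∑ a, th a * io a) (∑ a, ph a * io a) :=
    Commute.sum_right _ _ _ fun a _ => (h.commute_ph a).mul_right (h.commute_io a)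
  rw [nilExp_mul_of_commutator h.isNilpotent h.mul_diff
    (Z := - ∑ a, ∑ c, ∑ e, f a c e • (th c * th e * io a)) _ _]
  · congr 1
    module
  · rw [mul_add, mul_sub, h.mul_mul_lie, hP.eq, mul_smul_comm, hQ.eq, add_mul, sub_mul,
      smul_mul_assoc]
    abel
  · exact hQ.neg_right.eq

end WeilRelations

end Relations

/-! ### The operators of the Weil model -/

section ExteriorAlgebra

variable {V : Type*} [AddCommGroup V] [Module ℝ V] {ι : Type*} [Fintype ι] [DecidableEq ι]
  (b : Basis ι ℝ V)

theorem theta_mul_theta (a c : ι) : theta b a * theta b c = - (theta b c * theta b a) :=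
  eq_neg_of_add_eq_zero_left (ExteriorAlgebra.ι_add_mul_swap (R := ℝ) (b.coord a) (b.coord c))

theorem involute_contrExt (a : ι) (x : Ext V) :
    CliffordAlgebra.involute (contrExt b a x) = - contrExt b a (CliffordAlgebra.involute x) := by
  induction x using CliffordAlgebra.left_induction with
  | algebraMap r => simp [contrExt]
  | add x y hx hy => simp only [map_add, hx, hy, neg_add]
  | ι_mul x m hx =>
    simp only [contrExt] at hx ⊢
    simp only [map_mul, CliffordAlgebra.involute_ι, neg_mul, map_neg,
      CliffordAlgebra.contractLeft_ι_mul, map_sub, map_smul, hx]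
    simp

theorem sum_theta_contrExt_ι_mul (m : Dual ℝ V) (x : Ext V) :
    ∑ a, theta b a * contrExt b a (ExteriorAlgebra.ι ℝ m * x) =
      ExteriorAlgebra.ι ℝ m * x + ExteriorAlgebra.ι ℝ m * ∑ a, theta b a * contrExt b a x := by
  have h₁ : ∀ a, theta b a * contrExt b a (ExteriorAlgebra.ι ℝ m * x) =
      m (b a) • (theta b a * x) + ExteriorAlgebra.ι ℝ m * (theta b a * contrExt b a x) := by
    intro a
    have h₂ : contrExt b a (ExteriorAlgebra.ι ℝ m * x) =
        m (b a) • x - ExteriorAlgebra.ι ℝ m * contrExt b a x :=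
      CliffordAlgebra.contractLeft_ι_mul (Q := (0 : QuadraticForm ℝ (Dual ℝ V)))
        (d := Dual.eval ℝ V (b a)) m x
    have h₃ : theta b a * ExteriorAlgebra.ι ℝ m = - (ExteriorAlgebra.ι ℝ m * theta b a) :=
      eq_neg_of_add_eq_zero_left (ExteriorAlgebra.ι_add_mul_swap (R := ℝ) (b.coord a) m)
    rw [h₂, mul_sub, mul_smul_comm, ← mul_assoc, h₃, neg_mul, sub_neg_eq_add, mul_assoc]
  simp only [h₁, Finset.sum_add_distrib, ← Finset.mul_sum]
  congr 1
  have h₄ : m = ∑ a, m (b a) • b.coord a := by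
    refine b.ext fun c => ?_
    simp
  conv_rhs => rw [h₄]
  simp only [map_sum, map_smul, Finset.sum_mul, smul_mul_assoc, theta]

/-- The number operator `∑ θ^a ι_{e_a}` acts on `Λ^p` as multiplication by `p`. -/
theorem sum_theta_contrExt {p : ℕ} {x : Ext V}
    (hx : x ∈ LinearMap.range (ExteriorAlgebra.ι ℝ (M := Dual ℝ V)) ^ p) :
    ∑ a, theta b a * contrExt b a x = (p : ℝ) • x := by
  induction hx using Submodule.pow_induction_on_left' with
  | algebraMap r => simp [contrExt]
  | add x y i hx hy h₁ h₂ => simp only [map_add, mul_add, Finset.sum_add_distrib, h₁, h₂, smul_add]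
  | mem_mul m hm i x hx ih =>
    obtain ⟨m, rfl⟩ := hm
    rw [sum_theta_contrExt_ι_mul, ih, mul_smul_comm]
    push_cast
    module

/-- The projection to the scalars kills the elements of positive degree. -/
theorem algebraMapInv_of_mem_pow {p : ℕ} {x : Ext V}
    (hx : x ∈ LinearMap.range (ExteriorAlgebra.ι ℝ (M := Dual ℝ V)) ^ p) (hp : 0 < p) :
    ExteriorAlgebra.algebraMapInv x = 0 := by
  induction hx using Submodule.pow_induction_on_left' with
  | algebraMap r => simp at hp
  | add x y i hx hy h₁ h₂ => rw [map_add, h₁ hp, h₂ hp, add_zero]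
  | mem_mul m hm i x hx ih =>
    obtain ⟨m, rfl⟩ := hm
    simp [ExteriorAlgebra.algebraMapInv]

/-- An element of `Λ(V^*)` all of whose contractions vanish is a scalar; moreover this holds in
families, as the identity of `Λ(V^*)` is a projection to the scalars plus a combination of
contractions. -/
theorem exists_left_inverse_contrExt : ∃ Q : Ext V →ₗ[ℝ] Ext V, ∀ x : Ext V,
    x = algebraMap ℝ (Ext V) (ExteriorAlgebra.algebraMapInv x) +
      ∑ a, Q (theta b a * contrExt b a x) := by
  let 𝒜 : ℕ → Submodule ℝ (Ext V) := fun i => ⋀[ℝ]^i (Dual ℝ V)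
  -- division by the degree on each `Λ^p`; for `p = 0` this is zero, as `0⁻¹ = 0`
  let Q : Ext V →ₗ[ℝ] Ext V :=
    (DirectSum.toModule ℝ ℕ (Ext V) fun p => (p : ℝ)⁻¹ • (𝒜 p).subtype) ∘ₗ
    (DirectSum.decomposeLinearEquiv 𝒜).toLinearMap
  have hQ : ∀ p : ℕ, ∀ x ∈ 𝒜 p, Q x = (p : ℝ)⁻¹ • x := by
    intro p x hx
    have h₁ : DirectSum.decomposeLinearEquiv 𝒜 x = DirectSum.lof ℝ ℕ (fun i => 𝒜 i) p ⟨x, hx⟩ :=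
      DirectSum.decompose_of_mem 𝒜 hx
    simp only [Q, LinearMap.comp_apply, LinearEquiv.coe_coe, h₁, DirectSum.toModule_lof]
    rfl
  refine ⟨Q, fun x => ?_⟩
  induction x using DirectSum.Decomposition.inductionOn 𝒜 with
  | zero => simp
  | add x y hx hy =>
    simp only [map_add, mul_add, Finset.sum_add_distrib]
    nth_rewrite 1 [hx, hy]
    abel
  | @homogeneous p x =>
    rw [← map_sum, sum_theta_contrExt b x.2, map_smul, hQ p x x.2]
    rcases Nat.eq_zero_or_pos p with rfl | hp
    · obtain ⟨r, hr⟩ : ∃ r, algebraMap ℝ (Ext V) r = x := by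
        have h₁ : (x : Ext V) ∈ LinearMap.range (ExteriorAlgebra.ι ℝ (M := Dual ℝ V)) ^ 0 := x.2
        rw [pow_zero] at h₁
        exact Submodule.mem_one.1 h₁
      rw [← hr]
      simp [ExteriorAlgebra.algebraMap_leftInverse (R := ℝ) (Dual ℝ V) r]
    · rw [algebraMapInv_of_mem_pow x.2 hp]
      have : (p : ℝ) ≠ 0 := by positivity
      simp [this]

end ExteriorAlgebra

section Operators

variable {F : Type*} [NormedAddCommGroup F] [NormedSpace ℝ F]
  {G : Type*} [TopologicalSpace G] [ChartedSpace F G] [Group G] [LieGroup 𝓘(ℝ, F) ∞ G]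
  (E : Type*) [NormedAddCommGroup E] [NormedSpace ℝ E]
  (M : Type*) [TopologicalSpace M] [ChartedSpace E M] [IsManifold 𝓘(ℝ, E) ∞ M]

/-- The operator `P ⊗ Q ⊗ B` on `Λ(𝔤^*) ⊗ S(𝔤^*) ⊗ Ω(M)`, without signs -/
def tensorOp (P : Module.End ℝ (Ext (GroupLieAlgebra 𝓘(ℝ, F) G)))
    (Q : Module.End ℝ (Sym (GroupLieAlgebra 𝓘(ℝ, F) G))) (B : Module.End ℝ (Forms E M)) :
    Module.End ℝ (WeilForms F G E M) :=
  TensorProduct.map (TensorProduct.map P Q) B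

variable {E M}
variable {P P' : Module.End ℝ (Ext (GroupLieAlgebra 𝓘(ℝ, F) G))}
    {Q Q' : Module.End ℝ (Sym (GroupLieAlgebra 𝓘(ℝ, F) G))} {B B' : Module.End ℝ (Forms E M)}

theorem tensorOp_mul : tensorOp E M P Q B * tensorOp E M P' Q' B' =
    tensorOp E M (P * P') (Q * Q') (B * B') := by
  refine TensorProduct.ext_threefold fun _ _ _ => rfl

theorem tensorOp_neg_left : tensorOp E M (-P) Q B = - tensorOp E M P Q B := by
  refine TensorProduct.ext_threefold fun _ _ _ => ?_
  simp [tensorOp, TensorProduct.neg_tmul]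

theorem tensorOp_neg_right : tensorOp E M P Q (-B) = - tensorOp E M P Q B := by
  refine TensorProduct.ext_threefold fun _ _ _ => ?_
  simp [tensorOp, TensorProduct.tmul_neg]

theorem tensorOp_sub_left : tensorOp E M (P - P') Q B =
    tensorOp E M P Q B - tensorOp E M P' Q B := by
  refine TensorProduct.ext_threefold fun _ _ _ => ?_
  simp [tensorOp, TensorProduct.sub_tmul]

theorem tensorOp_add_right : tensorOp E M P Q (B + B') =
    tensorOp E M P Q B + tensorOp E M P Q B' := by
  refine TensorProduct.ext_threefold fun _ _ _ => ?_
  simp [tensorOp, TensorProduct.tmul_add]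

theorem tensorOp_sub_right : tensorOp E M P Q (B - B') =
    tensorOp E M P Q B - tensorOp E M P Q B' := by
  refine TensorProduct.ext_threefold fun _ _ _ => ?_
  simp [tensorOp, TensorProduct.tmul_sub]

theorem tensorOp_sum_smul_right {κ : Type*} (u : Finset κ) (r : κ → ℝ)
    (B : κ → Module.End ℝ (Forms E M)) :
    tensorOp E M P Q (∑ i ∈ u, r i • B i) = ∑ i ∈ u, r i • tensorOp E M P Q (B i) := by
  refine TensorProduct.ext_threefold fun _ _ _ => ?_
  simp [tensorOp, TensorProduct.tmul_sum]

theorem tensorOp_one : tensorOp E M (F := F) (G := G) 1 1 1 = 1 := by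
  refine TensorProduct.ext_threefold fun _ _ _ => rfl

theorem tensorOp_zero_left : tensorOp E M 0 Q B = 0 := by
  refine TensorProduct.ext_threefold fun _ _ _ => ?_
  simp [tensorOp]

end Operators

section WeilModel

variable {F : Type*} [NormedAddCommGroup F] [NormedSpace ℝ F] [FiniteDimensional ℝ F]
  {G : Type*} [TopologicalSpace G] [ChartedSpace F G] [Group G] [LieGroup 𝓘(ℝ, F) ∞ G]
  (E : Type*) [NormedAddCommGroup E] [NormedSpace ℝ E] [FiniteDimensional ℝ E]
  (M : Type*) [TopologicalSpace M] [ChartedSpace E M] [IsManifold 𝓘(ℝ, E) ∞ M]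
  [MulAction G M] [ContMDiffSMul 𝓘(ℝ, F) 𝓘(ℝ, E) ∞ G M]
  {ι : Type*} [Fintype ι] [DecidableEq ι] (b : Basis ι ℝ (GroupLieAlgebra 𝓘(ℝ, F) G))

/-- Multiplication by `θ^a` on `W(𝔤) ⊗ Ω(M)` -/
def opTheta (a : ι) : Module.End ℝ (WeilForms F G E M) :=
  tensorOp E M (LinearMap.mulLeft ℝ (theta b a)) 1 1

/-- The contraction of `θ^a` on `W(𝔤) ⊗ Ω(M)` -/
def opContr (a : ι) : Module.End ℝ (WeilForms F G E M) := tensorOp E M (contrExt b a) 1 1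

variable (F G) {E M} in
/-- The extension to `W(𝔤) ⊗ Ω(M)` of an odd operator on `Ω(M)` -/
def opOdd (B : Module.End ℝ (Forms E M)) : Module.End ℝ (WeilForms F G E M) :=
  tensorOp E M (CliffordAlgebra.involute (Q := (0 : QuadraticForm ℝ
    (Dual ℝ (GroupLieAlgebra 𝓘(ℝ, F) G))))).toLinearMap 1 B

/-- Multiplication by `φ^a` on `W(𝔤) ⊗ Ω(M)` -/
def opPhi (a : ι) : Module.End ℝ (WeilForms F G E M) :=
  tensorOp E M 1 (LinearMap.mulLeft ℝ (phi b a)) 1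

/-- The derivation `∂/∂φ^a` on `W(𝔤) ⊗ Ω(M)` -/
def opPartial (a : ι) : Module.End ℝ (WeilForms F G E M) := tensorOp E M 1 (partialSym b a) 1

/-- The Lie derivative along `X_a` on `W(𝔤) ⊗ Ω(M)` -/
def opLie (a : ι) : Module.End ℝ (WeilForms F G E M) := tensorOp E M 1 1 (lieD E M (b a))

variable {E M} in
theorem opOdd_mul_opOdd (B B' : Module.End ℝ (Forms E M)) :
    opOdd F G B * opOdd F G B' = tensorOp E M 1 1 (B * B') := by
  rw [opOdd, opOdd, tensorOp_mul]
  congr 1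
  exact LinearMap.ext fun x => CliffordAlgebra.involute_involute x

variable {E M} in
/-- An odd operator on forms anticommutes with an odd operator on `Λ(𝔤^*)`. -/
theorem opOdd_mul_left (B : Module.End ℝ (Forms E M))
    {P : Module.End ℝ (Ext (GroupLieAlgebra 𝓘(ℝ, F) G))}
    (hP : ∀ x, CliffordAlgebra.involute (P x) = - P (CliffordAlgebra.involute x)) :
    opOdd F G B * tensorOp E M P 1 1 = - (tensorOp E M P 1 1 * opOdd F G B) := by
  rw [opOdd, tensorOp_mul, tensorOp_mul, ← tensorOp_neg_left]
  congr 1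
  exact LinearMap.ext hP

variable {E M} in
theorem involute_mulLeft_theta (a : ι) (x : Ext (GroupLieAlgebra 𝓘(ℝ, F) G)) :
    CliffordAlgebra.involute (LinearMap.mulLeft ℝ (theta b a) x) =
      - LinearMap.mulLeft ℝ (theta b a) (CliffordAlgebra.involute x) := by
  have h : CliffordAlgebra.involute (theta b a) = - theta b a := CliffordAlgebra.involute_ι _
  rw [LinearMap.mulLeft_apply, LinearMap.mulLeft_apply, map_mul, h, neg_mul]

/-- The sign is that between the brackets of right-invariant and of left-invariant vector fields. -/
theorem structConst_smul_iota (a c : ι) :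
    ∑ e, structConst b e a c • (iota (fundVF E M (b e)) : Forms E M →ₗ[ℝ] Forms E M) =
      - iota (fundVF E M ⁅b a, b c⁆) := by
  rw [iota_fundVF_eq_sum E M b]
  simp [structConst]

theorem opTheta_mul (a c : ι) : opTheta E M b a * opTheta E M b c =
    - (opTheta E M b c * opTheta E M b a) := by
  rw [opTheta, opTheta, tensorOp_mul, tensorOp_mul, ← tensorOp_neg_left]
  congr 1
  refine LinearMap.ext fun x => ?_
  change theta b a * (theta b c * x) = - (theta b c * (theta b a * x))
  rw [← mul_assoc, theta_mul_theta, neg_mul, mul_assoc]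

theorem opTheta_mul_self (a : ι) : opTheta E M b a * opTheta E M b a = 0 := by
  rw [opTheta, tensorOp_mul, ← tensorOp_zero_left]
  congr 1
  refine LinearMap.ext fun x => ?_
  change theta b a * (theta b a * x) = 0
  rw [← mul_assoc, theta, ExteriorAlgebra.ι_sq_zero, zero_mul]

theorem opContr_mul_opTheta (a c : ι) : opContr E M b a * opTheta E M b c =
    (if a = c then 1 else 0) - opTheta E M b c * opContr E M b a := by
  have h₁ : (if a = c then 1 else 0 : Module.End ℝ (WeilForms F G E M)) =
      tensorOp E M (if a = c then 1 else 0) 1 1 := by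
    split_ifs
    · exact tensorOp_one.symm
    · exact tensorOp_zero_left.symm
  rw [opTheta, opContr, tensorOp_mul, tensorOp_mul, h₁, one_mul, one_mul, ← tensorOp_sub_left]
  congr 1
  refine LinearMap.ext fun x => ?_
  change contrExt b a (theta b c * x) = (if a = c then 1 else 0 : Module.End ℝ _) x -
    theta b c * contrExt b a x
  have h₂ : CliffordAlgebra.involute (theta b c) = - theta b c := CliffordAlgebra.involute_ι _
  rw [contrExt_mul, contrExt_theta, h₂]
  split_ifs <;> simp [sub_eq_add_neg]

theorem opOdd_iota_mul (a c : ι) :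
    opOdd F G (iota (fundVF E M (b a))) * opOdd F G (iota (fundVF E M (b c))) =
      - (opOdd F G (iota (fundVF E M (b c))) * opOdd F G (iota (fundVF E M (b a)))) := by
  rw [opOdd_mul_opOdd, opOdd_mul_opOdd, ← tensorOp_neg_right]
  congr 1
  exact LinearMap.ext fun η => iota_iota _ _ η

theorem opOdd_iota_mul_opOdd_dR (a : ι) :
    opOdd F G (iota (fundVF E M (b a))) * opOdd F G dR =
      opLie E M b a - opOdd F G dR * opOdd F G (iota (fundVF E M (b a))) := by
  rw [opOdd_mul_opOdd, opOdd_mul_opOdd, opLie, ← tensorOp_sub_right]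
  congr 1
  refine LinearMap.ext fun η => ?_
  change iota (fundVF E M (b a)) (dR η) = dR (iota (fundVF E M (b a)) η) +
    iota (fundVF E M (b a)) (dR η) - dR (iota (fundVF E M (b a)) η)
  rw [add_sub_cancel_left]

/-- `[L_{X_a}, ι_{X_c}] = f^e_{ac} ι_{X_e}` -/
theorem opLie_mul_opOdd_iota (a c : ι) :
    opLie E M b a * opOdd F G (iota (fundVF E M (b c))) =
      opOdd F G (iota (fundVF E M (b c))) * opLie E M b a +
        ∑ e, structConst b e a c • opOdd F G (iota (fundVF E M (b e))) := by
  simp only [opLie, opOdd, tensorOp_mul, one_mul, mul_one]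
  rw [← tensorOp_sum_smul_right, ← tensorOp_add_right, structConst_smul_iota]
  congr 1
  refine LinearMap.ext fun η => ?_
  exact (lieD_iota b (b a) (b c) η).trans (sub_eq_add_neg _ _)

variable {E M} in
/-- Operators acting on different factors of `Λ(𝔤^*) ⊗ S(𝔤^*) ⊗ Ω(M)` commute, up to the sign that
is dealt with in `opOdd_mul_left`. -/
theorem tensorOp_commute {P P' : Module.End ℝ (Ext (GroupLieAlgebra 𝓘(ℝ, F) G))}
    {Q Q' : Module.End ℝ (Sym (GroupLieAlgebra 𝓘(ℝ, F) G))} {B B' : Module.End ℝ (Forms E M)}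
    (hP : Commute P P') (hQ : Commute Q Q') (hB : Commute B B') :
    Commute (tensorOp E M P Q B) (tensorOp E M P' Q' B') := by
  change _ * _ = _ * _
  rw [tensorOp_mul, tensorOp_mul, hP.eq, hQ.eq, hB.eq]

/-- The operators of the Weil model satisfy the relations from which the effect of the Kalkman
transformation is computed. -/
theorem weilRelations : WeilRelations (structConst b) (opTheta E M b) (opContr E M b)
    (fun a => opOdd F G (iota (fundVF E M (b a)))) (opPhi E M b) (opPartial E M b) (opLie E M b)
    (opOdd F G dR) where
  th_th := opTheta_mul E M b
  th_sq := opTheta_mul_self E M b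
  io_io := opOdd_iota_mul E M b
  ct_th := opContr_mul_opTheta E M b
  io_th _ c := opOdd_mul_left _ (involute_mulLeft_theta b c)
  io_ct _ c := opOdd_mul_left _ (involute_contrExt b c)
  d_th a := opOdd_mul_left _ (involute_mulLeft_theta b a)
  io_d := opOdd_iota_mul_opOdd_dR E M b
  ph_th _ _ := tensorOp_commute (.one_left _) (.one_right _) (.one_left _)
  ph_io _ _ := tensorOp_commute (.one_left _) (.one_right _) (.one_left _)
  pd_th _ _ := tensorOp_commute (.one_left _) (.one_right _) (.one_left _)
  pd_io _ _ := tensorOp_commute (.one_left _) (.one_right _) (.one_left _)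
  lie_th _ _ := tensorOp_commute (.one_left _) (.one_left _) (.one_right _)
  lie_io := opLie_mul_opOdd_iota E M b

/-- The sign comes from exchanging the multiplication by `θ^a` with the contraction; it makes the
Kalkman transformation the exponential of `θ^a ι_{X_a}` with a positive sign. -/
theorem thetaContr_eq : (thetaContr E M b : Module.End ℝ (WeilForms F G E M)) =
    - ∑ a, opTheta E M b a * opOdd F G (iota (fundVF E M (b a))) := by
  rw [← Finset.sum_neg_distrib]
  refine Finset.sum_congr rfl fun a _ => ?_
  rw [← (weilRelations E M b).io_th]
  refine TensorProduct.ext_threefold fun l s η => ?_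
  simp [opOdd, opTheta, tensorOp, onForms, onWeil, parity]

theorem kalkman_eq : kalkman E M b =
    nilExp (∑ a, opTheta E M b a * opOdd F G (iota (fundVF E M (b a)))) := by
  rw [kalkman, thetaContr_eq, neg_neg]

theorem isNilpotent_thetaContr :
    IsNilpotent (thetaContr E M b : Module.End ℝ (WeilForms F G E M)) := by
  rw [thetaContr_eq]
  exact (weilRelations E M b).isNilpotent.neg

theorem totalContr_eq (a : ι) : (totalContr E M b a : Module.End ℝ (WeilForms F G E M)) =
    opContr E M b a + opOdd F G (iota (fundVF E M (b a))) := rfl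

theorem totalD_eq : (totalD E M b : Module.End ℝ (WeilForms F G E M)) =
    WeilRelations.diff (structConst b) (opTheta E M b) (opContr E M b) (opPhi E M b)
      (opPartial E M b) (opOdd F G dR) := by
  refine TensorProduct.ext_threefold fun l s η => ?_
  simp only [totalD, WeilRelations.diff, onWeil, weilD, onForms, parity, opTheta, opContr, opPhi,
    opPartial, opOdd, LinearMap.add_apply, LinearMap.sub_apply,
    LinearMap.smul_apply, LinearMap.sum_apply, tensorOp, TensorProduct.map_tmul,
    TensorProduct.sub_tmul, TensorProduct.sum_tmul,
    ← TensorProduct.smul_tmul', LinearMap.id_apply, Module.End.mul_apply, LinearMap.comp_apply,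
    Module.End.one_apply, LinearMap.mulLeft_apply, mul_assoc]

theorem kalkman_totalContr (a : ι) (x : WeilForms F G E M) :
    kalkman E M b (totalContr E M b a x) = opContr E M b a (kalkman E M b x) := by
  rw [kalkman_eq, totalContr_eq]
  exact LinearMap.congr_fun ((weilRelations E M b).nilExp_mul_contr a) x

theorem kalkman_totalD (x : WeilForms F G E M) :
    kalkman E M b (totalD E M b x) =
      totalD E M b (kalkman E M b x) + (∑ a, opTheta E M b a (opLie E M b a (kalkman E M b x)) -
        ∑ a, opPhi E M b a (opOdd F G (iota (fundVF E M (b a))) (kalkman E M b x))) := by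
  have h := LinearMap.congr_fun ((weilRelations E M b).nilExp_mul_diff) x
  rw [← kalkman_eq, ← totalD_eq] at h
  simpa using h

end WeilModel

/-! ### The Cartan model inside the Weil model -/

section CartanModel

variable {F : Type*} [NormedAddCommGroup F] [NormedSpace ℝ F] [FiniteDimensional ℝ F]
  {G : Type*} [TopologicalSpace G] [ChartedSpace F G] [Group G] [LieGroup 𝓘(ℝ, F) ∞ G]
  (E : Type*) [NormedAddCommGroup E] [NormedSpace ℝ E] [FiniteDimensional ℝ E]
  (M : Type*) [TopologicalSpace M] [ChartedSpace E M] [IsManifold 𝓘(ℝ, E) ∞ M]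
  [MulAction G M] [ContMDiffSMul 𝓘(ℝ, F) 𝓘(ℝ, E) ∞ G M]
  {ι : Type*} [Fintype ι] [DecidableEq ι] (b : Basis ι ℝ (GroupLieAlgebra 𝓘(ℝ, F) G))

variable (F G) in
/-- The projection of `W(𝔤) ⊗ Ω(M)` onto `S(𝔤^*) ⊗ Ω(M)` that sends all `θ^a` to zero -/
def cartanProj : WeilForms F G E M →ₗ[ℝ] CartanForms F G E M :=
  TensorProduct.map ((TensorProduct.lid ℝ _).toLinearMap ∘ₗ TensorProduct.map
    (ExteriorAlgebra.algebraMapInv (R := ℝ)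
      (M := Dual ℝ (GroupLieAlgebra 𝓘(ℝ, F) G))).toLinearMap LinearMap.id) LinearMap.id

theorem cartanIncl_tmul (s : Sym (GroupLieAlgebra 𝓘(ℝ, F) G)) (η : Forms E M) :
    cartanIncl F G E M (s ⊗ₜ η) = ((1 : Ext (GroupLieAlgebra 𝓘(ℝ, F) G)) ⊗ₜ s) ⊗ₜ η := rfl

theorem cartanProj_tmul (l : Ext (GroupLieAlgebra 𝓘(ℝ, F) G))
    (s : Sym (GroupLieAlgebra 𝓘(ℝ, F) G)) (η : Forms E M) :
    cartanProj F G E M ((l ⊗ₜ s) ⊗ₜ η) = (ExteriorAlgebra.algebraMapInv l • s) ⊗ₜ η := rfl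

theorem cartanProj_cartanIncl (γ : CartanForms F G E M) :
    cartanProj F G E M (cartanIncl F G E M γ) = γ := by
  induction γ using TensorProduct.induction_on with
  | zero => simp
  | add x y hx hy => rw [map_add, map_add, hx, hy]
  | tmul s η => rw [cartanIncl_tmul, cartanProj_tmul, map_one, one_smul]

theorem cartanIncl_injective : Function.Injective (cartanIncl F G E M) :=
  Function.LeftInverse.injective (cartanProj_cartanIncl E M)

theorem opContr_cartanIncl (a : ι) (γ : CartanForms F G E M) :
    opContr E M b a (cartanIncl F G E M γ) = 0 := by
  induction γ using TensorProduct.induction_on with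
  | zero => simp
  | add x y hx hy => rw [map_add, map_add, hx, hy, add_zero]
  | tmul s η =>
    rw [cartanIncl_tmul]
    change ((contrExt b a 1 ⊗ₜ[ℝ] s) ⊗ₜ[ℝ] η : WeilForms F G E M) = 0
    rw [contrExt_one, TensorProduct.zero_tmul, TensorProduct.zero_tmul]

/-- The horizontal elements of `W(𝔤) ⊗ Ω(M)` for the contractions of the `θ^a` form
`S(𝔤^*) ⊗ Ω(M)`. -/
theorem cartanIncl_cartanProj {x : WeilForms F G E M} (hx : ∀ a, opContr E M b a x = 0) :
    cartanIncl F G E M (cartanProj F G E M x) = x := by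
  obtain ⟨Q, hQ⟩ := exists_left_inverse_contrExt b
  have h : ∀ y : WeilForms F G E M, y = cartanIncl F G E M (cartanProj F G E M y) +
      ∑ a, tensorOp E M (Q ∘ₗ LinearMap.mulLeft ℝ (theta b a)) 1 1 (opContr E M b a y) := by
    intro y
    let A : WeilForms F G E M →ₗ[ℝ] WeilForms F G E M := cartanIncl F G E M ∘ₗ cartanProj F G E M +
      ∑ a, tensorOp E M (Q ∘ₗ LinearMap.mulLeft ℝ (theta b a)) 1 1 ∘ₗ opContr E M b a
    have hA : LinearMap.id = A := by
      refine TensorProduct.ext_threefold fun l s η => ?_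
      have h₁ : A ((l ⊗ₜ s) ⊗ₜ η) =
          ((algebraMap ℝ _ (ExteriorAlgebra.algebraMapInv l) +
            ∑ a, Q (theta b a * contrExt b a l)) ⊗ₜ s) ⊗ₜ η := by
        simp only [A, LinearMap.add_apply, LinearMap.comp_apply, LinearMap.sum_apply,
          cartanProj_tmul, cartanIncl_tmul, opContr, tensorOp, TensorProduct.map_tmul,
          TensorProduct.add_tmul, TensorProduct.sum_tmul, Module.End.one_apply,
          LinearMap.mulLeft_apply, Algebra.algebraMap_eq_smul_one,
          ← TensorProduct.smul_tmul', TensorProduct.tmul_smul, map_smul]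
      rw [h₁, ← hQ]
      rfl
    have h₂ := LinearMap.congr_fun hA y
    simpa [A] using h₂
  have h₁ := h x
  simp only [hx, map_zero, Finset.sum_const_zero, add_zero] at h₁
  exact h₁.symm

/-- The infinitesimal action of `e_c` on `S(𝔤^*) ⊗ Ω(M)`: the coadjoint action
`-f^a_{cd} φ^d ∂/∂φ^a` on `S(𝔤^*)` and the Lie derivative along `X_c` on `Ω(M)` -/
def cartanLie (c : ι) : CartanForms F G E M →ₗ[ℝ] CartanForms F G E M :=
  TensorProduct.map LinearMap.id (lieD E M (b c)) -
    ∑ a, ∑ e, structConst b a c e •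
      TensorProduct.map (LinearMap.mulLeft ℝ (phi b e) ∘ₗ partialSym b a) LinearMap.id

theorem opTheta_cartanIncl_tmul (c : ι) (s : Sym (GroupLieAlgebra 𝓘(ℝ, F) G)) (η : Forms E M) :
    opTheta E M b c (cartanIncl F G E M (s ⊗ₜ η)) = (theta b c ⊗ₜ s) ⊗ₜ η := by
  rw [cartanIncl_tmul]
  change (((theta b c * 1) ⊗ₜ[ℝ] s) ⊗ₜ[ℝ] η : WeilForms F G E M) = _
  rw [mul_one]

theorem totalD_cartanIncl_tmul (s : Sym (GroupLieAlgebra 𝓘(ℝ, F) G)) (η : Forms E M) :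
    totalD E M b (cartanIncl F G E M (s ⊗ₜ η)) = cartanIncl F G E M (s ⊗ₜ dR η) -
      ∑ a, ∑ c, ∑ e, structConst b a c e •
        (theta b c ⊗ₜ[ℝ] (phi b e * partialSym b a s)) ⊗ₜ[ℝ] η := by
  simp only [cartanIncl_tmul, totalD, weilD, onWeil, onForms, parity, LinearMap.add_apply,
    LinearMap.sub_apply, LinearMap.smul_apply, LinearMap.sum_apply, TensorProduct.map_tmul,
    contrExt_one, LinearMap.comp_apply, map_zero, TensorProduct.zero_tmul,
    Finset.sum_const_zero, smul_zero, zero_sub, LinearMap.mulLeft_apply, mul_one,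
    AlgHom.toLinearMap_apply, map_one, LinearMap.id_apply, TensorProduct.neg_tmul,
    TensorProduct.sum_tmul, ← TensorProduct.smul_tmul', sub_zero]
  abel

/-- On `S(𝔤^*) ⊗ Ω(M)`, the conjugate of the differential of the Weil model differs from the Cartan
differential by the infinitesimal action. -/
theorem conj_totalD_cartanIncl :
    (totalD E M b : Module.End ℝ (WeilForms F G E M)) ∘ₗ cartanIncl F G E M +
      (∑ c, (opTheta E M b c * opLie E M b c) ∘ₗ cartanIncl F G E M -
        ∑ a, (opPhi E M b a * opOdd F G (iota (fundVF E M (b a)))) ∘ₗ cartanIncl F G E M) =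
    cartanIncl F G E M ∘ₗ cartanD E M b +
      ∑ c, opTheta E M b c ∘ₗ cartanIncl F G E M ∘ₗ cartanLie E M b c := by
  refine TensorProduct.ext' fun s η => ?_
  have h₁ : ∀ c, opLie E M b c (cartanIncl F G E M (s ⊗ₜ η)) =
      cartanIncl F G E M (s ⊗ₜ lieD E M (b c) η) := fun c => rfl
  have h₂ : ∀ a, opPhi E M b a (opOdd F G (iota (fundVF E M (b a)))
      (cartanIncl F G E M (s ⊗ₜ η))) =
      cartanIncl F G E M ((phi b a * s) ⊗ₜ iota (fundVF E M (b a)) η) := fun a => by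
    rw [cartanIncl_tmul, cartanIncl_tmul]
    change (((CliffordAlgebra.involute 1 : Ext _) ⊗ₜ[ℝ] _) ⊗ₜ[ℝ] _ : WeilForms F G E M) = _
    rw [map_one]
    rfl
  have h₃ : ∑ a, ∑ c, ∑ e, structConst b a c e •
      (theta b c ⊗ₜ[ℝ] (phi b e * partialSym b a s)) ⊗ₜ[ℝ] η =
      ∑ c, ∑ a, ∑ e, structConst b a c e • opTheta E M b c (cartanIncl F G E M
        ((phi b e * partialSym b a s) ⊗ₜ η)) := by
    simp only [opTheta_cartanIncl_tmul]
    exact Finset.sum_comm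
  simp only [LinearMap.add_apply, LinearMap.sub_apply, LinearMap.sum_apply, LinearMap.comp_apply,
    Module.End.mul_apply]
  rw [totalD_cartanIncl_tmul, h₃]
  simp only [h₁, h₂, cartanD, cartanLie, LinearMap.sub_apply, LinearMap.sum_apply,
    LinearMap.smul_apply, TensorProduct.map_tmul, LinearMap.comp_apply, LinearMap.mulLeft_apply,
    LinearMap.id_apply, map_sub, map_sum, map_smul, Finset.sum_sub_distrib]
  abel

/-- Conjugation with `κ` takes the differential of the Weil model to the Cartan differential, up to
a term that vanishes on invariant elements. -/
theorem kalkman_totalD_of_eq {x : WeilForms F G E M} {γ : CartanForms F G E M}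
    (hx : kalkman E M b x = cartanIncl F G E M γ) :
    kalkman E M b (totalD E M b x) = cartanIncl F G E M (cartanD E M b γ) +
      ∑ c, opTheta E M b c (cartanIncl F G E M (cartanLie E M b c γ)) := by
  have h := LinearMap.congr_fun (conj_totalD_cartanIncl E M b) γ
  simp only [LinearMap.add_apply, LinearMap.sub_apply, LinearMap.sum_apply, LinearMap.comp_apply,
    Module.End.mul_apply] at h
  rw [kalkman_totalD, hx, h]

theorem isUnit_kalkman : IsUnit (kalkman E M b) :=
  isUnit_nilExp (isNilpotent_thetaContr E M b).neg

theorem kalkman_inverse (x : WeilForms F G E M) :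
    kalkman E M b (Ring.inverse (kalkman E M b) x) = x :=
  LinearMap.congr_fun (Ring.mul_inverse_cancel _ (isUnit_kalkman E M b)) x

theorem inverse_kalkman (x : WeilForms F G E M) :
    Ring.inverse (kalkman E M b) (kalkman E M b x) = x :=
  LinearMap.congr_fun (Ring.inverse_mul_cancel _ (isUnit_kalkman E M b)) x

theorem kalkman_injective : Function.Injective (kalkman E M b) :=
  Function.LeftInverse.injective (inverse_kalkman E M b)

end CartanModel

/-! ### Equivariance under the group -/

section Equivariance

variable {F : Type*} [NormedAddCommGroup F] [NormedSpace ℝ F] [FiniteDimensional ℝ F]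
  {G : Type*} [TopologicalSpace G] [ChartedSpace F G] [Group G] [LieGroup 𝓘(ℝ, F) ∞ G]
  (E : Type*) [NormedAddCommGroup E] [NormedSpace ℝ E] [FiniteDimensional ℝ E]
  (M : Type*) [TopologicalSpace M] [ChartedSpace E M] [IsManifold 𝓘(ℝ, E) ∞ M]
  [MulAction G M] [ContMDiffSMul 𝓘(ℝ, F) 𝓘(ℝ, E) ∞ G M]
  {ι : Type*} [Fintype ι] [DecidableEq ι] (b : Basis ι ℝ (GroupLieAlgebra 𝓘(ℝ, F) G))

theorem Ad_inv_Ad (g : G) (ξ : GroupLieAlgebra 𝓘(ℝ, F) G) : Ad g⁻¹ (Ad g ξ) = ξ := by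
  have h := Ad_mul (F := F) g⁻¹ g
  rw [inv_mul_cancel, Ad_one] at h
  exact (LinearMap.congr_fun h ξ).symm

theorem Ad_Ad_inv (g : G) (ξ : GroupLieAlgebra 𝓘(ℝ, F) G) : Ad g (Ad g⁻¹ ξ) = ξ := by
  have h := Ad_mul (F := F) g g⁻¹
  rw [mul_inv_cancel, Ad_one] at h
  exact (LinearMap.congr_fun h ξ).symm

/-- The matrices of the adjoint and the coadjoint action are inverse transposes of each other. -/
theorem sum_Ad_smul_coadj (g : G) (c : ι) :
    ∑ a, b.coord c (Ad g (b a)) • coadj F g (b.coord a) = b.coord c := by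
  refine LinearMap.ext fun ξ => ?_
  have h₁ : Ad g⁻¹ ξ = ∑ a, b.coord a (Ad g⁻¹ ξ) • b a := (b.sum_repr _).symm
  have h₂ : b.coord c ξ = b.coord c (Ad g (Ad g⁻¹ ξ)) := by rw [Ad_Ad_inv]
  rw [h₂, h₁]
  simp only [LinearMap.sum_apply, LinearMap.smul_apply, map_sum, map_smul, smul_eq_mul, coadj,
    LinearMap.dualMap_apply]
  exact Finset.sum_congr rfl fun a _ => mul_comm _ _

theorem actForms_iota (g : G) (ξ : GroupLieAlgebra 𝓘(ℝ, F) G) (η : Forms E M) :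
    actForms F E M g (iota (fundVF E M ξ) η) =
      iota (fundVF E M (Ad g ξ)) (actForms F E M g η) := by
  have h := pull_iota (E := E) (M := M) g⁻¹ (Ad g ξ) η
  rw [Ad_inv_Ad] at h
  exact h

theorem actForms_dR (g : G) (η : Forms E M) :
    actForms F E M g (dR η) = dR (actForms F E M g η) := pull_dR _ η

/-- The element `∑_a b^a ⊗ e_a` of `𝔤^* ⊗ 𝔤` is invariant; here the second factor is contracted
into a form. -/
theorem sum_coadj_iota {X : Type*} [AddCommGroup X] [Module ℝ X]
    (Φ : Dual ℝ (GroupLieAlgebra 𝓘(ℝ, F) G) →ₗ[ℝ] Forms E M →ₗ[ℝ] X) (g : G) (η : Forms E M) :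
    ∑ a, Φ (coadj F g (b.coord a)) (iota (fundVF E M (Ad g (b a))) η) =
      ∑ a, Φ (b.coord a) (iota (fundVF E M (b a)) η) := by
  have h₁ : ∀ a, Φ (coadj F g (b.coord a)) (iota (fundVF E M (Ad g (b a))) η) =
      ∑ c, Φ (b.coord c (Ad g (b a)) • coadj F g (b.coord a))
        (iota (fundVF E M (b c)) η) := fun a => by
    rw [iota_fundVF_eq_sum E M b (Ad g (b a))]
    simp only [LinearMap.sum_apply, LinearMap.smul_apply, map_sum, map_smul]
  simp only [h₁]
  rw [Finset.sum_comm]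
  refine Finset.sum_congr rfl fun c _ => ?_
  rw [← LinearMap.sum_apply, ← map_sum, sum_Ad_smul_coadj]

theorem actExt_ι_mul (g : G) (m : Dual ℝ (GroupLieAlgebra 𝓘(ℝ, F) G))
    (x : Ext (GroupLieAlgebra 𝓘(ℝ, F) G)) :
    actExt F g (ExteriorAlgebra.ι ℝ m * x) =
      ExteriorAlgebra.ι ℝ (coadj F g m) * actExt F g x := by
  simp only [actExt, AlgHom.toLinearMap_apply, map_mul, ExteriorAlgebra.map_apply_ι]

theorem actExt_one (g : G) : actExt F g (1 : Ext (GroupLieAlgebra 𝓘(ℝ, F) G)) = 1 := by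
  simp only [actExt, AlgHom.toLinearMap_apply, map_one]

theorem actExt_involute (g : G) (x : Ext (GroupLieAlgebra 𝓘(ℝ, F) G)) :
    actExt F g (CliffordAlgebra.involute x) = CliffordAlgebra.involute (actExt F g x) := by
  induction x using CliffordAlgebra.left_induction with
  | algebraMap r => simp [actExt]
  | add x y hx hy => simp only [map_add, hx, hy]
  | ι_mul x m hx =>
    have h := actExt_ι_mul g m x
    have h' := actExt_ι_mul g m (CliffordAlgebra.involute x)
    simp only [ExteriorAlgebra.ι] at h h'
    rw [h, map_mul CliffordAlgebra.involute, map_mul CliffordAlgebra.involute,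
      CliffordAlgebra.involute_ι, CliffordAlgebra.involute_ι, neg_mul, neg_mul, map_neg, h', hx]

theorem actSym_ι_mul (g : G) (m : Dual ℝ (GroupLieAlgebra 𝓘(ℝ, F) G))
    (x : Sym (GroupLieAlgebra 𝓘(ℝ, F) G)) :
    actSym F g (SymmetricAlgebra.ι ℝ _ m * x) =
      SymmetricAlgebra.ι ℝ _ (coadj F g m) * actSym F g x := by
  simp only [actSym, AlgHom.toLinearMap_apply, map_mul, SymmetricAlgebra.lift_ι_apply,
    LinearMap.comp_apply]

theorem actWeil_tmul (g : G) (l : Ext (GroupLieAlgebra 𝓘(ℝ, F) G))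
    (s : Sym (GroupLieAlgebra 𝓘(ℝ, F) G)) (η : Forms E M) :
    actWeil F E M g ((l ⊗ₜ s) ⊗ₜ η) = (actExt F g l ⊗ₜ actSym F g s) ⊗ₜ actForms F E M g η := rfl

theorem actCartan_tmul (g : G) (s : Sym (GroupLieAlgebra 𝓘(ℝ, F) G)) (η : Forms E M) :
    actCartan F E M g (s ⊗ₜ η) = actSym F g s ⊗ₜ actForms F E M g η := rfl

theorem actWeil_cartanIncl (g : G) (γ : CartanForms F G E M) :
    actWeil F E M g (cartanIncl F G E M γ) = cartanIncl F G E M (actCartan F E M g γ) := by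
  induction γ using TensorProduct.induction_on with
  | zero => simp
  | add x y hx hy => simp only [map_add, hx, hy]
  | tmul s η => rw [cartanIncl_tmul, actWeil_tmul, actCartan_tmul, cartanIncl_tmul, actExt_one]

/-- `θ^a ι_{X_a}` is the contraction with the invariant element `∑_a b^a ⊗ e_a`. -/
theorem commute_actWeil (g : G) :
    Commute (∑ a, opTheta E M b a * opOdd F G (iota (fundVF E M (b a))))
      (actWeil F E M g : Module.End ℝ (WeilForms F G E M)) := by
  refine TensorProduct.ext_threefold fun l s η => ?_
  let Φ : Dual ℝ (GroupLieAlgebra 𝓘(ℝ, F) G) →ₗ[ℝ] Forms E M →ₗ[ℝ] WeilForms F G E M :=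
    TensorProduct.mk ℝ _ _ ∘ₗ (TensorProduct.mk ℝ (Ext (GroupLieAlgebra 𝓘(ℝ, F) G))
      (Sym (GroupLieAlgebra 𝓘(ℝ, F) G))).flip (actSym F g s) ∘ₗ
      LinearMap.mulRight ℝ (CliffordAlgebra.involute (actExt F g l)) ∘ₗ ExteriorAlgebra.ι ℝ
  have h := sum_coadj_iota E M b Φ g (actForms F E M g η)
  have h₁ : ∀ (l : Ext (GroupLieAlgebra 𝓘(ℝ, F) G)) (s : Sym (GroupLieAlgebra 𝓘(ℝ, F) G))
      (η : Forms E M) (a : ι), (opTheta E M b a * opOdd F G (iota (fundVF E M (b a))))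
        ((l ⊗ₜ s) ⊗ₜ η) = ((theta b a * CliffordAlgebra.involute l) ⊗ₜ s) ⊗ₜ
          iota (fundVF E M (b a)) η := fun _ _ _ _ => rfl
  rw [Module.End.mul_apply, Module.End.mul_apply, actWeil_tmul, LinearMap.sum_apply,
    LinearMap.sum_apply, map_sum]
  simp only [h₁, actWeil_tmul, actForms_iota, theta, actExt_ι_mul, actExt_involute]
  exact h.symm

theorem kalkman_actWeil (g : G) (x : WeilForms F G E M) :
    kalkman E M b (actWeil F E M g x) = actWeil F E M g (kalkman E M b x) := by
  rw [kalkman_eq]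
  exact LinearMap.congr_fun (commute_nilExp (commute_actWeil E M b g)) x

/-- `φ^a ι_{X_a}` is the contraction with the invariant element `∑_a b^a ⊗ e_a`. -/
theorem actCartan_cartanD (g : G) (γ : CartanForms F G E M) :
    actCartan F E M g (cartanD E M b γ) = cartanD E M b (actCartan F E M g γ) := by
  induction γ using TensorProduct.induction_on with
  | zero => simp
  | add x y hx hy => simp only [map_add, hx, hy]
  | tmul s η =>
    let Φ : Dual ℝ (GroupLieAlgebra 𝓘(ℝ, F) G) →ₗ[ℝ] Forms E M →ₗ[ℝ] CartanForms F G E M :=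
      TensorProduct.mk ℝ _ _ ∘ₗ LinearMap.mulRight ℝ (actSym F g s) ∘ₗ SymmetricAlgebra.ι ℝ _
    have h := sum_coadj_iota E M b Φ g (actForms F E M g η)
    simp only [cartanD, LinearMap.sub_apply, LinearMap.sum_apply, TensorProduct.map_tmul,
      map_sub, map_sum, actCartan_tmul, LinearMap.id_apply, LinearMap.mulLeft_apply, phi,
      actSym_ι_mul, actForms_dR, actForms_iota]
    congr 1

theorem mem_cartan_iff {γ : CartanForms F G E M} :
    γ ∈ cartan F G E M ↔ ∀ g : G, actCartan F E M g γ = γ := by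
  simp [cartan, Submodule.mem_iInf]

theorem cartanD_mem_cartan {γ : CartanForms F G E M} (hγ : γ ∈ cartan F G E M) :
    cartanD E M b γ ∈ cartan F G E M := by
  rw [mem_cartan_iff] at hγ ⊢
  intro g
  rw [actCartan_cartanD, hγ]

/-! ### Elements of `S(𝔤^*) ⊗ Ω(M)` as polynomial maps -/

theorem evalAt_tmul (ξ : GroupLieAlgebra 𝓘(ℝ, F) G) (s : Sym (GroupLieAlgebra 𝓘(ℝ, F) G))
    (η : Forms E M) :
    evalAt ξ (s ⊗ₜ η) = SymmetricAlgebra.lift (Dual.eval ℝ _ ξ) s • η := rfl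

/-- A polynomial that vanishes everywhere is zero. -/
theorem sym_eq_zero_of_eval {V : Type*} [AddCommGroup V] [Module ℝ V] (b : Basis ι ℝ V) {s : Sym V}
    (hs : ∀ ξ, SymmetricAlgebra.lift (Dual.eval ℝ V ξ) s = 0) : s = 0 := by
  let e := SymmetricAlgebra.equivMvPolynomial b.dualBasis
  have h₁ : ∀ (v : ι → ℝ), (MvPolynomial.aeval v).comp e.toAlgHom =
      SymmetricAlgebra.lift (Dual.eval ℝ V (∑ a, v a • b a)) := by
    intro v
    refine SymmetricAlgebra.algHom_ext (b.dualBasis.ext fun a => ?_)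
    have h₂ : e (SymmetricAlgebra.ι ℝ _ (b.dualBasis a)) = MvPolynomial.X a :=
      SymmetricAlgebra.equivMvPolynomial_ι_apply b.dualBasis a
    have h₃ : b.dualBasis a (∑ c, v c • b c) = v a := by
      simp [Finsupp.single_apply]
    change MvPolynomial.aeval v (e (SymmetricAlgebra.ι ℝ _ (b.dualBasis a))) =
      SymmetricAlgebra.lift (Dual.eval ℝ V (∑ c, v c • b c))
        (SymmetricAlgebra.ι ℝ _ (b.dualBasis a))
    rw [h₂, SymmetricAlgebra.lift_ι_apply, Dual.eval_apply, h₃, MvPolynomial.aeval_X]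
  have h₃ : e s = 0 := MvPolynomial.funext fun v => by
    have := hs (∑ a, v a • b a)
    rw [← h₁] at this
    simpa [MvPolynomial.aeval_def] using this
  simpa using h₃

open Classical in
/-- An element of `S(𝔤^*) ⊗ Ω(M)` is determined by its values, as follows from the case of
polynomials by expanding in a basis of the vector space of forms. -/
theorem cartanForms_ext {κ : Type*} [Fintype κ] (b : Basis κ ℝ (GroupLieAlgebra 𝓘(ℝ, F) G))
    {γ γ' : CartanForms F G E M}
    (h : ∀ ξ, evalAt ξ γ = evalAt ξ γ') : γ = γ' := by
  rw [← sub_eq_zero]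
  have h' : ∀ ξ, evalAt ξ (γ - γ') = 0 := fun ξ => by rw [map_sub, h, sub_self]
  generalize γ - γ' = δ at h'
  let B := Basis.ofVectorSpace ℝ (Forms E M)
  let e := TensorProduct.equivFinsuppOfBasisRight (M := Sym (GroupLieAlgebra 𝓘(ℝ, F) G)) B
  have h₁ : ∀ (δ : CartanForms F G E M) ξ i,
      SymmetricAlgebra.lift (Dual.eval ℝ _ ξ) (e δ i) = B.repr (evalAt ξ δ) i := by
    intro δ ξ i
    induction δ using TensorProduct.induction_on with
    | zero => simp
    | add x y hx hy => simp only [map_add, Finsupp.add_apply, hx, hy]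
    | tmul s η => simp [e, evalAt_tmul, mul_comm]
  have h₂ : e δ = 0 := by
    ext i
    refine sym_eq_zero_of_eval b fun ξ => ?_
    rw [h₁, h', map_zero, Finsupp.zero_apply]
  simpa using h₂

/-- The action on polynomial maps `𝔤 → Ω(M)`: `(g⁻¹ · γ)(ξ) = g^* (γ(Ad_g ξ))`. -/
theorem evalAt_actCartan_inv (g : G) (ξ : GroupLieAlgebra 𝓘(ℝ, F) G) (γ : CartanForms F G E M) :
    evalAt ξ (actCartan F E M g⁻¹ γ) =
      pull (fun z : M => g • z) (contMDiff_smul_left F g) (evalAt (Ad g ξ) γ) := by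
  induction γ using TensorProduct.induction_on with
  | zero => simp
  | add x y hx hy => simp only [map_add, hx, hy]
  | tmul s η =>
    rw [actCartan_tmul, evalAt_tmul, evalAt_tmul, map_smul]
    have h₁ : ((SymmetricAlgebra.lift (Dual.eval ℝ _ ξ)).comp (SymmetricAlgebra.lift
        (SymmetricAlgebra.ι ℝ _ ∘ₗ coadj F g⁻¹))) = SymmetricAlgebra.lift
        (Dual.eval ℝ (GroupLieAlgebra 𝓘(ℝ, F) G) (Ad g ξ)) := by
      refine SymmetricAlgebra.algHom_ext (LinearMap.ext fun m => ?_)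
      simp [coadj]
    have h₂ : ∀ k : G, k = g → ∀ hk : ContMDiff 𝓘(ℝ, E) 𝓘(ℝ, E) ∞ (fun z : M => k • z),
        pull (fun z : M => k • z) hk η =
        pull (fun z : M => g • z) (contMDiff_smul_left F g) η := by rintro k rfl _; rfl
    have h₃ := AlgHom.congr_fun h₁ s
    exact congrArg₂ (· • ·) h₃ (h₂ _ (inv_inv g) _)

end Equivariance

/-! ### Invariance under the group and under the Lie algebra -/

section LocallyConstant

variable {F : Type*} [NormedAddCommGroup F] [NormedSpace ℝ F]
  {G : Type*} [TopologicalSpace G] [ChartedSpace F G] [IsManifold 𝓘(ℝ, F) 1 G]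

/-- A function on a connected manifold with vanishing derivative is constant. -/
theorem eq_of_hasMFDerivAt_zero [ConnectedSpace G] {h : G → ℝ}
    (hh : ∀ g, HasMFDerivAt 𝓘(ℝ, F) 𝓘(ℝ, ℝ) h g (0 : F →L[ℝ] ℝ)) (g g' : G) : h g = h g' := by
  refine IsLocallyConstant.apply_eq_of_preconnectedSpace
    ((IsLocallyConstant.iff_eventually_eq h).2 fun k => ?_) g g'
  set c := chartAt F k
  have hk : k ∈ c.source := mem_chart_source F k
  have hd : ∀ y ∈ c.target, HasFDerivAt (h ∘ c.symm) (0 : F →L[ℝ] ℝ) y := by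
    intro y hy
    have h₁ : MDifferentiableAt 𝓘(ℝ, F) 𝓘(ℝ, F) c.symm y :=
      mdifferentiableAt_atlas_symm (chart_mem_atlas F k) hy
    have h₂ := HasMFDerivAt.comp y (hh (c.symm y)) h₁.hasMFDerivAt
    have h₃ : ∀ A : F →L[ℝ] F, (0 : F →L[ℝ] ℝ).comp A = 0 :=
      fun A => ContinuousLinearMap.zero_comp A
    exact (h₂.congr_mfderiv (h₃ _)).hasFDerivAt
  obtain ⟨r, hr, hr'⟩ := Metric.isOpen_iff.1 c.open_target (c k) (c.map_source hk)
  have h₁ : ∀ y ∈ Metric.ball (c k) r, h (c.symm y) = h k := by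
    intro y hy
    have h₂ := (convex_ball (c k) r).is_const_of_fderivWithin_eq_zero (𝕜 := ℝ) (f := h ∘ c.symm)
      (fun z hz => (hd z (hr' hz)).differentiableAt.differentiableWithinAt)
      (fun z hz => ((hd z (hr' hz)).hasFDerivWithinAt).fderivWithin
        (Metric.isOpen_ball.uniqueDiffWithinAt hz)) hy (Metric.mem_ball_self hr)
    have h₃ : h (c.symm (c k)) = h k := by rw [c.left_inv hk]
    exact h₂.trans h₃
  have h₄ : ∀ᶠ l in nhds k, c l ∈ Metric.ball (c k) r :=
    (c.continuousAt hk).eventually (Metric.ball_mem_nhds _ hr)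
  filter_upwards [h₄, c.open_source.mem_nhds hk] with l hl hl'
  rw [← h₁ _ hl, c.left_inv hl']

end LocallyConstant

section Infinitesimal

variable {F : Type*} [NormedAddCommGroup F] [NormedSpace ℝ F] [FiniteDimensional ℝ F]
  {G : Type*} [TopologicalSpace G] [ChartedSpace F G] [Group G] [LieGroup 𝓘(ℝ, F) ∞ G]
  (E : Type*) [NormedAddCommGroup E] [NormedSpace ℝ E] [FiniteDimensional ℝ E]
  (M : Type*) [TopologicalSpace M] [ChartedSpace E M] [IsManifold 𝓘(ℝ, E) ∞ M]
  [MulAction G M] [ContMDiffSMul 𝓘(ℝ, F) 𝓘(ℝ, E) ∞ G M]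
  {ι : Type*} [Fintype ι] [DecidableEq ι] (b : Basis ι ℝ (GroupLieAlgebra 𝓘(ℝ, F) G))

theorem partialSym_ι {V : Type*} [AddCommGroup V] [Module ℝ V] (b : Basis ι ℝ V) (a : ι)
    (m : Dual ℝ V) :
    partialSym b a (SymmetricAlgebra.ι ℝ _ m) = algebraMap ℝ (Sym V) (m (b a)) := by
  have h₁ : m = ∑ c, m (b c) • b.coord c := b.ext fun c => by simp
  conv_lhs => rw [h₁]
  have h₂ : ∀ c, partialSym b a (SymmetricAlgebra.ι ℝ _ (b.coord c)) = if a = c then 1 else 0 :=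
    partialSym_phi b a
  simp only [map_sum, map_smul, h₂, smul_ite, smul_zero, Finset.sum_ite_eq, Finset.mem_univ,
    if_true, Algebra.algebraMap_eq_smul_one]

/-- Linearity of the bracket, with the smoothness of `G` that the Lie algebra structure asks for. -/
theorem lie_sum_smul {κ : Type*} (u : Finset κ) (v : GroupLieAlgebra 𝓘(ℝ, F) G) (r : κ → ℝ)
    (w : κ → GroupLieAlgebra 𝓘(ℝ, F) G) :
    ⁅v, ∑ i ∈ u, r i • w i⁆ = ∑ i ∈ u, r i • ⁅v, w i⁆ := by
  have : CompleteSpace F := FiniteDimensional.complete ℝ F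
  have : LieGroup 𝓘(ℝ, F) (minSmoothness ℝ 3) G :=
    LieGroup.of_le (n := ∞) (by
      rw [minSmoothness_of_isRCLikeNormedField]
      exact ENat.LEInfty.out)
  refine (lie_sum (L := GroupLieAlgebra 𝓘(ℝ, F) G) (M := GroupLieAlgebra 𝓘(ℝ, F) G)
    u (fun i => r i • w i) v).trans (Finset.sum_congr rfl fun i _ => ?_)
  exact lie_smul (R := ℝ) (L := GroupLieAlgebra 𝓘(ℝ, F) G) (r i) v (w i)

theorem structConst_swap (a c e : ι) : structConst b a c e = - structConst b a e c := by
  have h : ⁅b c, b e⁆ = -⁅b e, b c⁆ := VectorField.mlieBracket_swap_apply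
  rw [structConst, structConst, h, neg_neg, map_neg, neg_neg]

/-- The infinitesimal coadjoint action `-f^a_{cd} φ^d ∂/∂φ^a` of `e_c` on `S(𝔤^*)` -/
def symLie (c : ι) : Sym (GroupLieAlgebra 𝓘(ℝ, F) G) →ₗ[ℝ] Sym (GroupLieAlgebra 𝓘(ℝ, F) G) :=
  - ∑ a, ∑ e, structConst b a c e • (LinearMap.mulLeft ℝ (phi b e) ∘ₗ partialSym b a)

theorem symLie_mul (c : ι) (s t : Sym (GroupLieAlgebra 𝓘(ℝ, F) G)) :
    symLie b c (s * t) = symLie b c s * t + s * symLie b c t := by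
  simp only [symLie, LinearMap.neg_apply, LinearMap.sum_apply, LinearMap.smul_apply,
    LinearMap.comp_apply, LinearMap.mulLeft_apply, partialSym_mul, neg_mul, mul_neg,
    Finset.sum_mul, Finset.mul_sum, smul_mul_assoc, mul_smul_comm, mul_add, smul_add,
    Finset.sum_add_distrib, neg_add]
  congr 1
  · simp only [mul_assoc]
  · simp only [mul_left_comm s]

theorem symLie_algebraMap (c : ι) (r : ℝ) : symLie b c (algebraMap ℝ _ r) = 0 := by
  simp [symLie, Algebra.algebraMap_eq_smul_one, partialSym_one]

/-- On linear functions, the infinitesimal coadjoint action is the transpose of `⁅e_c, _⁆`, the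
bracket being that of left-invariant vector fields. -/
theorem eval_symLie_ι (c : ι) (m : Dual ℝ (GroupLieAlgebra 𝓘(ℝ, F) G))
    (ξ : GroupLieAlgebra 𝓘(ℝ, F) G) :
    SymmetricAlgebra.lift (Dual.eval ℝ _ ξ) (symLie b c (SymmetricAlgebra.ι ℝ _ m)) =
      m ⁅b c, ξ⁆ := by
  have h₁ : ⁅b c, ξ⁆ = ∑ e, ∑ a, (b.coord e ξ * b.coord a ⁅b c, b e⁆) • b a := by
    conv_lhs => rw [← b.sum_repr ξ, lie_sum_smul]
    refine Finset.sum_congr rfl fun e _ => ?_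
    conv_lhs => rw [← b.sum_repr ⁅b c, b e⁆]
    rw [Finset.smul_sum]
    exact Finset.sum_congr rfl fun a _ => smul_smul _ _ _
  rw [h₁]
  simp only [symLie, LinearMap.neg_apply, LinearMap.sum_apply, LinearMap.smul_apply,
    LinearMap.comp_apply, LinearMap.mulLeft_apply, partialSym_ι, map_neg, map_sum, map_smul,
    map_mul, phi, SymmetricAlgebra.lift_ι_apply, AlgHom.commutes, Dual.eval_apply, structConst,
    smul_eq_mul, Algebra.algebraMap_self, RingHom.id_apply]
  rw [Finset.sum_comm, ← Finset.sum_neg_distrib]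
  refine Finset.sum_congr rfl fun e _ => ?_
  rw [← Finset.sum_neg_distrib]
  exact Finset.sum_congr rfl fun a _ => by ring

/-- The derivative at `1` of the translates of a polynomial on the Lie algebra -/
theorem hasDerivAtOne_eval_Ad (s : Sym (GroupLieAlgebra 𝓘(ℝ, F) G))
    (ξ : GroupLieAlgebra 𝓘(ℝ, F) G) :
    ∃ A : F →L[ℝ] ℝ,
      HasDerivAtOne (fun g : G => SymmetricAlgebra.lift (Dual.eval ℝ _ (Ad g ξ)) s) A ∧
      ∀ c, A (b c) = SymmetricAlgebra.lift (Dual.eval ℝ _ ξ) (symLie b c s) := by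
  induction s using SymmetricAlgebra.induction with
  | algebraMap r =>
    refine ⟨0, ?_, fun c => ?_⟩
    · simp only [AlgHom.commutes]
      exact hasDerivAtOne_const _
    · rw [symLie_algebraMap, map_zero]
      rfl
  | ι m =>
    obtain ⟨A, hA, hA'⟩ := hasDerivAtOne_dual_Ad m ξ
    refine ⟨A, ?_, fun c => ?_⟩
    · simp only [SymmetricAlgebra.lift_ι_apply, Dual.eval_apply]
      exact hA
    · rw [eval_symLie_ι, hA']
  | mul s t hs ht =>
    obtain ⟨A, hA, hA'⟩ := hs
    obtain ⟨B, hB, hB'⟩ := ht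
    have hAB := hA.mul hB
    simp only [Ad_one, LinearMap.id_apply, ← map_mul] at hAB
    refine ⟨_, hAB, fun c => ?_⟩
    rw [symLie_mul, map_add, map_mul, map_mul, ← hA' c, ← hB' c, add_comm, mul_comm (A (b c))]
    rfl
  | add s t hs ht =>
    obtain ⟨A, hA, hA'⟩ := hs
    obtain ⟨B, hB, hB'⟩ := ht
    refine ⟨A + B, ?_, fun c => ?_⟩
    · simp only [map_add]
      exact hA.add hB
    · rw [map_add, map_add, ← hA', ← hB']
      rfl

theorem cartanLie_tmul (c : ι) (s : Sym (GroupLieAlgebra 𝓘(ℝ, F) G)) (η : Forms E M) :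
    cartanLie E M b c (s ⊗ₜ η) = s ⊗ₜ lieD E M (b c) η + symLie b c s ⊗ₜ η := by
  simp only [cartanLie, symLie, LinearMap.sub_apply, LinearMap.neg_apply, LinearMap.sum_apply,
    LinearMap.smul_apply, TensorProduct.map_tmul, LinearMap.id_apply, TensorProduct.neg_tmul,
    TensorProduct.sum_tmul, ← TensorProduct.smul_tmul']
  exact sub_eq_add_neg _ _

theorem pull_eq_self {f : M → M} (hf : ContMDiff 𝓘(ℝ, E) 𝓘(ℝ, E) ∞ f) (h : ∀ z, f z = z)
    (η : Forms E M) : pull f hf η = η := by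
  obtain rfl : f = fun z => z := funext h
  exact pull_id η

/-- The derivative at `1` of the translates of an element of `S(𝔤^*) ⊗ Ω(M)` is the infinitesimal
action. -/
theorem hasDerivAtOne_evForm_evalAt (γ : CartanForms F G E M) (ξ : GroupLieAlgebra 𝓘(ℝ, F) G)
    {k : ℕ} (x : M) (v : Fin k → TangentSpace 𝓘(ℝ, E) x) :
    ∃ A : F →L[ℝ] ℝ,
      HasDerivAtOne (fun g : G => evForm x v (evalAt ξ (actCartan F E M g⁻¹ γ))) A ∧
      ∀ c, A (b c) = evForm x v (evalAt ξ (cartanLie E M b c γ)) := by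
  simp only [evalAt_actCartan_inv]
  induction γ using TensorProduct.induction_on with
  | zero =>
    simp only [map_zero]
    exact ⟨0, hasDerivAtOne_const _, fun c => rfl⟩
  | add y z hy hz =>
    obtain ⟨A, hA, hA'⟩ := hy
    obtain ⟨B, hB, hB'⟩ := hz
    refine ⟨A + B, ?_, fun c => ?_⟩
    · simp only [map_add]
      exact hA.add hB
    · rw [map_add, map_add, map_add, ← hA', ← hB']
      rfl
  | tmul s η =>
    obtain ⟨A, hA, hA'⟩ := hasDerivAtOne_eval_Ad b s ξ
    obtain ⟨B, hB, hB'⟩ := hasDerivAtOne_evForm_pull (F := F) (G := G) η x v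
    have hAB := hA.mul hB
    simp only [Ad_one, LinearMap.id_apply] at hAB
    rw [pull_eq_self E M _ (one_smul G)] at hAB
    simp only [evalAt_tmul, map_smul, smul_eq_mul]
    refine ⟨_, hAB, fun c => ?_⟩
    rw [cartanLie_tmul, map_add, map_add, evalAt_tmul, evalAt_tmul, map_smul, map_smul,
      smul_eq_mul, smul_eq_mul, ← hA' c, ← hB' (b c), mul_comm (A (b c))]
    rfl

/-- Invariant elements are annihilated by the infinitesimal action. -/
theorem cartanLie_eq_zero {γ : CartanForms F G E M} (hγ : γ ∈ cartan F G E M) (c : ι) :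
    cartanLie E M b c γ = 0 := by
  rw [mem_cartan_iff] at hγ
  refine cartanForms_ext E M b fun ξ => forms_ext fun k x v => ?_
  obtain ⟨A, hA, hA'⟩ := hasDerivAtOne_evForm_evalAt E M b γ ξ x v
  simp only [hγ] at hA
  have h := hA.unique (hasDerivAtOne_const _)
  rw [← hA' c, h, map_zero, map_zero]
  rfl

/-- For connected `G`, elements annihilated by the infinitesimal action are invariant: at every
`g`, the derivative of a translate is the derivative at `1` of another translate. -/
theorem mem_cartan_of_cartanLie [ConnectedSpace G] {γ : CartanForms F G E M}
    (hγ : ∀ c, cartanLie E M b c γ = 0) : γ ∈ cartan F G E M := by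
  have hI : IsManifold 𝓘(ℝ, F) 1 G := IsManifold.of_le (n := ∞) (by norm_num)
  have h₀ : ∀ (ξ : GroupLieAlgebra 𝓘(ℝ, F) G) (k : ℕ) (x : M)
      (v : Fin k → TangentSpace 𝓘(ℝ, E) x),
      HasDerivAtOne (fun g : G => evForm x v (evalAt ξ (actCartan F E M g⁻¹ γ)))
        (0 : F →L[ℝ] ℝ) := by
    intro ξ k x v
    obtain ⟨A, hA, hA'⟩ := hasDerivAtOne_evForm_evalAt E M b γ ξ x v
    have hA0 : A = 0 := by
      let b' : Basis ι ℝ F := b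
      refine ContinuousLinearMap.coe_injective (b'.ext fun c => ?_)
      have h := hA' c
      rw [hγ c, map_zero, map_zero] at h
      exact h
    rwa [hA0] at hA
  rw [mem_cartan_iff]
  intro g
  refine cartanForms_ext E M b fun ξ => forms_ext fun k x v => ?_
  have h₁ : ∀ l : G, HasMFDerivAt 𝓘(ℝ, F) 𝓘(ℝ, ℝ)
      (fun g : G => evForm x v (evalAt ξ (actCartan F E M g⁻¹ γ))) l (0 : F →L[ℝ] ℝ) := by
    intro l
    -- the function in question is `H` composed with the right translation by `l⁻¹`
    let H : G → ℝ := fun g => evForm (l • x) (fun i => mfderiv 𝓘(ℝ, E) 𝓘(ℝ, E)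
      (fun z : M => l • z) x (v i)) (evalAt (Ad l ξ) (actCartan F E M g⁻¹ γ))
    have hH : HasMFDerivAt 𝓘(ℝ, F) 𝓘(ℝ, ℝ) H (l * l⁻¹) (0 : F →L[ℝ] ℝ) := by
      have := (h₀ (Ad l ξ) k (l • x) fun i => mfderiv 𝓘(ℝ, E) 𝓘(ℝ, E)
        (fun z : M => l • z) x (v i)).hasMFDerivAt
      rw [mul_inv_cancel]
      exact this
    have hm : MDifferentiableAt 𝓘(ℝ, F) 𝓘(ℝ, F) (fun g : G => g * l⁻¹) l :=
      (contMDiff_mul_right (I := 𝓘(ℝ, F)) (n := ∞) (a := l⁻¹)).mdifferentiableAt (by simp)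
    have hc := HasMFDerivAt.comp l hH hm.hasMFDerivAt
    have hz : ∀ A : F →L[ℝ] F, (0 : F →L[ℝ] ℝ).comp A = 0 :=
      fun A => ContinuousLinearMap.zero_comp A
    refine (hc.congr_mfderiv (hz _)).congr_of_eventuallyEq (Filter.Eventually.of_forall fun p => ?_)
    simp only [H, Function.comp_apply, evalAt_actCartan_inv]
    rw [← evForm_pull (contMDiff_smul_left F l), pull_pull]
    have h₃ : Ad (p * l⁻¹) (Ad l ξ) = Ad p ξ := by
      rw [← LinearMap.comp_apply, ← Ad_mul, inv_mul_cancel_right]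
    have h₄ : (fun z : M => (p * l⁻¹) • l • z) = fun z => p • z := by
      funext z
      rw [smul_smul, inv_mul_cancel_right]
    rw [h₃]
    have h₅ : ∀ (f : M → M) (hf : ContMDiff 𝓘(ℝ, E) 𝓘(ℝ, E) ∞ f), f = (fun z => p • z) →
        ∀ η : Forms E M, pull (fun z : M => p • z) (contMDiff_smul_left F p) η = pull f hf η := by
      rintro f hf rfl η
      rfl
    rw [h₅ _ _ h₄]
  have h₂ := eq_of_hasMFDerivAt_zero h₁ g⁻¹ 1
  simp only [inv_inv] at h₂
  rw [h₂, evalAt_actCartan_inv, Ad_one, pull_eq_self E M _ (one_smul G)]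
  rfl

end Infinitesimal

/-! ### Isomorphic cochain complexes -/

section Cohomology

variable {T T' U : Type*} [AddCommGroup T] [Module ℝ T] [AddCommGroup T'] [Module ℝ T']
  [AddCommGroup U] [Module ℝ U] {C : ℕ → Submodule ℝ T} {δ : T →ₗ[ℝ] T}
  {C' : ℕ → Submodule ℝ T'} {δ' : T' →ₗ[ℝ] T'} {κ : T →ₗ[ℝ] U} {i : T' →ₗ[ℝ] U}

/-- Two complexes that are identified with each other inside a common overspace by injections
`κ` and `i` intertwining the differentials have the same cohomology. -/
theorem exists_coh_equiv (hκ : Function.Injective κ) (hi : Function.Injective i)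
    (hC : ∀ k, (C k).map κ = (C' k).map i)
    (hδ : ∀ k, ∀ x ∈ C k, ∀ y ∈ C' k, κ x = i y → κ (δ x) = i (δ' y)) (k : ℕ) :
    ∃ e : Coh C δ k ≃ₗ[ℝ] Coh C' δ' k, ∀ (z : cocycles C δ k) (z' : cocycles C' δ' k),
      κ z.1 = i z'.1 → e (Submodule.Quotient.mk z) = Submodule.Quotient.mk z' := by
  have h₁ : ∀ k, ∀ x ∈ C k, ∃ y ∈ C' k, κ x = i y := fun k x hx => by
    obtain ⟨y, hy, h⟩ : κ x ∈ (C' k).map i := hC k ▸ Submodule.mem_map_of_mem hx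
    exact ⟨y, hy, h.symm⟩
  have h₂ : ∀ k, ∀ y ∈ C' k, ∃ x ∈ C k, κ x = i y := fun k y hy => by
    have h : i y ∈ (C k).map κ := (hC k).symm ▸ Submodule.mem_map_of_mem hy
    exact h
  have hZ : (cocycles C δ k).map κ = (cocycles C' δ' k).map i := by
    apply le_antisymm
    · rintro _ ⟨x, ⟨hx, hx'⟩, rfl⟩
      obtain ⟨y, hy, h⟩ := h₁ k x hx
      refine ⟨y, ⟨hy, hi ?_⟩, h.symm⟩
      rw [← hδ k x hx y hy h, LinearMap.mem_ker.1 hx', map_zero, map_zero]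
    · rintro _ ⟨y, ⟨hy, hy'⟩, rfl⟩
      obtain ⟨x, hx, h⟩ := h₂ k y hy
      refine ⟨x, ⟨hx, hκ ?_⟩, h⟩
      rw [hδ k x hx y hy h, LinearMap.mem_ker.1 hy', map_zero, map_zero]
  let e₀ : cocycles C δ k ≃ₗ[ℝ] cocycles C' δ' k :=
    (Submodule.equivMapOfInjective κ hκ _).trans ((LinearEquiv.ofEq _ _ hZ).trans
      (Submodule.equivMapOfInjective i hi _).symm)
  have he₀ : ∀ z, i (e₀ z).1 = κ z.1 := fun z => by
    exact congrArg Subtype.val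
      ((Submodule.equivMapOfInjective i hi (cocycles C' δ' k)).apply_symm_apply
        (LinearEquiv.ofEq _ _ hZ (Submodule.equivMapOfInjective κ hκ _ z)))
  have hB : ∀ z, (e₀ z).1 ∈ coboundaries C' δ' k ↔ z.1 ∈ coboundaries C δ k := by
    intro z
    cases k with
    | zero =>
      simp only [coboundaries, Submodule.mem_bot]
      rw [← map_eq_zero_iff i hi, he₀, map_eq_zero_iff κ hκ]
    | succ k =>
      constructor
      · rintro ⟨y, hy, h⟩
        obtain ⟨x, hx, h'⟩ := h₂ k y hy
        refine ⟨x, hx, hκ ?_⟩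
        rw [hδ k x hx y hy h', h, he₀]
      · rintro ⟨x, hx, h⟩
        obtain ⟨y, hy, h'⟩ := h₁ k x hx
        refine ⟨y, hy, hi ?_⟩
        rw [← hδ k x hx y hy h', h, he₀]
  refine ⟨Submodule.Quotient.equiv _ _ e₀ ?_, fun z z' h => ?_⟩
  · ext z'
    rw [Submodule.mem_map_equiv]
    have h := hB (e₀.symm z')
    rw [LinearEquiv.apply_symm_apply] at h
    exact h.symm
  · have : e₀ z = z' := Subtype.ext (hi ((he₀ z).trans h))
    rw [← this]
    rfl

end Cohomology

/-! ### Degrees -/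

section Degrees

variable {F : Type*} [NormedAddCommGroup F] [NormedSpace ℝ F] [FiniteDimensional ℝ F]
  {G : Type*} [TopologicalSpace G] [ChartedSpace F G] [Group G] [LieGroup 𝓘(ℝ, F) ∞ G]
  (E : Type*) [NormedAddCommGroup E] [NormedSpace ℝ E] [FiniteDimensional ℝ E]
  (M : Type*) [TopologicalSpace M] [ChartedSpace E M] [IsManifold 𝓘(ℝ, E) ∞ M]
  [MulAction G M] [ContMDiffSMul 𝓘(ℝ, F) 𝓘(ℝ, E) ∞ G M]
  {ι : Type*} [Fintype ι] [DecidableEq ι] (b : Basis ι ℝ (GroupLieAlgebra 𝓘(ℝ, F) G))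

theorem involute_of_mem_pow {V : Type*} [AddCommGroup V] [Module ℝ V] {p : ℕ} {l : Ext V}
    (hl : l ∈ LinearMap.range (ExteriorAlgebra.ι ℝ (M := Dual ℝ V)) ^ p) :
    CliffordAlgebra.involute l = (-1 : ℝ) ^ p • l := by
  induction hl using Submodule.pow_induction_on_left' with
  | algebraMap r => simp
  | add x y i hx hy h₁ h₂ => rw [map_add, h₁, h₂, smul_add]
  | mem_mul m hm i x hx ih =>
    obtain ⟨m, rfl⟩ := hm
    have h : CliffordAlgebra.involute (ExteriorAlgebra.ι ℝ m) = - ExteriorAlgebra.ι ℝ m :=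
      CliffordAlgebra.involute_ι _
    rw [map_mul, ih, h, pow_succ, mul_smul_comm, neg_mul]
    module

theorem weilDeg_tmul_mem {p q r k : ℕ} {l : Ext (GroupLieAlgebra 𝓘(ℝ, F) G)}
    {s : Sym (GroupLieAlgebra 𝓘(ℝ, F) G)}
    (hl : l ∈ LinearMap.range
      (ExteriorAlgebra.ι ℝ (M := Dual ℝ (GroupLieAlgebra 𝓘(ℝ, F) G))) ^ p)
    (hs : s ∈ LinearMap.range
      (SymmetricAlgebra.ι ℝ (Dual ℝ (GroupLieAlgebra 𝓘(ℝ, F) G))) ^ q)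
    (η : Form E M r) (h : p + 2 * q + r = k) :
    (l ⊗ₜ[ℝ] s) ⊗ₜ[ℝ] DirectSum.lof ℝ ℕ (fun k => Form E M k) r η ∈ weilDeg F G E M k :=
  Submodule.subset_span ⟨p, q, r, l, s, η, hl, hs, h, rfl⟩

theorem cartanFormsDeg_tmul_mem {q r k : ℕ} {s : Sym (GroupLieAlgebra 𝓘(ℝ, F) G)}
    (hs : s ∈ LinearMap.range
      (SymmetricAlgebra.ι ℝ (Dual ℝ (GroupLieAlgebra 𝓘(ℝ, F) G))) ^ q)
    (η : Form E M r) (h : 2 * q + r = k) :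
    s ⊗ₜ[ℝ] DirectSum.lof ℝ ℕ (fun k => Form E M k) r η ∈ cartanFormsDeg F G E M k :=
  Submodule.subset_span ⟨q, r, s, η, hs, h, rfl⟩

theorem cartanIncl_mem_weilDeg {k : ℕ} {γ : CartanForms F G E M}
    (hγ : γ ∈ cartanFormsDeg F G E M k) : cartanIncl F G E M γ ∈ weilDeg F G E M k := by
  have h : cartanFormsDeg F G E M k ≤ (weilDeg F G E M k).comap (cartanIncl F G E M) := by
    refine Submodule.span_le.2 ?_
    rintro _ ⟨q, r, s, η, hs, h, rfl⟩
    refine weilDeg_tmul_mem E M (p := 0) ?_ hs η (by omega)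
    rw [pow_zero]
    exact Submodule.one_le.1 le_rfl
  exact h hγ

theorem cartanProj_mem {k : ℕ} {x : WeilForms F G E M} (hx : x ∈ weilDeg F G E M k) :
    cartanProj F G E M x ∈ cartanFormsDeg F G E M k := by
  have h : weilDeg F G E M k ≤ (cartanFormsDeg F G E M k).comap (cartanProj F G E M) := by
    refine Submodule.span_le.2 ?_
    rintro _ ⟨p, q, r, l, s, η, hl, hs, h, rfl⟩
    rw [SetLike.mem_coe, Submodule.mem_comap, cartanProj_tmul]
    rcases Nat.eq_zero_or_pos p with rfl | hp
    · exact cartanFormsDeg_tmul_mem E M (Submodule.smul_mem _ _ hs) η (by omega)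
    · rw [algebraMapInv_of_mem_pow hl hp, zero_smul, TensorProduct.zero_tmul]
      exact Submodule.zero_mem _
  exact h hx

/-- `θ^a ι_{X_a}` raises the degree in `Λ(𝔤^*)` by one and lowers that in `Ω(M)` by one. -/
theorem mul_iota_mem_weilDeg (a : ι) {k : ℕ} {x : WeilForms F G E M}
    (hx : x ∈ weilDeg F G E M k) :
    (opTheta E M b a * opOdd F G (iota (fundVF E M (b a)))) x ∈ weilDeg F G E M k := by
  have h : weilDeg F G E M k ≤ (weilDeg F G E M k).comap
      (opTheta E M b a * opOdd F G (iota (fundVF E M (b a)))) := by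
    refine Submodule.span_le.2 ?_
    rintro _ ⟨p, q, r, l, s, η, hl, hs, h, rfl⟩
    change ((theta b a * CliffordAlgebra.involute l) ⊗ₜ[ℝ] s) ⊗ₜ[ℝ]
      iota (fundVF E M (b a)) (DirectSum.lof ℝ ℕ (fun k => Form E M k) r η) ∈ weilDeg F G E M k
    cases r with
    | zero =>
      rw [iota_lof_zero, TensorProduct.tmul_zero]
      exact Submodule.zero_mem _
    | succ r =>
      rw [iota_lof_succ, involute_of_mem_pow hl]
      refine weilDeg_tmul_mem E M (p := p + 1) ?_ hs _ (by omega)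
      rw [pow_succ']
      exact Submodule.mul_mem_mul (LinearMap.mem_range_self _ _) (Submodule.smul_mem _ _ hl)
  exact h hx

theorem nilExp_mem {T : Type*} [AddCommGroup T] [Module ℝ T] {A : Module.End ℝ T}
    {S : Submodule ℝ T} (hA : ∀ x ∈ S, A x ∈ S) {x : T} (hx : x ∈ S) : nilExp A x ∈ S := by
  have h : ∀ n : ℕ, (A ^ n) x ∈ S := fun n => by
    induction n with
    | zero => exact hx
    | succ n ih => rw [pow_succ']; exact hA _ ih
  rw [nilExp, LinearMap.sum_apply]
  exact Submodule.sum_mem _ fun n _ => Submodule.smul_mem _ _ (h n)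

theorem thetaContr_mem {k : ℕ} {x : WeilForms F G E M} (hx : x ∈ weilDeg F G E M k) :
    (thetaContr E M b : Module.End ℝ (WeilForms F G E M)) x ∈ weilDeg F G E M k := by
  rw [thetaContr_eq, LinearMap.neg_apply, LinearMap.sum_apply]
  exact Submodule.neg_mem _ (Submodule.sum_mem _ fun a _ => mul_iota_mem_weilDeg E M b a hx)

theorem kalkman_mem {k : ℕ} {x : WeilForms F G E M} (hx : x ∈ weilDeg F G E M k) :
    kalkman E M b x ∈ weilDeg F G E M k :=
  nilExp_mem (fun _ hy => Submodule.neg_mem _ (thetaContr_mem E M b hy)) hx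

theorem inverse_kalkman_mem {k : ℕ} {x : WeilForms F G E M} (hx : x ∈ weilDeg F G E M k) :
    Ring.inverse (kalkman E M b) x ∈ weilDeg F G E M k := by
  rw [kalkman, inverse_nilExp (isNilpotent_thetaContr E M b).neg, neg_neg]
  exact nilExp_mem (fun _ hy => thetaContr_mem E M b hy) hx

theorem cartanD_mem_cartanFormsDeg {k : ℕ} {γ : CartanForms F G E M}
    (hγ : γ ∈ cartanFormsDeg F G E M k) :
    cartanD E M b γ ∈ cartanFormsDeg F G E M (k + 1) := by
  have h : cartanFormsDeg F G E M k ≤ (cartanFormsDeg F G E M (k + 1)).comap (cartanD E M b) := by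
    refine Submodule.span_le.2 ?_
    rintro _ ⟨q, r, s, η, hs, h, rfl⟩
    rw [SetLike.mem_coe, Submodule.mem_comap, cartanD, LinearMap.sub_apply, LinearMap.sum_apply]
    refine Submodule.sub_mem _ ?_ (Submodule.sum_mem _ fun a _ => ?_)
    · rw [TensorProduct.map_tmul, dR_lof]
      exact cartanFormsDeg_tmul_mem E M hs _ (by omega)
    · rw [TensorProduct.map_tmul]
      cases r with
      | zero =>
        rw [iota_lof_zero, TensorProduct.tmul_zero]
        exact Submodule.zero_mem _
      | succ r =>
        rw [iota_lof_succ]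
        refine cartanFormsDeg_tmul_mem E M (q := q + 1) ?_ _ (by omega)
        rw [pow_succ']
        exact Submodule.mul_mem_mul (LinearMap.mem_range_self _ _) hs
  exact h hγ

end Degrees

/-! ### Basic elements and the Cartan complex -/

section Basic

variable {F : Type*} [NormedAddCommGroup F] [NormedSpace ℝ F] [FiniteDimensional ℝ F]
  {G : Type*} [TopologicalSpace G] [ChartedSpace F G] [Group G] [LieGroup 𝓘(ℝ, F) ∞ G]
  (E : Type*) [NormedAddCommGroup E] [NormedSpace ℝ E] [FiniteDimensional ℝ E]
  (M : Type*) [TopologicalSpace M] [ChartedSpace E M] [IsManifold 𝓘(ℝ, E) ∞ M]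
  [MulAction G M] [ContMDiffSMul 𝓘(ℝ, F) 𝓘(ℝ, E) ∞ G M]
  {ι : Type*} [Fintype ι] [DecidableEq ι] (b : Basis ι ℝ (GroupLieAlgebra 𝓘(ℝ, F) G))

theorem lieD_eq_sum (ξ : GroupLieAlgebra 𝓘(ℝ, F) G) (η : Forms E M) :
    lieD E M ξ η = ∑ c, b.coord c ξ • lieD E M (b c) η := by
  simp only [lieD, LinearMap.add_apply, LinearMap.comp_apply, iota_fundVF_eq_sum E M b ξ,
    LinearMap.sum_apply, LinearMap.smul_apply, map_sum, map_smul, smul_add, Finset.sum_add_distrib]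

/-- The infinitesimal coadjoint action of `ξ` on a polynomial vanishes at `ξ`, as `[ξ, ξ] = 0`. -/
theorem sum_eval_symLie (ξ : GroupLieAlgebra 𝓘(ℝ, F) G) (s : Sym (GroupLieAlgebra 𝓘(ℝ, F) G)) :
    ∑ c, b.coord c ξ * SymmetricAlgebra.lift (Dual.eval ℝ _ ξ) (symLie b c s) = 0 := by
  have h : ∀ c, b.coord c ξ * SymmetricAlgebra.lift (Dual.eval ℝ _ ξ) (symLie b c s) =
      - ∑ a, ∑ e, structConst b a c e * (b.coord c ξ * b.coord e ξ *
        SymmetricAlgebra.lift (Dual.eval ℝ _ ξ) (partialSym b a s)) := by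
    intro c
    simp only [symLie, LinearMap.neg_apply, LinearMap.sum_apply, LinearMap.smul_apply,
      LinearMap.comp_apply, LinearMap.mulLeft_apply, map_neg, map_sum, map_smul, map_mul, phi,
      SymmetricAlgebra.lift_ι_apply, Dual.eval_apply, smul_eq_mul, mul_neg, Finset.mul_sum]
    congr 1
    exact Finset.sum_congr rfl fun a _ => Finset.sum_congr rfl fun e _ => by ring
  simp only [h, Finset.sum_neg_distrib, neg_eq_zero]
  rw [Finset.sum_comm]
  refine Finset.sum_eq_zero fun a _ => ?_
  rw [← self_eq_neg, ← Finset.sum_neg_distrib]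
  conv_lhs => rw [Finset.sum_comm]
  refine Finset.sum_congr rfl fun c _ => ?_
  rw [← Finset.sum_neg_distrib]
  refine Finset.sum_congr rfl fun e _ => ?_
  rw [structConst_swap]
  ring

/-- `∑_c ξ^c (𝓛_c γ)(ξ) = L_ξ (γ(ξ))` for the infinitesimal action `𝓛`: the contribution of the
polynomial factor vanishes. -/
theorem sum_evalAt_cartanLie (ξ : GroupLieAlgebra 𝓘(ℝ, F) G) (γ : CartanForms F G E M) :
    ∑ c, b.coord c ξ • evalAt ξ (cartanLie E M b c γ) = lieD E M ξ (evalAt ξ γ) := by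
  induction γ using TensorProduct.induction_on with
  | zero => simp
  | add x y hx hy => simp only [map_add, smul_add, Finset.sum_add_distrib, hx, hy]
  | tmul s η =>
    simp only [cartanLie_tmul, map_add, evalAt_tmul, smul_add, Finset.sum_add_distrib, smul_smul,
      ← Finset.sum_smul, sum_eval_symLie, zero_smul, add_zero, map_smul]
    rw [lieD_eq_sum E M b ξ η, Finset.smul_sum]
    exact Finset.sum_congr rfl fun c _ => by rw [smul_smul, mul_comm]

/-- `(d_G^2 γ)(ξ) = - L_ξ (γ(ξ))`, which vanishes for invariant `γ`. -/
theorem cartanD_cartanD {γ : CartanForms F G E M} (hγ : γ ∈ cartan F G E M) :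
    cartanD E M b (cartanD E M b γ) = 0 := by
  refine cartanForms_ext E M b fun ξ => ?_
  have h : lieD E M ξ (evalAt ξ γ) = 0 := by
    rw [← sum_evalAt_cartanLie E M b]
    simp only [cartanLie_eq_zero E M b hγ, map_zero, smul_zero, Finset.sum_const_zero]
  have h' : dR (iota (fundVF E M ξ) (evalAt ξ γ)) + iota (fundVF E M ξ) (dR (evalAt ξ γ)) = 0 := h
  rw [evalAt_cartanD, evalAt_cartanD, map_sub, map_sub, dR_dR, iota_iota_self, map_zero, zero_sub,
    sub_zero, ← neg_add', h', neg_zero]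

theorem opContr_opTheta_cartanIncl (a c : ι) (γ : CartanForms F G E M) :
    opContr E M b a (opTheta E M b c (cartanIncl F G E M γ)) =
      if a = c then cartanIncl F G E M γ else 0 := by
  have h := LinearMap.congr_fun ((weilRelations E M b).ct_th a c) (cartanIncl F G E M γ)
  rw [Module.End.mul_apply, LinearMap.sub_apply, Module.End.mul_apply, opContr_cartanIncl,
    map_zero, sub_zero] at h
  rw [h]
  split_ifs <;> rfl

/-- `κ` identifies the elements satisfying the infinitesimal conditions for being basic with the
elements of `S(𝔤^*) ⊗ Ω(M)` annihilated by the infinitesimal action. -/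
theorem mem_infBasic_iff {x : WeilForms F G E M} : x ∈ infBasic E M b ↔
    ∃ γ, kalkman E M b x = cartanIncl F G E M γ ∧ ∀ c, cartanLie E M b c γ = 0 := by
  have h₁ : ∀ γ, kalkman E M b x = cartanIncl F G E M γ → ∀ a,
      kalkman E M b (totalContr E M b a (totalD E M b x)) =
        cartanIncl F G E M (cartanLie E M b a γ) := by
    intro γ hγ a
    rw [kalkman_totalContr, kalkman_totalD_of_eq E M b hγ, map_add, map_sum, opContr_cartanIncl,
      zero_add]
    simp only [opContr_opTheta_cartanIncl, Finset.sum_ite_eq, Finset.mem_univ, if_true]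
  simp only [infBasic, Submodule.mem_iInf, Submodule.mem_inf, LinearMap.mem_ker]
  constructor
  · intro h
    have hγ := (cartanIncl_cartanProj E M b (x := kalkman E M b x) fun a => by
      rw [← kalkman_totalContr, (h a).1, map_zero]).symm
    refine ⟨_, hγ, fun c => cartanIncl_injective E M ?_⟩
    have h₂ := (h c).2
    rw [totalLie, LinearMap.add_apply, LinearMap.comp_apply, (h c).1, map_zero, zero_add,
      LinearMap.comp_apply] at h₂
    rw [← h₁ _ hγ c, h₂, map_zero, map_zero]
  · rintro ⟨γ, hγ, hL⟩ a
    have h₂ : totalContr E M b a x = 0 := kalkman_injective E M b (by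
      rw [kalkman_totalContr, hγ, opContr_cartanIncl, map_zero])
    refine ⟨h₂, kalkman_injective E M b ?_⟩
    rw [totalLie, LinearMap.add_apply, LinearMap.comp_apply, h₂, map_zero, zero_add,
      LinearMap.comp_apply, h₁ γ hγ, hL, map_zero, map_zero]

/-- `κ` identifies the basic elements with the Cartan complex. Infinitesimal invariance need not be
asked for, since it follows from invariance under `G`. -/
theorem mem_weilBasic_iff {x : WeilForms F G E M} : x ∈ weilBasic E M b ↔
    ∃ γ ∈ cartan F G E M, kalkman E M b x = cartanIncl F G E M γ := by
  have h₁ : ∀ γ, kalkman E M b x = cartanIncl F G E M γ →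
      ((∀ g : G, actWeil F E M g x = x) ↔ γ ∈ cartan F G E M) := by
    intro γ hγ
    rw [mem_cartan_iff]
    refine forall_congr' fun g => ?_
    rw [← (kalkman_injective E M b).eq_iff, kalkman_actWeil, hγ, actWeil_cartanIncl,
      (cartanIncl_injective E M).eq_iff]
  have h₂ : x ∈ weilBasic E M b ↔ x ∈ infBasic E M b ∧ ∀ g : G, actWeil F E M g x = x := by
    simp [weilBasic, Submodule.mem_iInf]
  rw [h₂, mem_infBasic_iff]
  constructor
  · rintro ⟨⟨γ, hγ, -⟩, h⟩
    exact ⟨γ, (h₁ γ hγ).1 h, hγ⟩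
  · rintro ⟨γ, h, hγ⟩
    exact ⟨⟨γ, hγ, cartanLie_eq_zero E M b h⟩, (h₁ γ hγ).2 h⟩

theorem map_kalkman_weilBasic : (weilBasic E M b).map (kalkman E M b) =
    (cartan F G E M).map (cartanIncl F G E M) := by
  apply le_antisymm
  · rintro _ ⟨x, hx, rfl⟩
    obtain ⟨γ, hγ, h⟩ := (mem_weilBasic_iff E M b).1 hx
    exact ⟨γ, hγ, h.symm⟩
  · rintro _ ⟨γ, hγ, rfl⟩
    refine ⟨Ring.inverse (kalkman E M b) (cartanIncl F G E M γ), ?_, kalkman_inverse E M b _⟩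
    exact (mem_weilBasic_iff E M b).2 ⟨γ, hγ, kalkman_inverse E M b _⟩

theorem map_kalkman_weilBasicDeg (k : ℕ) : (weilBasicDeg E M b k).map (kalkman E M b) =
    (cartanDeg F G E M k).map (cartanIncl F G E M) := by
  apply le_antisymm
  · rintro _ ⟨x, ⟨hx, hk⟩, rfl⟩
    obtain ⟨γ, hγ, h⟩ := (mem_weilBasic_iff E M b).1 hx
    refine ⟨γ, ⟨hγ, ?_⟩, h.symm⟩
    rw [← cartanProj_cartanIncl E M γ, ← h]
    exact cartanProj_mem E M (kalkman_mem E M b hk)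
  · rintro _ ⟨γ, ⟨hγ, hk⟩, rfl⟩
    refine ⟨Ring.inverse (kalkman E M b) (cartanIncl F G E M γ), ⟨?_, ?_⟩, kalkman_inverse E M b _⟩
    · exact (mem_weilBasic_iff E M b).2 ⟨γ, hγ, kalkman_inverse E M b _⟩
    · exact inverse_kalkman_mem E M b (cartanIncl_mem_weilDeg E M hk)

theorem kalkman_totalD_of_mem_cartan {x : WeilForms F G E M} {γ : CartanForms F G E M}
    (hγ : γ ∈ cartan F G E M) (hx : kalkman E M b x = cartanIncl F G E M γ) :
    kalkman E M b (totalD E M b x) = cartanIncl F G E M (cartanD E M b γ) := by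
  rw [kalkman_totalD_of_eq E M b hx]
  simp only [cartanLie_eq_zero E M b hγ, map_zero, Finset.sum_const_zero, add_zero]

theorem isComplex_cartanDeg : IsComplex (cartanDeg F G E M) (cartanD E M b) := fun _ _ h =>
  ⟨⟨cartanD_mem_cartan E M b h.1, cartanD_mem_cartanFormsDeg E M b h.2⟩, cartanD_cartanD E M b h.1⟩

/-- The Weil complex inherits the properties of a complex from the Cartan complex through `κ`. -/
theorem isComplex_weilBasicDeg : IsComplex (weilBasicDeg E M b) (totalD E M b) := by
  intro k x hx
  obtain ⟨γ, hγ, h⟩ : kalkman E M b x ∈ (cartanDeg F G E M k).map (cartanIncl F G E M) :=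
    map_kalkman_weilBasicDeg E M b k ▸ Submodule.mem_map_of_mem hx
  have h₁ := kalkman_totalD_of_mem_cartan E M b hγ.1 h.symm
  obtain ⟨hd, hd'⟩ := isComplex_cartanDeg E M b k γ hγ
  constructor
  · obtain ⟨y, hy, h₂⟩ : cartanIncl F G E M (cartanD E M b γ) ∈
        (weilBasicDeg E M b (k + 1)).map (kalkman E M b) :=
      (map_kalkman_weilBasicDeg E M b (k + 1)).symm ▸ Submodule.mem_map_of_mem hd
    rwa [← kalkman_injective E M b (h₂.trans h₁.symm)]
  · apply kalkman_injective E M b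
    rw [kalkman_totalD_of_mem_cartan E M b hd.1 h₁, hd', map_zero, map_zero]

theorem weilBasic_eq_infBasic [ConnectedSpace G] : weilBasic E M b = infBasic E M b := by
  refine le_antisymm inf_le_left fun x hx => ?_
  obtain ⟨γ, hγ, hL⟩ := (mem_infBasic_iff E M b).1 hx
  exact (mem_weilBasic_iff E M b).2 ⟨γ, mem_cartan_of_cartanLie E M b hL, hγ⟩

end Basic

end EquivCoh

end

theorem mainTheorem2
    {F : Type*} [NormedAddCommGroup F] [NormedSpace ℝ F] [FiniteDimensional ℝ F]
    {G : Type*} [TopologicalSpace G] [T2Space G] [CompactSpace G] [ChartedSpace F G] [Group G]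
    [LieGroup 𝓘(ℝ, F) ∞ G]
    {E : Type*} [NormedAddCommGroup E] [NormedSpace ℝ E] [FiniteDimensional ℝ E]
    {M : Type*} [TopologicalSpace M] [T2Space M] [SecondCountableTopology M] [ChartedSpace E M]
    [IsManifold 𝓘(ℝ, E) ∞ M]
    [MulAction G M] [ContMDiffSMul 𝓘(ℝ, F) 𝓘(ℝ, E) ∞ G M]
    {ι : Type*} [Fintype ι] [DecidableEq ι] (b : Basis ι ℝ (GroupLieAlgebra 𝓘(ℝ, F) G)) :
    -- the exponential defining `κ` is that of a nilpotent operator, and `κ` is invertible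
    IsNilpotent (EquivCoh.thetaContr E M b : Module.End ℝ (EquivCoh.WeilForms F G E M)) ∧
    IsUnit (EquivCoh.kalkman E M b) ∧
    Function.Injective (EquivCoh.cartanIncl F G E M) ∧
    -- `κ ∘ (d_W ⊗ 1 + 1 ⊗ d) ∘ κ⁻¹ = d_G` on the Cartan complex
    (∀ α ∈ EquivCoh.cartan F G E M,
      EquivCoh.kalkman E M b (EquivCoh.totalD E M b
        (Ring.inverse (EquivCoh.kalkman E M b) (EquivCoh.cartanIncl F G E M α))) =
      EquivCoh.cartanIncl F G E M (EquivCoh.cartanD E M b α)) ∧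
    -- `κ` maps the basic subcomplex of the Weil model onto the Cartan complex, in every degree
    (EquivCoh.weilBasic E M b).map (EquivCoh.kalkman E M b) =
      (EquivCoh.cartan F G E M).map (EquivCoh.cartanIncl F G E M) ∧
    (∀ k, (EquivCoh.weilBasicDeg E M b k).map (EquivCoh.kalkman E M b) =
      (EquivCoh.cartanDeg F G E M k).map (EquivCoh.cartanIncl F G E M)) ∧
    -- both are cochain complexes, and `κ` induces an isomorphism in cohomology
    EquivCoh.IsComplex (EquivCoh.weilBasicDeg E M b) (EquivCoh.totalD E M b) ∧
    EquivCoh.IsComplex (EquivCoh.cartanDeg F G E M) (EquivCoh.cartanD E M b) ∧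
    (∀ k, ∃ e : EquivCoh.Coh (EquivCoh.weilBasicDeg E M b) (EquivCoh.totalD E M b) k ≃ₗ[ℝ]
        EquivCoh.Coh (EquivCoh.cartanDeg F G E M) (EquivCoh.cartanD E M b) k,
      ∀ (z : EquivCoh.cocycles (EquivCoh.weilBasicDeg E M b) (EquivCoh.totalD E M b) k)
        (z' : EquivCoh.cocycles (EquivCoh.cartanDeg F G E M) (EquivCoh.cartanD E M b) k),
        EquivCoh.kalkman E M b z.1 = EquivCoh.cartanIncl F G E M z'.1 →
          e (Submodule.Quotient.mk z) = Submodule.Quotient.mk z') ∧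
    -- for connected `G`, invariance under `G` follows from invariance under all `L_{e_a}`
    (ConnectedSpace G → EquivCoh.weilBasic E M b = EquivCoh.infBasic E M b) := by
  refine ⟨EquivCoh.isNilpotent_thetaContr E M b, EquivCoh.isUnit_kalkman E M b,
    EquivCoh.cartanIncl_injective E M, fun α hα => ?_, EquivCoh.map_kalkman_weilBasic E M b,
    EquivCoh.map_kalkman_weilBasicDeg E M b, EquivCoh.isComplex_weilBasicDeg E M b,
    EquivCoh.isComplex_cartanDeg E M b, fun k => ?_, fun _ => EquivCoh.weilBasic_eq_infBasic E M b⟩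
  · exact EquivCoh.kalkman_totalD_of_mem_cartan E M b hα (EquivCoh.kalkman_inverse E M b _)
  · refine EquivCoh.exists_coh_equiv (EquivCoh.kalkman_injective E M b)
      (EquivCoh.cartanIncl_injective E M) (EquivCoh.map_kalkman_weilBasicDeg E M b) ?_ k
    exact fun _ _ _ _ hγ h => EquivCoh.kalkman_totalD_of_mem_cartan E M b hγ.1 h
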